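/- Let $\mathcal N$ be the space of locally finite subsets of $\mathbb R^d$, with the $\sigma$-algebra generated by the counts of points in bounded Borel sets, and put $\tau_x\mathbf s=\{s-x:s\in\mathbf s\}$. For $s\in\mathbf s\in\mathcal N$ let $\mathrm{Vor}(s,\mathbf s)=\{x:|x-s|\le|x-s'|\ \forall s'\in\mathbf s\}$. For $s,s'\in\mathbf s$ let $b(s,s',\mathbf s)=\mathrm{Vor}(s,\mathbf s)\cap\mathrm{Vor}(s',\mathbf s)$. Let $a(s,s',\mathbf s)=1$ if $s\ne s'$ and $b(s,s',\mathbf s)$ has dimension $d-1$ (then $s,s'$ are neighbours), $a(s,s',\mathbf s)=0$ otherwise, and $a(s,\mathbf s)=\sum_{s'\in\mathbf s}a(s,s',\mathbf s)$. Let $S$ be a stationary point process in $\mathbb R^d$ of intensity $1$, with Palm version $S^\circ$, whose law is $A\mapsto\mathcal E\,\#\{s\in S\cap[0,1)^d:\tau_sS\in A\}$. Assume: (A1) the law of $S$ is mixing under translations; (A2) for every ball $B$, $|S\cap\partial B|<d+2$ almost surely; (A3) $\mathcal E\exp(\beta a(0,S^\circ))<\infty$ for some $\beta>0$; (A4) $\mathcal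 E[\ell_{d-1}(\partial\mathrm{Vor}(0,S^\circ))^2]<\infty$, where $\ell_{d-1}$ is $(d-1)$-dimensional Lebesgue measure; (A5) $\mathcal E[\sum_{s\in S^\circ}a(0,s,S^\circ)|s|^r]<\infty$ for some $r>4$; (A6) almost surely $\tau_xS\ne S$ for all $x\neq0$. A surface $\eta$ assigns a real number $\eta(s,\mathbf s)$ to each $s\in\mathbf s\in\mathcal N$; its gradient is $\nabla\eta(s,s',\mathbf s)=a(s,s',\mathbf s)[\eta(s',\mathbf s)-\eta(s,\mathbf s)]$. A field $\zeta(s,s',\mathbf s)$, $s,s'\in\mathbf s\in\mathcal N$, is covariant if $\zeta(s'-s,s''-s,\tau_s\mathbf s)=\zeta(s',s'',\mathbf s)$ for all $\mathbf s\in\mathcal N$ and $s,s',s''\in\mathbf s$. Let $\mathcal C$ be the measure with $\mathcal C(\zeta)=\frac12\mathcal E\sum_{s\in S^\circ}a(0,s,S^\circ)\zeta(0,s,S^\circ)$ and let $\mathcal H=L^2(\mathcal C)$. For a unit vector $u$ let $$\omega_u(0,s,S^\circ)=\mathrm{sgn}(s\cdot u)\,a(0,s,S^\circ)\,\ell_{d-1}(b_u(0,s,S^\circ)),$$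 where $b_u$ is the orthogonal projection of $b$ onto the hyperplane perpendicular to $u$. The integrated tilt of $\eta$ in direction $u$ is $J_u(\eta)=\mathcal C(\nabla\eta\cdot\omega_u)$. If $\eta$ depends on further randomness, $\mathcal H$ and $J_u$ are defined in the same way, with the expectation taken over all the randomness. Let $T=(T_n)$ be independent Poisson processes on $\mathbb R$ of intensity $1$, independent of $S^\circ$, and attach $T_n$ to the $n$-th point of $S^\circ$ in an arbitrary measurable enumeration. For $t\ge0$ let $p_t(s,s',S^\circ,T)$ be the probability, given $(S^\circ,T)$, that the walk which starts at $s$ at time $t$, runs backward in time, and at each epoch in $(0,t]$ of the point where it sits jumps to a uniformly chosen neighbour of that point, is at $s'$ at time $0$. The harness process started from a surface $\gamma$ is $\eta^\gamma_t(s,S^\circ,T)=\sum_{s'\in S^\circ}p_t(s,s',S^\circ,T)\,\gamma(s',S^\circ)$. Then $\omega_u\in\mathcal H$ for every unit vector $u$. Moreover, for every unit vector $u$, every surface $\gamma$ whose gradient is covariant and satisfies $\nabla\gamma\in\mathcal H$, and every $t\ge0$: almost surely the series defining $\eta^\gamma_t(s,S^\circ,T)$ converges absolutely for all $s\in S^\circ$;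 $\nabla\eta^\gamma_t\in\mathcal H$; and $$J_u(\eta^\gamma_t)=J_u(\gamma).$$ -/

import Mathlib

open MeasureTheory ProbabilityTheory Filter Topology Set
open scoped ENNReal NNReal MeasureTheory

namespace HarnessTilt

noncomputable section

/-- The space `ℝ^d` with its Euclidean norm. -/
abbrev Pt (d : ℕ) : Type := EuclideanSpace ℝ (Fin d)

/-! ### Point configurations -/

/-- Locally finite subsets of `X` (finitely many points in every bounded set). -/
structure Config (X : Type*) [PseudoMetricSpace X] where
  /-- the set of points -/
  carrier : Set X
  locallyFinite : ∀ B : Set X, Bornology.IsBounded B → (carrier ∩ B).Finite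

instance {X : Type*} [PseudoMetricSpace X] : Membership X (Config X) :=
  ⟨fun S x => x ∈ S.carrier⟩

/-- The σ-algebra generated by the sets `{S : |S ∩ B| = k}`, with `B` bounded Borel and `k ≥ 1`. -/
instance {X : Type*} [PseudoMetricSpace X] [MeasurableSpace X] : MeasurableSpace (Config X) :=
  MeasurableSpace.generateFrom
    {A | ∃ (B : Set X) (k : ℕ), Bornology.IsBounded B ∧ MeasurableSet B ∧ 1 ≤ k ∧
      A = {S : Config X | (S.carrier ∩ B).ncard = k}}

variable {d : ℕ}

/-- The translate `τ_x S = {s - x : s ∈ S}`. -/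
def translate (x : Pt d) (S : Config (Pt d)) : Config (Pt d) where
  carrier := (fun s => s - x) '' S.carrier
  locallyFinite := by
    intro B hB
    have hB' : Bornology.IsBounded ((fun s => s + x) '' B) := by
      rw [isBounded_iff_forall_norm_le] at hB ⊢
      obtain ⟨C, hC⟩ := hB
      refine ⟨C + ‖x‖, ?_⟩
      rintro _ ⟨y, hy, rfl⟩
      exact (norm_add_le _ _).trans (by linarith [hC y hy])
    refine ((S.locallyFinite _ hB').image (fun s => s - x)).subset ?_
    rintro _ ⟨⟨s, hs, rfl⟩, hsB⟩
    exact ⟨s, ⟨hs, s - x, hsB, by simp⟩, rfl⟩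

/-! ### Voronoi cells and the neighbour graph -/

/-- The closed Voronoi cell of `s` in `S`. -/
def vor (S : Config (Pt d)) (s : Pt d) : Set (Pt d) :=
  {x | ∀ s' ∈ S, dist x s ≤ dist x s'}

/-- The common side `b(s, s', S)` of the Voronoi cells of `s` and `s'`. -/
def side (S : Config (Pt d)) (s s' : Pt d) : Set (Pt d) := vor S s ∩ vor S s'

/-- Two distinct points of `S` are Voronoi neighbours if the (convex) set in which their cells meet
has dimension `d - 1`. -/
def IsNeighbour (S : Config (Pt d)) (s s' : Pt d) : Prop :=
  s ∈ S ∧ s' ∈ S ∧ s ≠ s' ∧ (side S s s').Nonempty ∧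
    Module.finrank ℝ (vectorSpan ℝ (side S s s')) + 1 = d

/-- The set of Voronoi neighbours of `s` in `S`. -/
def neighbours (S : Config (Pt d)) (s : Pt d) : Set (Pt d) := {s' | IsNeighbour S s s'}

open Classical in
/-- The conductance `a(s, s', S)`. -/
def conductance (S : Config (Pt d)) (s s' : Pt d) : ℝ := if IsNeighbour S s s' then 1 else 0

/-- The number `a(s, S)` of neighbours of `s` (used for finite neighbourhoods). -/
def degree (S : Config (Pt d)) (s : Pt d) : ℕ := (neighbours S s).ncard

/-! ### Stationary point processes and their Palm version -/

/-- The half-open unit cube `[0, 1)^d`. -/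
def unitCube (d : ℕ) : Set (Pt d) := {x | ∀ i, 0 ≤ x i ∧ x i < 1}

/-- The law of the Palm version of a stationary point process with law `Q` and intensity `1`:
`A ↦ E #{s ∈ S ∩ [0,1)^d : τ_s S ∈ A}`. -/
def palm (Q : Measure (Config (Pt d))) : Measure (Config (Pt d)) :=
  Q.bind fun S => Measure.sum fun s : ↥(S.carrier ∩ unitCube d) =>
    Measure.dirac (translate (s : Pt d) S)

/-- The standing assumptions on the law `Q` of the point process: stationarity, intensity one and
the conditions A1 to A6. -/
structure StandingAssumptions (Q : Measure (Config (Pt d))) : Prop where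
  stationary : ∀ x : Pt d, MeasurePreserving (translate x) Q Q
  intensity_one : ∫⁻ S, ((S.carrier ∩ unitCube d).encard : ℝ≥0∞) ∂Q = 1
  /-- A1: the process is mixing under translations. -/
  mixing : ∀ A B : Set (Config (Pt d)), MeasurableSet A → MeasurableSet B →
    Tendsto (fun x : Pt d => Q (A ∩ translate x ⁻¹' B)) (Bornology.cobounded (Pt d))
      (𝓝 (Q A * Q B))
  /-- A2: the boundary of any given ball a.s. contains fewer than `d + 2` points. -/
  sphere : ∀ (c : Pt d) (r : ℝ), 0 < r →
    ∀ᵐ S ∂Q, (S.carrier ∩ Metric.sphere c r).encard < (d + 2 : ℕ)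
  /-- A3: the number of neighbours of the origin has a finite exponential moment. -/
  degree_exp : (∀ᵐ S ∂palm Q, (neighbours S 0).Finite) ∧
    ∃ β : ℝ, 0 < β ∧ ∫⁻ S, ENNReal.ofReal (Real.exp (β * degree S 0)) ∂palm Q < ⊤
  /-- A4: the surface area of the Voronoi cell of the origin has a finite second moment. -/
  surface_sq : ∫⁻ S, (μHE[d - 1] (frontier (vor S 0))) ^ 2 ∂palm Q < ⊤
  /-- A5: moments of the edge lengths at the origin. -/
  edge_moment : ∃ r : ℝ, 4 < r ∧
    ∫⁻ S, ∑' s : ↥(neighbours S 0), ENNReal.ofReal (‖(s : Pt d)‖ ^ r) ∂palm Q < ⊤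
  /-- A6: the process is a.s. aperiodic. -/
  aperiodic : ∀ᵐ S ∂Q, ∀ x : Pt d, x ≠ 0 → translate x S ≠ S

/-! ### Surfaces and fields

A surface assigns a height to each point `s` of a configuration, a field assigns a number to each
pair of points. To cover random surfaces, which depend on more than the configuration, they
are functions of `z : α`, where `conf : α → Config (Pt d)` reads off the configuration of `z`. The
case `α = Config (Pt d)`, `conf = id` is the non-random one. Only the values at points of
`conf z` are ever used. -/

variable {α : Type*}

/-- The gradient `∇η(s, s') = a(s, s') (η(s') - η(s))`. -/
def grad (conf : α → Config (Pt d)) (η : Pt d → α → ℝ) : Pt d → Pt d → α → ℝ :=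
  fun s s' z => conductance (conf z) s s' * (η s' z - η s z)

/-- A field is covariant if `ζ(s' - s, s'' - s, τ_s S) = ζ(s', s'', S)` for `s, s', s'' ∈ S`. -/
def IsCovariant (ζ : Pt d → Pt d → Config (Pt d) → ℝ) : Prop :=
  ∀ S : Config (Pt d), ∀ s ∈ S, ∀ s' ∈ S, ∀ s'' ∈ S,
    ζ (s' - s) (s'' - s) (translate s S) = ζ s' s'' S

/-- The measure `𝒞`, given by `𝒞(ζ) = (1/2) E ∑_{s ∈ S°} a(0, s, S°) ζ(0, s, S°)`. Here `μ` is the law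
of the underlying `z`, with `conf z = S°`. -/
def campbell [MeasurableSpace α] (μ : Measure α) (conf : α → Config (Pt d)) :
    Measure (Pt d × Pt d × α) :=
  (2⁻¹ : ℝ≥0∞) • μ.bind fun z => Measure.sum fun s : ↥(neighbours (conf z) 0) =>
    Measure.dirac ((0 : Pt d), (s : Pt d), z)

/-- Membership of a field in the Hilbert space `𝓗 = L²(𝒞)`. -/
def MemH [MeasurableSpace α] (μ : Measure α) (conf : α → Config (Pt d))
    (ζ : Pt d → Pt d → α → ℝ) : Prop :=
  MemLp (fun p : Pt d × Pt d × α => ζ p.1 p.2.1 p.2.2) 2 (campbell μ conf)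

/-- The inner product `𝒞(ζ · ζ')`, where `(ζ · ζ')(s, s') = a(s, s') ζ(s, s') ζ'(s, s')`. -/
def innerH [MeasurableSpace α] (μ : Measure α) (conf : α → Config (Pt d))
    (ζ ζ' : Pt d → Pt d → α → ℝ) : ℝ :=
  ∫ p : Pt d × Pt d × α,
    conductance (conf p.2.2) p.1 p.2.1 * ζ p.1 p.2.1 p.2.2 * ζ' p.1 p.2.1 p.2.2 ∂campbell μ conf

/-! ### The integrated tilt -/

/-- The orthogonal projection of `x` onto the hyperplane perpendicular to the unit vector `u`. -/
def projPerp (u x : Pt d) : Pt d := x - (inner ℝ x u) • u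

/-- The field `ω_u`: the signed `(d-1)`-dimensional Lebesgue measure of the projection, onto the
hyperplane perpendicular to `u`, of the common side of two neighbouring cells
(`μHE[d - 1]` is Hausdorff measure, normalised to be Lebesgue measure on hyperplanes). -/
def omega (conf : α → Config (Pt d)) (u : Pt d) : Pt d → Pt d → α → ℝ :=
  fun s s' z => Real.sign (inner ℝ (s' - s) u) * conductance (conf z) s s' *
    (μHE[d - 1] (projPerp u '' side (conf z) s s')).toReal

/-- The integrated tilt `J_u(η) = 𝒞(∇η · ω_u)`. -/
def tilt [MeasurableSpace α] (μ : Measure α) (conf : α → Config (Pt d)) (u : Pt d)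
    (η : Pt d → α → ℝ) : ℝ :=
  innerH μ conf (grad conf η) (omega conf u)

/-! ### The harness process -/

/-- `T` is a homogeneous Poisson process on `ℝ` with intensity one. -/
structure IsPoissonProcess {Ω : Type*} [MeasurableSpace Ω] (P : Measure Ω) (T : Ω → Config ℝ) :
    Prop where
  measurable : Measurable T
  law : ∀ B : Set ℝ, Bornology.IsBounded B → MeasurableSet B →
    P.map (fun ω => ((T ω).carrier ∩ B).ncard) = poissonMeasure (volume B).toNNReal
  indep : ∀ (m : ℕ) (B : Fin m → Set ℝ), (∀ i, Bornology.IsBounded (B i)) →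
    (∀ i, MeasurableSet (B i)) → Pairwise (fun i j => Disjoint (B i) (B j)) →
    iIndepFun (fun i ω => ((T ω).carrier ∩ B i).ncard) P

/-- The epochs attached to the point `s` of `S`: if `s = s_n` in the enumeration `e S` of `S`, these
are the points of `T_n`. -/
def clock (e : Config (Pt d) → ℕ → Pt d) (T : ℕ → Config ℝ) (S : Config (Pt d)) (s : Pt d) :
    Set ℝ :=
  {τ | ∃ n, e S n = s ∧ τ ∈ T n}

open Classical in
/-- Let `I` be a bounded time window. The walk runs backward in time through `I`, starting at `s`.
Whenever it meets an epoch `τ` of the point at which it sits, it jumps to a uniformly chosen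
neighbour, and goes on through the times before `τ`. For given epochs `clk`, the number
`walkProb S clk n s I s'` is the probability that it makes exactly `n` jumps and ends at `s'`. -/
def walkProb (S : Config (Pt d)) (clk : Pt d → Set ℝ) : ℕ → Pt d → Set ℝ → Pt d → ℝ
  | 0, s, I, s' => if s = s' ∧ clk s ∩ I = ∅ then 1 else 0
  | n + 1, s, I, s' =>
    if (clk s ∩ I).Nonempty then
      (degree S s : ℝ)⁻¹ * ∑' s'' : ↥(neighbours S s),
        walkProb S clk n (s'' : Pt d) (I ∩ Iio (sSup (clk s ∩ I))) s'
    else 0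

/-- The probability `p_t(s, s', S, T)`, given the configuration and the epochs, that the
backward walk that starts from `s` at time `t` is at `s'` at time `0`. -/
def transProb (S : Config (Pt d)) (clk : Pt d → Set ℝ) (t : ℝ) (s s' : Pt d) : ℝ :=
  ∑' n : ℕ, walkProb S clk n s (Ioc 0 t) s'

/-- The harness process `η_t^γ(s, S, T) = ∑_{s' ∈ S} p_t(s, s', S, T) γ(s')`, as a random surface
over the pairs `z = (S, ω)`; the epochs are `T n ω`. -/
def harness {Ω : Type*} (e : Config (Pt d) → ℕ → Pt d) (T : ℕ → Ω → Config ℝ)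
    (γ : Pt d → Config (Pt d) → ℝ) (t : ℝ) : Pt d → Config (Pt d) × Ω → ℝ :=
  fun s z => ∑' s' : ↥z.1.carrier,
    transProb z.1 (clock e (fun n => T n z.2) z.1) t s s' * γ s' z.1

end

end HarnessTilt

/-!
The harness process replaces the height of a point by the mean of the initial heights over the
endpoint of a walk, so it changes a surface by adding to the height at `s` the mean `h(s)` of the
gradient `∇γ` along that walk. This `h` is covariant and, for the random surface, square integrable
with respect to the right measure; adding such a height to a surface cannot change the tilt, because
the field `ω_u` has no divergence.

*No divergence.* The sides of the cell of the origin that face in direction `u` project onto the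
same subset of the hyperplane `u^⊥`, and without essential overlap, as those that face in direction
`-u`: both families cover the projection of the cell
(`tsum_posShadow_eq_tsum_posShadow_neg`). This needs points of the configuration on both sides of
the origin, which stationarity provides: a maximum of `⟪s, u⟫` over the points would have a
translation invariant law (`ae_exists_inner_gt`). The total area of the projected sides is at most
the area of the boundary of the cell, and so `ω_u` is square integrable.

*Mass transport.* By stationarity, `E ∑_s K(0, s, S°) = E ∑_s K(s, 0, S°)` for covariant `K ≥ 0`
(`lintegral_palm_mass_transport`, `lintegral_palm_swap`). In `𝒞(∇h · ω_u)` the term with `h(s)`,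
for the endpoint `s` of an edge, is thereby turned into the term with `h(0)`, and the two cancel
since the positive and the negative part of `ω_u` have the same sum over the edges at the origin
(`lintegral_campbell_pointMean_mul_posShadow`). All this happens with nonnegative functions; `∇γ` is
split into its two parts, and finiteness is needed only at the end.

*Square integrability.* The Palm measure, biased by the number of neighbours, is stationary for the
simple random walk, so every step contributes the same to the mean of an additive functional
(`lintegral_palm_deg_mul_meanSum_le`). The number of jumps up to time `t` has all exponential
moments, so crude bounds for the square of a sum suffice.

*The clocks.* Given the configuration and averaged over the clocks, the walk makes `k` jumps with
the Poisson probability, along any sequence of points (`prob_pathEvent`), although it may return to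
a point whose clock it has already used. Running backward in time, it always depends on later epochs
only: the set of pairs `(r, ω)` for which a walk that starts at time `r` follows a given path is
predictable, and on predictable sets the last epoch before `t` behaves as if it were independent of
the clocks (`prob_lastEpoch_mem`). On a generating π-system this is an identity between void
probabilities of Poisson processes.
-/

namespace HarnessTilt

noncomputable section

section

/-! ### Sums over the points of a configuration -/

section Points

variable {X : Type*} [PseudoMetricSpace X]

lemma mem_iff {S : Config X} {x : X} : x ∈ S ↔ x ∈ S.carrier := Iff.rfl

lemma Config.ext {S S' : Config X} (h : S.carrier = S'.carrier) : S = S' := by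
  cases S; cases S'; simp_all

lemma Config.countable_carrier (S : Config X) : S.carrier.Countable := by
  rcases S.carrier.eq_empty_or_nonempty with h | ⟨x, -⟩
  · simp [h]
  · have : S.carrier = ⋃ n : ℕ, S.carrier ∩ Metric.ball x n := by
      rw [← inter_iUnion, Metric.iUnion_ball_nat, inter_univ]
    rw [this]
    exact countable_iUnion fun n => (S.locallyFinite _ Metric.isBounded_ball).countable

instance (S : Config X) : Countable S.carrier := S.countable_carrier.to_subtype

/-- The annuli around a base point, a partition into bounded Borel sets. -/
def annulus (x : X) (n : ℕ) : Set X := disjointed (fun k : ℕ => Metric.ball x k) n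

lemma isBounded_annulus (x : X) (n : ℕ) : Bornology.IsBounded (annulus x n) :=
  Metric.isBounded_ball.subset (disjointed_subset _ n)

lemma iUnion_annulus (x : X) : ⋃ n, annulus x n = univ := by
  simp [annulus, iUnion_disjointed, Metric.iUnion_ball_nat]

lemma pairwise_disjoint_annulus (x : X) : Pairwise (Function.onFun Disjoint (annulus x)) :=
  disjoint_disjointed _

lemma measurableSet_annulus [MeasurableSpace X] [OpensMeasurableSpace X] (x : X) (n : ℕ) :
    MeasurableSet (annulus x n) :=
  MeasurableSet.disjointed (fun _ => Metric.isOpen_ball.measurableSet) n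

variable [MeasurableSpace X]

/-- The counting measure of a configuration. -/
def pointMeasure (S : Config X) : Measure X :=
  Measure.sum fun s : S.carrier => Measure.dirac (s : X)

lemma lintegral_pointMeasure [MeasurableSingletonClass X] (S : Config X) (f : X → ℝ≥0∞) :
    ∫⁻ x, f x ∂pointMeasure S = ∑' s : S.carrier, f s := by
  simp [pointMeasure, lintegral_sum_measure]

lemma pointMeasure_apply [MeasurableSingletonClass X] (S : Config X) {B : Set X}
    (hB : MeasurableSet B) : pointMeasure S B = ((S.carrier ∩ B).encard : ℝ≥0∞) := by
  have h1 : pointMeasure S B = ∫⁻ x, B.indicator 1 x ∂pointMeasure S := by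
    rw [lintegral_indicator_one hB]
  rw [h1, lintegral_pointMeasure, tsum_subtype S.carrier (B.indicator (1 : X → ℝ≥0∞)),
    Set.indicator_indicator]
  rw [← tsum_subtype (S.carrier ∩ B) (1 : X → ℝ≥0∞)]
  simp

/-- The generators of the σ-algebra of `Config X` leave out the events that a count is zero; they
are complements. -/
lemma measurable_ncard {B : Set X} (hb : Bornology.IsBounded B) (hB : MeasurableSet B) :
    Measurable fun S : Config X => (S.carrier ∩ B).ncard := by
  have h : ∀ k : ℕ, MeasurableSet {S : Config X | (S.carrier ∩ B).ncard = k} := by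
    have h1 : ∀ k : ℕ, 1 ≤ k → MeasurableSet {S : Config X | (S.carrier ∩ B).ncard = k} :=
      fun k hk => MeasurableSpace.measurableSet_generateFrom ⟨B, k, hb, hB, hk, rfl⟩
    intro k
    rcases Nat.eq_zero_or_pos k with rfl | hk
    · have : {S : Config X | (S.carrier ∩ B).ncard = 0}
          = (⋃ k : ℕ, {S : Config X | (S.carrier ∩ B).ncard = k + 1})ᶜ := by
        ext S
        simp only [mem_ofPred_eq, mem_compl_iff, mem_iUnion, not_exists]
        exact ⟨fun h k hk => by omega, fun h => by
          by_contra h0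
          exact h ((S.carrier ∩ B).ncard - 1) (by omega)⟩
      rw [this]
      exact (MeasurableSet.iUnion fun k => h1 (k + 1) (by omega)).compl
    · exact h1 k hk
  exact measurable_to_countable' fun k => h k

lemma measurable_pointMeasure_apply_of_isBounded [MeasurableSingletonClass X] {B : Set X}
    (hb : Bornology.IsBounded B) (hB : MeasurableSet B) :
    Measurable fun S : Config X => pointMeasure S B := by
  have hm := measurable_ncard hb hB
  have : (fun S : Config X => pointMeasure S B)
      = fun S => (((S.carrier ∩ B).ncard : ℕ) : ℝ≥0∞) := by
    ext S
    rw [pointMeasure_apply S hB, ← (S.locallyFinite B hb).cast_ncard_eq]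
    rfl
  rw [this]
  exact (measurable_of_countable (fun n : ℕ => (n : ℝ≥0∞))).comp hm

/-- A configuration-valued map is measurable if its counts in bounded Borel sets are. -/
lemma measurable_config [MeasurableSingletonClass X] {α : Type*} [MeasurableSpace α]
    {g : α → Config X}
    (hg : ∀ B : Set X, MeasurableSet B → Measurable fun a => pointMeasure (g a) B) :
    Measurable g := by
  refine measurable_generateFrom ?_
  rintro _ ⟨B, k, hb, hB, -, rfl⟩
  have : g ⁻¹' {S : Config X | (S.carrier ∩ B).ncard = k}
      = {a | pointMeasure (g a) B = (k : ℝ≥0∞)} := by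
    ext a
    rw [mem_ofPred_eq, pointMeasure_apply _ hB, ← ((g a).locallyFinite B hb).cast_ncard_eq]
    simp
  rw [this]
  exact hg B hB (measurableSet_singleton _)

variable [OpensMeasurableSpace X] [MeasurableSingletonClass X]

lemma measurable_pointMeasure : Measurable (pointMeasure : Config X → Measure X) := by
  refine Measure.measurable_of_measurable_coe _ fun B hB => ?_
  rcases isEmpty_or_nonempty X with hX | ⟨⟨x⟩⟩
  · have : B = ∅ := Subsingleton.elim _ _
    simp [this]
  · have : (fun S : Config X => pointMeasure S B)
        = fun S => ∑' n, pointMeasure S (B ∩ annulus x n) := by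
      ext S
      rw [← measure_iUnion, ← inter_iUnion, iUnion_annulus, inter_univ]
      · exact fun i j hij => (pairwise_disjoint_annulus x hij).mono inter_subset_right
          inter_subset_right
      · exact fun n => hB.inter (measurableSet_annulus x n)
    rw [this]
    exact Measurable.tsum fun n => measurable_pointMeasure_apply_of_isBounded
      ((isBounded_annulus x n).subset inter_subset_right) (hB.inter (measurableSet_annulus x n))

/-- The counting measures of configurations as a kernel. -/
def pointKernel (X : Type*) [PseudoMetricSpace X] [MeasurableSpace X] [OpensMeasurableSpace X]
    [MeasurableSingletonClass X] : Kernel (Config X) X where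
  toFun := pointMeasure
  measurable' := measurable_pointMeasure

lemma pointKernel_apply (S : Config X) : pointKernel X S = pointMeasure S := rfl

/-- The point counts in bounded sets are finite but not uniformly bounded, so the kernel is split
both along annuli and along the values of the counts. -/
instance : IsSFiniteKernel (pointKernel X) := by
  classical
  rcases isEmpty_or_nonempty X with hX | ⟨⟨x⟩⟩
  · have : pointKernel X = 0 := by
      ext S B
      have : B = ∅ := Subsingleton.elim _ _
      simp [this]
    rw [this]
    infer_instance
  have hset : ∀ p : ℕ × ℕ, MeasurableSet
      {S : Config X | pointMeasure S (annulus x p.1) = (p.2 : ℝ≥0∞)} := fun p =>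
    measurable_pointMeasure_apply_of_isBounded (isBounded_annulus x p.1)
      (measurableSet_annulus x p.1) (measurableSet_singleton _)
  let κ : ℕ × ℕ → Kernel (Config X) X := fun p =>
    Kernel.piecewise (hset p) ((pointKernel X).restrict (measurableSet_annulus x p.1)) 0
  have hκ : ∀ p, IsFiniteKernel (κ p) := fun p => by
    refine ⟨⟨p.2, ENNReal.natCast_lt_top _, fun S => ?_⟩⟩
    simp only [κ, Kernel.piecewise_apply]
    split_ifs with h
    · rw [Kernel.restrict_apply, Measure.restrict_apply_univ, pointKernel_apply]
      exact le_of_eq h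
    · simp
  have : pointKernel X = Kernel.sum κ := by
    ext S B hB
    rw [Kernel.sum_apply' _ _ hB, ENNReal.tsum_prod']
    have h1 : pointKernel X S B = ∑' n, pointMeasure S (B ∩ annulus x n) := by
      rw [pointKernel_apply, ← measure_iUnion, ← inter_iUnion, iUnion_annulus, inter_univ]
      · exact fun i j hij => (pairwise_disjoint_annulus x hij).mono inter_subset_right
          inter_subset_right
      · exact fun n => hB.inter (measurableSet_annulus x n)
    rw [h1]
    congr 1
    ext n
    have hn : pointMeasure S (annulus x n) = (((S.carrier ∩ annulus x n).ncard : ℕ) : ℝ≥0∞) := by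
      rw [pointMeasure_apply S (measurableSet_annulus x n),
        ← (S.locallyFinite _ (isBounded_annulus x n)).cast_ncard_eq]
      rfl
    rw [tsum_eq_single (S.carrier ∩ annulus x n).ncard]
    · simp only [κ, Kernel.piecewise_apply]
      rw [if_pos (by simpa using hn), Kernel.restrict_apply,
        Measure.restrict_apply hB, pointKernel_apply]
    · intro k hk
      simp only [κ, Kernel.piecewise_apply]
      rw [if_neg]
      · simp
      · intro h
        rw [mem_ofPred_eq, hn] at h
        exact hk (by exact_mod_cast h.symm)
  rw [this]
  exact inferInstance

variable {α : Type*} [MeasurableSpace α]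

/-- Sums over the points of a configuration depend measurably on the parameters. -/
lemma Measurable.tsum_points {g : α → Config X} (hg : Measurable g) {f : α → X → ℝ≥0∞}
    (hf : Measurable (Function.uncurry f)) :
    Measurable fun a => ∑' s : (g a).carrier, f a s := by
  have h := Measurable.lintegral_kernel_prod_right (κ := (pointKernel X).comap g hg) hf
  simpa [Kernel.comap_apply, pointKernel_apply, lintegral_pointMeasure] using h

/-- The main tool for measurability: `∃ s ∈ g a, P a s` holds if and only if a measurable sum over
the points of `g a` does not vanish. -/
lemma measurableSet_exists_mem {g : α → Config X} (hg : Measurable g) {P : α → X → Prop}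
    (hP : MeasurableSet {p : α × X | P p.1 p.2}) :
    MeasurableSet {a | ∃ s ∈ g a, P a s} := by
  classical
  have hf : Measurable (Function.uncurry
      fun (a : α) (x : X) => ({p : α × X | P p.1 p.2}.indicator 1 (a, x) : ℝ≥0∞)) :=
    measurable_one.indicator hP
  have h := Measurable.tsum_points hg hf
  have : {a | ∃ s ∈ g a, P a s} = {a | (∑' s : (g a).carrier,
      ({p : α × X | P p.1 p.2}.indicator 1 (a, (s : X)) : ℝ≥0∞)) = 0}ᶜ := by
    ext a
    simp only [mem_ofPred_eq, mem_compl_iff, ENNReal.tsum_eq_zero, Subtype.forall,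
      indicator_apply, Pi.one_apply, ite_eq_right_iff, one_ne_zero, imp_false, not_forall, not_not,
      exists_prop]
    rfl
  rw [this]
  exact (h (measurableSet_singleton 0)).compl

end Points

/-! ### Translations, Voronoi cells and the Palm measure: measurability -/

variable {d : ℕ}

lemma mem_translate {x s : Pt d} {S : Config (Pt d)} : s ∈ translate x S ↔ s + x ∈ S := by
  constructor
  · rintro ⟨y, hy, rfl⟩
    simpa [mem_iff] using hy
  · intro h
    exact ⟨s + x, h, by simp⟩

lemma translate_translate (x y : Pt d) (S : Config (Pt d)) :
    translate x (translate y S) = translate (y + x) S := by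
  apply Config.ext
  ext s
  change s ∈ translate x (translate y S) ↔ s ∈ translate (y + x) S
  simp only [mem_translate]
  rw [add_assoc, add_comm x y]

lemma translate_zero (S : Config (Pt d)) : translate 0 S = S := by
  apply Config.ext
  ext s
  change s ∈ translate 0 S ↔ s ∈ S
  simp [mem_translate]

/-- Sums over the points of a translate, as sums over the points of the configuration. -/
lemma tsum_translate (x : Pt d) (S : Config (Pt d)) (f : Pt d → ℝ≥0∞) :
    ∑' s : (translate x S).carrier, f s = ∑' s : S.carrier, f (s - x) := by
  let φ : S.carrier ≃ (translate x S).carrier :=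
    Equiv.Set.image (fun s => s - x) S.carrier (sub_left_injective)
  rw [← φ.tsum_eq]
  rfl

lemma measurable_translate :
    Measurable fun p : Pt d × Config (Pt d) => translate p.1 p.2 := by
  refine measurable_config fun B hB => ?_
  have : (fun p : Pt d × Config (Pt d) => pointMeasure (translate p.1 p.2) B)
      = fun p => ∑' s : p.2.carrier, B.indicator (1 : Pt d → ℝ≥0∞) (s - p.1) := by
    ext p
    rw [← tsum_translate p.1 p.2 (B.indicator 1), ← lintegral_pointMeasure,
      lintegral_indicator_one hB]
  rw [this]
  refine Measurable.tsum_points (f := fun (p : Pt d × Config (Pt d)) (s : Pt d) =>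
    B.indicator (1 : Pt d → ℝ≥0∞) (s - p.1)) measurable_snd ?_
  exact (measurable_one.indicator hB).comp
    (measurable_snd.sub (measurable_fst.comp measurable_fst))

lemma measurableSet_mem : MeasurableSet {p : Pt d × Config (Pt d) | p.1 ∈ p.2} := by
  have h := measurableSet_exists_mem (α := Pt d × Config (Pt d)) (g := Prod.snd) measurable_snd
    (P := fun p s => s = p.1) (measurableSet_eq_fun measurable_snd
      (measurable_fst.comp measurable_fst))
  convert h using 1
  ext p
  simp

lemma measurableSet_mem_vor :
    MeasurableSet {p : Pt d × Pt d × Config (Pt d) | p.1 ∈ vor p.2.2 p.2.1} := by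
  have h := measurableSet_exists_mem (α := Pt d × Pt d × Config (Pt d)) (g := fun p => p.2.2)
    (measurable_snd.comp measurable_snd)
    (P := fun p s => dist p.1 s < dist p.1 p.2.1)
    (measurableSet_lt (by fun_prop) (by fun_prop))
  convert h.compl using 1
  ext p
  simp [vor]

lemma measurableSet_unitCube : MeasurableSet (unitCube d) := by
  have : unitCube d = ⋂ i, {x : Pt d | 0 ≤ x i ∧ x i < 1} := by
    ext x; simp [unitCube]
  rw [this]
  refine MeasurableSet.iInter fun i => ?_
  have hi : Measurable fun x : Pt d => x i := by fun_prop
  exact (measurableSet_le measurable_const hi).inter (measurableSet_lt hi measurable_const)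

/-- The sum over the points in a set as a sum over all points. -/
lemma tsum_carrier_inter (S : Config (Pt d)) (A : Set (Pt d)) (f : Pt d → ℝ≥0∞) :
    ∑' s : ↥(S.carrier ∩ A), f s = ∑' s : S.carrier, A.indicator f s := by
  rw [tsum_subtype, tsum_subtype, Set.indicator_indicator]

lemma measurable_palmKernel :
    Measurable fun S : Config (Pt d) => Measure.sum fun s : ↥(S.carrier ∩ unitCube d) =>
      Measure.dirac (translate (s : Pt d) S) := by
  refine Measure.measurable_of_measurable_coe _ fun A hA => ?_
  have : (fun S : Config (Pt d) => (Measure.sum fun s : ↥(S.carrier ∩ unitCube d) =>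
      Measure.dirac (translate (s : Pt d) S)) A)
      = fun S => ∑' s : S.carrier,
        (unitCube d).indicator
          (fun s => A.indicator (1 : Config (Pt d) → ℝ≥0∞) (translate s S)) s := by
    ext S
    rw [Measure.sum_apply _ hA, ← tsum_carrier_inter S (unitCube d)
      (fun s => A.indicator (1 : Config (Pt d) → ℝ≥0∞) (translate s S))]
    simp [Measure.dirac_apply' _ hA]
  rw [this]
  refine Measurable.tsum_points (f := fun (S : Config (Pt d)) (s : Pt d) =>
    (unitCube d).indicator (fun s => A.indicator (1 : Config (Pt d) → ℝ≥0∞) (translate s S)) s)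
    measurable_id ?_
  have h1 : Measurable fun p : Config (Pt d) × Pt d =>
      A.indicator (1 : Config (Pt d) → ℝ≥0∞) (translate p.2 p.1) :=
    (measurable_one.indicator hA).comp (measurable_translate.comp measurable_swap)
  exact h1.indicator (measurable_snd measurableSet_unitCube)

/-- Campbell's formula: integrals with respect to the Palm measure. -/
lemma lintegral_palm (Q : Measure (Config (Pt d))) {f : Config (Pt d) → ℝ≥0∞}
    (hf : Measurable f) :
    ∫⁻ S, f S ∂palm Q
      = ∫⁻ S, ∑' s : S.carrier, (unitCube d).indicator (fun s => f (translate s S)) s ∂Q := by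
  rw [palm, Measure.lintegral_bind measurable_palmKernel.aemeasurable hf.aemeasurable]
  congr 1
  ext S
  rw [lintegral_sum_measure, ← tsum_carrier_inter S (unitCube d) (fun s => f (translate s S))]
  congr 1
  ext s
  rw [lintegral_dirac' _ hf]

end

section

/-! ### Stationarity: the mass transport principle -/

variable {d : ℕ}

/-- The integer lattice inside `ℝ^d`. -/
def latticePt (v : Fin d → ℤ) : Pt d := WithLp.toLp 2 fun i => (v i : ℝ)

lemma tsum_lattice_indicator (y : Pt d) :
    ∑' v : Fin d → ℤ, (unitCube d).indicator (1 : Pt d → ℝ≥0∞) (y + latticePt v) = 1 := by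
  rw [tsum_eq_single (fun i => -⌊y i⌋)]
  · rw [indicator_of_mem]
    · rfl
    · intro i
      simp only [latticePt, PiLp.add_apply, Int.cast_neg]
      constructor
      · linarith [Int.floor_le (y i)]
      · linarith [Int.lt_floor_add_one (y i)]
  · intro v hv
    rw [indicator_of_notMem]
    intro h
    apply hv
    ext i
    have hi := h i
    simp only [latticePt, PiLp.add_apply] at hi
    have : ⌊y i⌋ = -v i := by
      rw [Int.floor_eq_iff]
      push_cast
      constructor <;> linarith [hi.1, hi.2]
    omega

lemma tsum_lattice_indicator_sub (y : Pt d) :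
    ∑' v : Fin d → ℤ, (unitCube d).indicator (1 : Pt d → ℝ≥0∞) (y - latticePt v) = 1 := by
  rw [← tsum_lattice_indicator y, ← (Equiv.neg (Fin d → ℤ)).tsum_eq]
  congr 1
  ext v
  congr 1
  ext i
  simp [latticePt]

/-- The mass transport principle. Mass sent from the origin to the points `s` of the Palm version
balances the mass received by the origin. Decomposing space into the unit cubes of the lattice, mass
sent from the cube at `0` to the cube at `v` has the same mean, by stationarity, as mass sent from
the cube at `-v` to the cube at `0`. -/
theorem lintegral_palm_mass_transport {Q : Measure (Config (Pt d))}
    (hQ : ∀ x : Pt d, MeasurePreserving (translate x) Q Q) {f : Pt d → Config (Pt d) → ℝ≥0∞}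
    (hf : Measurable (Function.uncurry f)) :
    ∫⁻ S, ∑' s : S.carrier, f s S ∂palm Q
      = ∫⁻ S, ∑' s : S.carrier, f (-(s : Pt d)) (translate s S) ∂palm Q := by
  set C : Pt d → ℝ≥0∞ := (unitCube d).indicator 1 with hC
  have hCm : Measurable C := measurable_one.indicator measurableSet_unitCube
  have hind : ∀ (g : Pt d → ℝ≥0∞) (x : Pt d), (unitCube d).indicator g x = C x * g x := by
    intro g x
    by_cases hx : x ∈ unitCube d <;> simp [hC, hx]
  -- the total mass sent from the unit cube to the unit cube shifted by `v`
  let Φ : (Fin d → ℤ) → Config (Pt d) → ℝ≥0∞ := fun v S =>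
    ∑' x : S.carrier, ∑' y : S.carrier,
      C x * C (y - latticePt v) * f (y - x) (translate x S)
  have hΦ : ∀ v, Measurable (Φ v) := fun v => by
    refine Measurable.tsum_points (f := fun S x => ∑' y : S.carrier,
      C x * C (y - latticePt v) * f (y - x) (translate x S)) measurable_id ?_
    refine Measurable.tsum_points (f := fun (p : Config (Pt d) × Pt d) (y : Pt d) =>
      C p.2 * C (y - latticePt v) * f (y - p.2) (translate p.2 p.1)) measurable_fst ?_
    have h1 : Measurable fun q : (Config (Pt d) × Pt d) × Pt d =>
        f (q.2 - q.1.2) (translate q.1.2 q.1.1) :=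
      hf.comp ((by fun_prop : Measurable fun q : (Config (Pt d) × Pt d) × Pt d =>
        q.2 - q.1.2).prodMk (measurable_translate.comp
          (by fun_prop : Measurable fun q : (Config (Pt d) × Pt d) × Pt d => (q.1.2, q.1.1))))
    exact ((hCm.comp (by fun_prop)).mul (hCm.comp (by fun_prop))).mul h1
  have hL : Measurable fun S : Config (Pt d) => ∑' s : S.carrier, f s S :=
    Measurable.tsum_points (f := fun S s => f s S) measurable_id (hf.comp measurable_swap)
  have hR : Measurable fun S : Config (Pt d) =>
      ∑' s : S.carrier, f (-(s : Pt d)) (translate s S) := by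
    refine Measurable.tsum_points (f := fun S s => f (-s) (translate s S)) measurable_id ?_
    exact hf.comp ((by fun_prop : Measurable fun q : Config (Pt d) × Pt d => -q.2).prodMk
      (measurable_translate.comp measurable_swap))
  have hLs : ∫⁻ S, ∑' s : S.carrier, f s S ∂palm Q = ∑' v, ∫⁻ S, Φ v S ∂Q := by
    rw [lintegral_palm Q hL, ← lintegral_tsum fun v => (hΦ v).aemeasurable]
    congr 1
    ext S
    simp only [Φ]
    rw [ENNReal.tsum_comm]
    refine tsum_congr fun x => ?_
    rw [ENNReal.tsum_comm, hind, tsum_translate (x : Pt d) S (fun s => f s (translate x S)),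
      ← ENNReal.tsum_mul_left]
    refine tsum_congr fun y => ?_
    simp_rw [mul_comm (C x) _, mul_assoc]
    rw [ENNReal.tsum_mul_right, tsum_lattice_indicator_sub, one_mul, mul_comm]
  have hshift : ∀ v, ∫⁻ S, Φ v S ∂Q = ∫⁻ S, ∑' x : S.carrier, ∑' y : S.carrier,
      C (x + latticePt v) * C y * f (y - x) (translate x S) ∂Q := fun v => by
    rw [← (hQ (-latticePt v)).lintegral_comp (hΦ v)]
    congr 1
    ext S
    simp only [Φ]
    rw [tsum_translate _ S fun x => ∑' y : (translate (-latticePt v) S).carrier,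
      C x * C (y - latticePt v) * f (y - x) (translate x (translate (-latticePt v) S))]
    refine tsum_congr fun x => ?_
    rw [tsum_translate _ S fun y => C (x - -latticePt v) * C (y - latticePt v) *
      f (y - (x - -latticePt v))
        (translate ((x : Pt d) - -latticePt v) (translate (-latticePt v) S))]
    refine tsum_congr fun y => ?_
    have hx : -latticePt v + ((x : Pt d) - -latticePt v) = x := by abel
    have hy : (y : Pt d) - -latticePt v - latticePt v = y := by abel
    have hyx : (y : Pt d) - -latticePt v - (x - -latticePt v) = y - x := by abel
    rw [translate_translate, hx, hy, hyx, sub_neg_eq_add]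
  have hm2 : ∀ v : Fin d → ℤ, Measurable fun S : Config (Pt d) => ∑' x : S.carrier,
      ∑' y : S.carrier, C (x + latticePt v) * C y * f (y - x) (translate x S) := fun v => by
    refine Measurable.tsum_points (f := fun S x => ∑' y : S.carrier,
      C (x + latticePt v) * C y * f (y - x) (translate x S)) measurable_id ?_
    refine Measurable.tsum_points (f := fun (p : Config (Pt d) × Pt d) (y : Pt d) =>
      C (p.2 + latticePt v) * C y * f (y - p.2) (translate p.2 p.1)) measurable_fst ?_
    have h1 : Measurable fun q : (Config (Pt d) × Pt d) × Pt d =>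
        f (q.2 - q.1.2) (translate q.1.2 q.1.1) :=
      hf.comp ((by fun_prop : Measurable fun q : (Config (Pt d) × Pt d) × Pt d =>
        q.2 - q.1.2).prodMk (measurable_translate.comp
          (by fun_prop : Measurable fun q : (Config (Pt d) × Pt d) × Pt d => (q.1.2, q.1.1))))
    exact ((hCm.comp (by fun_prop)).mul (hCm.comp (by fun_prop))).mul h1
  rw [hLs, lintegral_palm Q hR]
  simp_rw [hshift]
  rw [← lintegral_tsum fun v => (hm2 v).aemeasurable]
  congr 1
  ext S
  have h1 : ∀ y : S.carrier,
      (unitCube d).indicator (fun y => ∑' s : (translate y S).carrier,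
        f (-(s : Pt d)) (translate s (translate y S))) y
      = ∑' x : S.carrier, C y * f (y - x) (translate x S) := fun y => by
    rw [hind, tsum_translate (y : Pt d) S fun s => f (-s) (translate s (translate y S)),
      ENNReal.tsum_mul_left]
    congr 2
    ext x
    rw [translate_translate]
    congr 2 <;> abel_nf
  simp_rw [h1]
  rw [ENNReal.tsum_comm]
  rw [ENNReal.tsum_comm (f := fun (y x : S.carrier) => C y * f (y - x) (translate x S))]
  refine tsum_congr fun x => ?_
  rw [ENNReal.tsum_comm]
  refine tsum_congr fun y => ?_
  simp_rw [mul_assoc]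
  rw [ENNReal.tsum_mul_right, tsum_lattice_indicator, one_mul]

/-- An almost sure property of the Palm version holds, almost surely, as seen from each of its
points. -/
lemma ae_palm_forall_mem {Q : Measure (Config (Pt d))}
    (hQ : ∀ x : Pt d, MeasurePreserving (translate x) Q Q) {p : Config (Pt d) → Prop}
    (hp : ∀ᵐ S ∂palm Q, p S) : ∀ᵐ S ∂palm Q, ∀ s ∈ S, p (translate s S) := by
  set A := toMeasurable (palm Q) {S | ¬ p S}
  have hAm : MeasurableSet A := measurableSet_toMeasurable _ _
  have hA0 : palm Q A = 0 := by rw [measure_toMeasurable]; exact hp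
  have hf : Measurable (Function.uncurry fun (_ : Pt d) (S : Config (Pt d)) =>
      A.indicator (1 : Config (Pt d) → ℝ≥0∞) S) :=
    (measurable_one.indicator hAm).comp measurable_snd
  have h := lintegral_palm_mass_transport hQ hf
  have h0 : ∫⁻ S, ∑' _ : S.carrier, A.indicator (1 : Config (Pt d) → ℝ≥0∞) S ∂palm Q = 0 := by
    refine lintegral_eq_zero_of_ae_eq_zero ?_
    have : ∀ᵐ S ∂palm Q, S ∉ A := measure_eq_zero_iff_ae_notMem.1 hA0
    filter_upwards [this] with S hS
    simp [hS]
  rw [h0] at h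
  have hm : Measurable fun S : Config (Pt d) =>
      ∑' s : S.carrier, A.indicator (1 : Config (Pt d) → ℝ≥0∞) (translate s S) :=
    Measurable.tsum_points (f := fun S s => A.indicator 1 (translate s S)) measurable_id
      ((measurable_one.indicator hAm).comp (measurable_translate.comp measurable_swap))
  have h2 := (lintegral_eq_zero_iff hm).1 h.symm
  filter_upwards [h2] with S hS s hs
  by_contra hps
  have h3 := ENNReal.tsum_eq_zero.1 hS ⟨s, hs⟩
  have h4 : translate s S ∈ A := subset_toMeasurable _ _ hps
  simp [h4] at h3

lemma ae_palm_of_ae {Q : Measure (Config (Pt d))} {A : Set (Config (Pt d))}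
    (hA : MeasurableSet A) (h : ∀ᵐ S ∂Q, ∀ s ∈ S, translate s S ∈ A) :
    ∀ᵐ S ∂palm Q, S ∈ A := by
  have h1 : palm Q Aᶜ = 0 := by
    rw [← lintegral_indicator_one hA.compl, lintegral_palm Q (measurable_one.indicator hA.compl)]
    refine lintegral_eq_zero_of_ae_eq_zero ?_
    filter_upwards [h] with S hS
    refine ENNReal.tsum_eq_zero.2 fun s => ?_
    have := hS s s.2
    simp [this]
  exact (measure_eq_zero_iff_ae_notMem.1 h1).mono fun S hS => not_not.1 hS

lemma ae_palm_zero_mem (Q : Measure (Config (Pt d))) : ∀ᵐ S ∂palm Q, (0 : Pt d) ∈ S :=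
  ae_palm_of_ae (measurableSet_mem.preimage (measurable_const.prodMk measurable_id))
    (Eventually.of_forall fun S s hs => by
      change (0 : Pt d) ∈ translate s S
      simpa [mem_translate] using hs)

/-- In a stationary configuration no point is extremal in a given direction: the maximum of
`⟪s, u⟫` over the points would have a translation invariant law on `ℝ`. -/
lemma ae_exists_inner_gt {Q : Measure (Config (Pt d))} [IsFiniteMeasure Q]
    (hQ : ∀ x : Pt d, MeasurePreserving (translate x) Q Q) {u : Pt d} (hu : ‖u‖ = 1) :
    ∀ᵐ S ∂Q, ∀ s ∈ S, ∃ s' ∈ S, (inner ℝ s u : ℝ) < inner ℝ s' u := by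
  -- `E k` says that the supremum of `⟪s, u⟫` lies near `k`: some value lies in `[k, k + 1)`, and no
  -- value is larger; these disjoint events all have the same probability
  let E : ℤ → Set (Config (Pt d)) := fun k =>
    {S | ∃ s ∈ S, (k : ℝ) ≤ inner ℝ s u ∧ (inner ℝ s u : ℝ) < k + 1} ∩
      {S | ∃ s ∈ S, (k + 1 : ℝ) ≤ inner ℝ s u}ᶜ
  have hin : Measurable fun p : Config (Pt d) × Pt d => (inner ℝ p.2 u : ℝ) := by fun_prop
  have hE : ∀ k, MeasurableSet (E k) := fun k =>
    (measurableSet_exists_mem (g := fun S : Config (Pt d) => S) measurable_id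
      (P := fun _ s => (k : ℝ) ≤ inner ℝ s u ∧ (inner ℝ s u : ℝ) < k + 1)
      ((measurableSet_le measurable_const hin).inter
        (measurableSet_lt hin measurable_const))).inter
    (measurableSet_exists_mem (g := fun S : Config (Pt d) => S) measurable_id
      (P := fun _ s => (k + 1 : ℝ) ≤ inner ℝ s u)
      (measurableSet_le measurable_const hin)).compl
  have hEt : ∀ k : ℤ, translate ((k : ℝ) • u) ⁻¹' E 0 = E k := by
    intro k
    have hex : ∀ (S : Config (Pt d)) (p : ℝ → Prop),
        (∃ s ∈ translate ((k : ℝ) • u) S, p (inner ℝ s u)) ↔ ∃ s ∈ S, p (inner ℝ s u - k) := by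
      intro S p
      constructor
      · rintro ⟨s, hs, h⟩
        refine ⟨_, mem_translate.1 hs, ?_⟩
        simpa [inner_add_left, inner_smul_left, hu] using h
      · rintro ⟨s, hs, h⟩
        refine ⟨s - (k : ℝ) • u, mem_translate.2 (by simpa using hs), ?_⟩
        simpa [inner_sub_left, inner_smul_left, hu] using h
    ext S
    simp only [E, mem_preimage, mem_inter_iff, mem_ofPred_eq, mem_compl_iff]
    rw [hex S (fun x => ((0 : ℤ) : ℝ) ≤ x ∧ x < ((0 : ℤ) : ℝ) + 1),
      hex S (fun x => ((0 : ℤ) : ℝ) + 1 ≤ x)]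
    have e1 : ∀ x : ℝ, (((0 : ℤ) : ℝ) ≤ x - k ∧ x - k < ((0 : ℤ) : ℝ) + 1) ↔
        ((k : ℝ) ≤ x ∧ x < k + 1) := by
      intro x; push_cast; constructor <;> rintro ⟨h1, h2⟩ <;> constructor <;> linarith
    have e2 : ∀ x : ℝ, (((0 : ℤ) : ℝ) + 1 ≤ x - k) ↔ ((k : ℝ) + 1 ≤ x) := by
      intro x; push_cast; constructor <;> intro h1 <;> linarith
    simp only [e1, e2]
  have hdisj : Pairwise (Function.onFun Disjoint E) := by
    have key : ∀ i j : ℤ, i < j → Disjoint (E i) (E j) := by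
      intro i j hij
      refine Set.disjoint_left.2 fun S hi hj => ?_
      obtain ⟨s, hs, h1, -⟩ := hj.1
      refine hi.2 ⟨s, hs, ?_⟩
      have : ((i + 1 : ℤ) : ℝ) ≤ j := by exact_mod_cast hij
      push_cast at this
      linarith
    intro i j hij
    rcases lt_or_gt_of_ne hij with h | h
    · exact key i j h
    · exact (key j i h).symm
  have hconst : ∀ k, Q (E k) = Q (E 0) := fun k => by
    rw [← hEt k, (hQ _).measure_preimage (hE 0).nullMeasurableSet]
  have h0 : Q (E 0) = 0 := by
    by_contra hne
    have h1 := measure_iUnion (μ := Q) hdisj hE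
    simp_rw [hconst] at h1
    rw [ENNReal.tsum_const_eq_top_of_ne_zero hne] at h1
    exact measure_ne_top Q _ h1
  have hall : ∀ᵐ S ∂Q, ∀ k, S ∉ E k :=
    ae_all_iff.2 fun k => measure_eq_zero_iff_ae_notMem.1 ((hconst k).trans h0)
  filter_upwards [hall] with S hS s hs
  by_contra! hmax
  refine hS ⌊(inner ℝ s u : ℝ)⌋ ⟨⟨s, hs, Int.floor_le _, Int.lt_floor_add_one _⟩, ?_⟩
  rintro ⟨s', hs', h⟩
  linarith [hmax s' hs', Int.lt_floor_add_one (inner ℝ s u : ℝ)]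

lemma ae_palm_exists_inner_pos {Q : Measure (Config (Pt d))} [IsFiniteMeasure Q]
    (hQ : ∀ x : Pt d, MeasurePreserving (translate x) Q Q) {u : Pt d} (hu : ‖u‖ = 1) :
    ∀ᵐ S ∂palm Q, ∃ s ∈ S, (0 : ℝ) < inner ℝ s u := by
  refine ae_palm_of_ae (A := {S | ∃ s ∈ S, (0 : ℝ) < inner ℝ s u})
    (measurableSet_exists_mem (g := fun S : Config (Pt d) => S) measurable_id
      (P := fun _ s => (0 : ℝ) < inner ℝ s u)
      (measurableSet_lt measurable_const (by fun_prop))) ?_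
  filter_upwards [ae_exists_inner_gt hQ hu] with S hS s hs
  obtain ⟨s', hs', h⟩ := hS s hs
  refine ⟨s' - s, mem_translate.2 (by simpa using hs'), ?_⟩
  rw [inner_sub_left]
  linarith

end

section

/-! ### Geometry of Voronoi cells -/

variable {d : ℕ}

lemma euclideanHausdorffMeasure_image_le {X Y : Type*} [MetricSpace X] [MeasurableSpace X]
    [BorelSpace X] [MetricSpace Y] [MeasurableSpace Y] [BorelSpace Y] {f : X → Y}
    (hf : LipschitzWith 1 f) (m : ℕ) (A : Set X) : μHE[m] (f '' A) ≤ μHE[m] A := by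
  simp only [Measure.euclideanHausdorffMeasure_def, Measure.smul_apply]
  have := hf.hausdorffMeasure_image_le (d := m) (Nat.cast_nonneg m) A
  simp only [ENNReal.coe_one, ENNReal.one_rpow, one_mul] at this
  gcongr

/-- Sets of dimension less than `m` have no `m`-dimensional measure. -/
lemma euclideanHausdorffMeasure_eq_zero_of_finrank_lt {A : Set (Pt d)} {m : ℕ}
    (h : Module.finrank ℝ (vectorSpan ℝ A) < m) : μHE[m] A = 0 := by
  rcases A.eq_empty_or_nonempty with rfl | ⟨p, hp⟩
  · simp
  let D := vectorSpan ℝ A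
  let f : D → Pt d := fun v => v + p
  have hf : LipschitzWith 1 f := LipschitzWith.of_dist_le_mul fun v w => by
    simp [f, dist_eq_norm]
  have hA : A ⊆ f '' univ := by
    intro a ha
    exact ⟨⟨a - p, vsub_mem_vectorSpan ℝ ha hp⟩, mem_univ _, by simp [f]⟩
  refine measure_mono_null hA (le_antisymm ?_ bot_le)
  refine (euclideanHausdorffMeasure_image_le hf m univ).trans (le_of_eq ?_)
  rw [Measure.euclideanHausdorffMeasure_def, Measure.smul_apply]
  have : (μH[((m : ℝ≥0) : ℝ)] : Measure D) univ = 0 := by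
    apply hausdorffMeasure_of_dimH_lt
    rw [Real.dimH_univ_eq_finrank]
    exact_mod_cast h
  simp only [NNReal.coe_natCast] at this
  simp [this]

lemma dist_le_dist_iff_inner (x s s' : Pt d) :
    dist x s ≤ dist x s' ↔ 2 * (inner ℝ (x - s) (s' - s) : ℝ) ≤ ‖s' - s‖ ^ 2 := by
  have h : dist x s' ^ 2 = dist x s ^ 2 - 2 * inner ℝ (x - s) (s' - s) + ‖s' - s‖ ^ 2 := by
    rw [dist_eq_norm, dist_eq_norm, ← norm_sub_sq_real]
    congr 2
    abel
  rw [← sq_le_sq₀ dist_nonneg dist_nonneg, h]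
  constructor <;> intro h <;> linarith

lemma mem_vor_iff {S : Config (Pt d)} {s x : Pt d} :
    x ∈ vor S s ↔ ∀ s' ∈ S, 2 * (inner ℝ (x - s) (s' - s) : ℝ) ≤ ‖s' - s‖ ^ 2 := by
  simp only [vor, mem_ofPred_eq, dist_le_dist_iff_inner]

lemma inner_sub_swap (x s s' : Pt d) :
    (inner ℝ (x - s') (s - s') : ℝ) = ‖s' - s‖ ^ 2 - inner ℝ (x - s) (s' - s) := by
  rw [← real_inner_self_eq_norm_sq, ← inner_sub_left, ← neg_sub s' s, inner_neg_right,
    ← inner_neg_left]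
  congr 1
  abel

/-- The common side consists of the points of one cell that lie on the bisecting hyperplane. -/
lemma mem_side_iff {S : Config (Pt d)} {s s' x : Pt d} (hs : s ∈ S) (hs' : s' ∈ S) :
    x ∈ side S s s' ↔
      x ∈ vor S s ∧ 2 * (inner ℝ (x - s) (s' - s) : ℝ) = ‖s' - s‖ ^ 2 := by
  constructor
  · rintro ⟨h1, h2⟩
    refine ⟨h1, le_antisymm (mem_vor_iff.1 h1 s' hs') ?_⟩
    have h3 := mem_vor_iff.1 h2 s hs
    rw [inner_sub_swap, norm_sub_rev s s'] at h3
    linarith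
  · rintro ⟨h1, h2⟩
    refine ⟨h1, fun s'' hs'' => ?_⟩
    have : dist x s = dist x s' := by
      refine le_antisymm (h1 s' hs') ?_
      rw [dist_le_dist_iff_inner]
      rw [inner_sub_swap, norm_sub_rev s s']
      linarith
    rw [← this]
    exact h1 s'' hs''

lemma isClosed_vor (S : Config (Pt d)) (s : Pt d) : IsClosed (vor S s) := by
  have : vor S s = ⋂ s' ∈ S, {x | dist x s ≤ dist x s'} := by ext x; simp [vor]
  rw [this]
  exact isClosed_biInter fun s' _ => isClosed_le (by fun_prop) (by fun_prop)

lemma convex_vor (S : Config (Pt d)) (s : Pt d) : Convex ℝ (vor S s) := by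
  intro x hx y hy a b ha hb hab
  rw [mem_vor_iff] at *
  intro s' hs'
  have e : a • x + b • y - s = a • (x - s) + b • (y - s) := by
    have : s = (a + b) • s := by rw [hab, one_smul]
    nth_rewrite 1 [this]
    module
  rw [e, inner_add_left, inner_smul_left, inner_smul_left]
  simp only [conj_trivial]
  have h1 := mul_le_mul_of_nonneg_left (hx s' hs') ha
  have h2 := mul_le_mul_of_nonneg_left (hy s' hs') hb
  nlinarith

lemma isClosed_side (S : Config (Pt d)) (s s' : Pt d) : IsClosed (side S s s') :=
  (isClosed_vor S s).inter (isClosed_vor S s')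

lemma side_comm (S : Config (Pt d)) (s s' : Pt d) : side S s s' = side S s' s :=
  inter_comm _ _

lemma isNeighbour_comm {S : Config (Pt d)} {s s' : Pt d} :
    IsNeighbour S s s' ↔ IsNeighbour S s' s := by
  unfold IsNeighbour
  rw [side_comm S s s', ne_comm]
  tauto

/-- A set contained in a level set of `⟪·, w⟫` spans only vectors orthogonal to `w`. -/
lemma vectorSpan_le_orthogonal {A : Set (Pt d)} {W : Set (Pt d)}
    (h : ∀ w ∈ W, ∀ x ∈ A, ∀ y ∈ A, (inner ℝ (x - y) w : ℝ) = 0) :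
    vectorSpan ℝ A ≤ (Submodule.span ℝ W)ᗮ := by
  rw [vectorSpan_def, Submodule.span_le]
  rintro _ ⟨x, hx, y, hy, rfl⟩
  rw [SetLike.mem_coe, Submodule.mem_orthogonal']
  intro w hw
  induction hw using Submodule.span_induction with
  | mem w hw => exact h w hw x hx y hy
  | zero => simp
  | add a b _ _ ha hb => rw [inner_add_right, ha, hb, add_zero]
  | smul c a _ ha => rw [inner_smul_right, ha, mul_zero]

lemma inner_sub_eq_zero_of_mem_side {S : Config (Pt d)} {s s' : Pt d} (hs : s ∈ S) (hs' : s' ∈ S)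
    {x y : Pt d} (hx : x ∈ side S s s') (hy : y ∈ side S s s') :
    (inner ℝ (x - y) (s' - s) : ℝ) = 0 := by
  have h1 := ((mem_side_iff hs hs').1 hx).2
  have h2 := ((mem_side_iff hs hs').1 hy).2
  have : x - y = (x - s) - (y - s) := by abel
  rw [this, inner_sub_left]
  linarith

lemma vectorSpan_side_le {S : Config (Pt d)} {s s' : Pt d} (hs : s ∈ S) (hs' : s' ∈ S) :
    vectorSpan ℝ (side S s s') ≤ (Submodule.span ℝ {s' - s})ᗮ := by
  refine vectorSpan_le_orthogonal ?_
  rintro w rfl x hx y hy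
  exact inner_sub_eq_zero_of_mem_side hs hs' hx hy

lemma finrank_orthogonal_singleton_add_one {w : Pt d} (hw : w ≠ 0) :
    Module.finrank ℝ (Submodule.span ℝ {w})ᗮ + 1 = d := by
  have h := (Submodule.span ℝ {w}).finrank_add_finrank_orthogonal
  rw [finrank_span_singleton hw, finrank_euclideanSpace_fin] at h
  omega

/-- Cells of distinct points that are not neighbours meet in a null set. -/
lemma euclideanHausdorffMeasure_side_eq_zero {S : Config (Pt d)} {s s' : Pt d} (hs : s ∈ S)
    (hs' : s' ∈ S) (hne : s ≠ s') (hn : ¬ IsNeighbour S s s') :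
    μHE[d - 1] (side S s s') = 0 := by
  rcases (side S s s').eq_empty_or_nonempty with h | h
  · simp [h]
  · have h1 := Submodule.finrank_mono (vectorSpan_side_le hs hs')
    have h2 := finrank_orthogonal_singleton_add_one (sub_ne_zero.2 hne.symm)
    have h3 : Module.finrank ℝ (vectorSpan ℝ (side S s s')) + 1 ≠ d := fun h4 =>
      hn ⟨hs, hs', hne, h, h4⟩
    exact euclideanHausdorffMeasure_eq_zero_of_finrank_lt (by omega)

/-- Two sides of a cell meet in a set of dimension at most `d - 2`. -/
lemma euclideanHausdorffMeasure_side_inter_side {S : Config (Pt d)} {s s' s'' : Pt d} (hs : s ∈ S)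
    (hs' : s' ∈ S) (hs'' : s'' ∈ S) (h1 : s ≠ s') (h2 : s ≠ s'') (h3 : s' ≠ s'') :
    μHE[d - 1] (side S s s' ∩ side S s s'') = 0 := by
  rcases (side S s s' ∩ side S s s'').eq_empty_or_nonempty with h | ⟨x, hx', hx''⟩
  · simp [h]
  have e1 := ((mem_side_iff hs hs').1 hx').2
  have e2 := ((mem_side_iff hs hs'').1 hx'').2
  have hw' : s' - s ≠ 0 := sub_ne_zero.2 h1.symm
  have hw'' : s'' - s ≠ 0 := sub_ne_zero.2 h2.symm
  have hli : LinearIndependent ℝ ![s' - s, s'' - s] := by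
    rw [LinearIndependent.pair_iff' hw']
    intro a ha
    -- proportional bisectors through a common point coincide
    rw [← ha, inner_smul_right, norm_smul, mul_pow, Real.norm_eq_abs, sq_abs] at e2
    have hpos : 0 < ‖s' - s‖ ^ 2 := by positivity
    have : a * (a - 1) * ‖s' - s‖ ^ 2 = 0 := by linear_combination (-1) * e2 + a * e1
    rcases mul_eq_zero.1 this with h | h
    · rcases mul_eq_zero.1 h with h | h
      · rw [h, zero_smul] at ha
        exact hw'' ha.symm
      · rw [sub_eq_zero.1 h, one_smul] at ha
        exact h3 (sub_left_injective ha)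
    · exact hpos.ne' h
  have hle : vectorSpan ℝ (side S s s' ∩ side S s s'')
      ≤ (Submodule.span ℝ (Set.range ![s' - s, s'' - s]))ᗮ := by
    refine vectorSpan_le_orthogonal ?_
    rintro _ ⟨i, rfl⟩ x hx y hy
    fin_cases i
    · exact inner_sub_eq_zero_of_mem_side hs hs' hx.1 hy.1
    · exact inner_sub_eq_zero_of_mem_side hs hs'' hx.2 hy.2
  have f1 := Submodule.finrank_mono hle
  have f2 := (Submodule.span ℝ (Set.range ![s' - s, s'' - s])).finrank_add_finrank_orthogonal
  rw [finrank_span_eq_card hli, finrank_euclideanSpace_fin, Fintype.card_fin] at f2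
  exact euclideanHausdorffMeasure_eq_zero_of_finrank_lt (by omega)

lemma side_subset_frontier {S : Config (Pt d)} {s s' : Pt d} (hs : s ∈ S) (hs' : s' ∈ S)
    (hne : s ≠ s') : side S s s' ⊆ frontier (vor S s) := by
  intro x hx
  rw [(isClosed_vor S s).frontier_eq]
  obtain ⟨h1, h2⟩ := (mem_side_iff hs hs').1 hx
  refine ⟨h1, fun hint => ?_⟩
  -- moving from `x` towards `s'` leaves the cell of `s`
  have hc : Tendsto (fun ε : ℝ => x + ε • (s' - s)) (𝓝[>] 0) (𝓝 x) := by
    have : Continuous fun ε : ℝ => x + ε • (s' - s) := by fun_prop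
    have h := this.tendsto 0
    simp only [zero_smul, add_zero] at h
    exact h.mono_left nhdsWithin_le_nhds
  have hev := hc.eventually (isOpen_interior.mem_nhds hint)
  obtain ⟨ε, hε, hε0⟩ := (hev.and self_mem_nhdsWithin).exists
  have h3 := mem_vor_iff.1 (interior_subset hε) s' hs'
  have e : x + ε • (s' - s) - s = (x - s) + ε • (s' - s) := by abel
  rw [e, inner_add_left, inner_smul_left, real_inner_self_eq_norm_sq] at h3
  simp only [conj_trivial] at h3
  have hpos : 0 < ‖s' - s‖ ^ 2 := by
    have := norm_pos_iff.2 (sub_ne_zero.2 hne.symm)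
    positivity
  have hε0 : 0 < ε := hε0
  nlinarith [mul_pos hε0 hpos]

/-- The sides of a cell, being essentially disjoint parts of its boundary, have total area at most
the area of the boundary. -/
lemma tsum_side_le_frontier {S : Config (Pt d)} {s : Pt d} (hs : s ∈ S) :
    ∑' s' : ↥(neighbours S s), μHE[d - 1] (side S s s') ≤ μHE[d - 1] (frontier (vor S s)) := by
  have hcount : (neighbours S s).Countable :=
    S.countable_carrier.mono fun s' (h : IsNeighbour S s s') => h.2.1
  have : Countable ↥(neighbours S s) := hcount.to_subtype
  rw [← measure_iUnion₀]
  · refine measure_mono (iUnion_subset fun s' => ?_)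
    have h : IsNeighbour S s s' := s'.2
    exact side_subset_frontier h.1 h.2.1 h.2.2.1
  · intro s' s'' hne
    have h' : IsNeighbour S s s' := s'.2
    have h'' : IsNeighbour S s s'' := s''.2
    exact euclideanHausdorffMeasure_side_inter_side hs h'.2.1 h''.2.1 h'.2.2.1 h''.2.2.1
      fun h => hne (Subtype.ext h)
  · exact fun s' => (isClosed_side S s s').measurableSet.nullMeasurableSet

/-! ### Shadows of the sides of a cell -/

/-- The hyperplane perpendicular to `u`. -/
abbrev perp (u : Pt d) : Submodule ℝ (Pt d) := (Submodule.span ℝ {u})ᗮ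

lemma projPerp_mem (u : Pt d) (hu : ‖u‖ = 1) (x : Pt d) : projPerp u x ∈ perp u := by
  rw [Submodule.mem_orthogonal_singleton_iff_inner_left, projPerp, inner_sub_left,
    inner_smul_left, real_inner_self_eq_norm_sq, hu]
  simp

lemma projPerp_neg (u x : Pt d) : projPerp (-u) x = projPerp u x := by
  simp [projPerp]

/-- The projection along `u`, as a linear map. -/
def projLin (u : Pt d) (hu : ‖u‖ = 1) : Pt d →ₗ[ℝ] perp u where
  toFun x := ⟨projPerp u x, projPerp_mem u hu x⟩
  map_add' x y := by
    ext1
    simp only [projPerp, inner_add_left, Submodule.coe_add]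
    module
  map_smul' c x := by
    ext1
    simp only [projPerp, inner_smul_left, conj_trivial, RingHom.id_apply, Submodule.coe_smul]
    module

lemma lipschitzWith_projPerp (u : Pt d) (hu : ‖u‖ = 1) : LipschitzWith 1 (projPerp u) := by
  refine LipschitzWith.of_dist_le_mul fun x y => ?_
  rw [dist_eq_norm, dist_eq_norm, NNReal.coe_one, one_mul]
  have e : projPerp u x - projPerp u y = (x - y) - (inner ℝ (x - y) u : ℝ) • u := by
    simp only [projPerp, inner_sub_left]
    module
  rw [e, ← sq_le_sq₀ (norm_nonneg _) (norm_nonneg _), norm_sub_sq_real, norm_smul, hu,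
    inner_smul_right, mul_one, Real.norm_eq_abs, sq_abs]
  nlinarith [sq_nonneg (inner ℝ (x - y) u : ℝ)]

lemma finrank_perp {u : Pt d} (hu : ‖u‖ = 1) : Module.finrank ℝ (perp u) = d - 1 := by
  have : Module.finrank ℝ (perp u) + 1 = d :=
    finrank_orthogonal_singleton_add_one (by rintro rfl; simp at hu)
  omega

lemma euclideanHausdorffMeasure_image_coe {u : Pt d} (hu : ‖u‖ = 1) (B : Set (perp u)) :
    μHE[d - 1] ((↑) '' B : Set (Pt d)) = (volume : Measure (perp u)) B := by
  have h1 : μHE[d - 1] ((↑) '' B : Set (Pt d)) = μHE[d - 1] B :=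
    Isometry.euclideanHausdorffMeasure_image (f := ((↑) : perp u → Pt d)) isometry_subtype_coe B
  rw [h1, ← finrank_perp hu, InnerProductSpace.euclideanHausdorffMeasure_eq_volume]

/-- A convex subset of full dimension of a hyperplane that does not contain the direction `u` has a
projection along `u` of positive measure. -/
lemma projPerp_image_pos {u w : Pt d} (hu : ‖u‖ = 1) (hw : (inner ℝ u w : ℝ) ≠ 0)
    {A : Set (Pt d)} (hA : Convex ℝ A) (hne : A.Nonempty)
    (hin : vectorSpan ℝ A ≤ (Submodule.span ℝ {w})ᗮ)
    (hdim : Module.finrank ℝ (vectorSpan ℝ A) + 1 = d) :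
    0 < μHE[d - 1] (projPerp u '' A) := by
  have e : projPerp u '' A = ((↑) '' (projLin u hu '' A) : Set (Pt d)) := by
    rw [image_image]; rfl
  rw [e, euclideanHausdorffMeasure_image_coe hu]
  have hspan : vectorSpan ℝ (projLin u hu '' A) = ⊤ := by
    apply Submodule.eq_top_of_finrank_eq
    have h1 : vectorSpan ℝ (projLin u hu '' A) = (vectorSpan ℝ A).map (projLin u hu) := by
      have := AffineMap.map_vectorSpan (projLin u hu).toAffineMap (s := A)
      simpa using this.symm
    have hinj : Function.Injective ((projLin u hu).domRestrict (vectorSpan ℝ A)) := by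
      rw [← LinearMap.ker_eq_bot, LinearMap.ker_eq_bot']
      rintro ⟨v, hv⟩ h0
      have h2 : v - (inner ℝ v u : ℝ) • u = 0 := congrArg Subtype.val h0
      have h3 := Submodule.mem_orthogonal_singleton_iff_inner_left.1 (hin hv)
      rw [sub_eq_zero.1 h2, inner_smul_left] at h3
      have h4 : (inner ℝ v u : ℝ) = 0 := (mul_eq_zero.1 h3).resolve_right hw
      rw [h4, zero_smul, sub_zero] at h2
      exact Subtype.ext h2
    rw [h1, finrank_perp hu, ← LinearMap.range_domRestrict, LinearMap.finrank_range_of_inj hinj]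
    omega
  have hint : (interior (projLin u hu '' A)).Nonempty := by
    rw [(hA.linear_image (projLin u hu)).interior_nonempty_iff_affineSpan_eq_top]
    rwa [AffineSubspace.affineSpan_eq_top_iff_vectorSpan_eq_top_of_nonempty _ _ _ (hne.image _)]
  exact (isOpen_interior.measure_pos _ hint).trans_le (measure_mono interior_subset)

/-- The area of the projection along `u` of the common side of the cells of `s` and `s'`. -/
def shadow (u : Pt d) (S : Config (Pt d)) (s s' : Pt d) : ℝ≥0∞ :=
  μHE[d - 1] (projPerp u '' side S s s')

lemma shadow_comm (u : Pt d) (S : Config (Pt d)) (s s' : Pt d) :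
    shadow u S s s' = shadow u S s' s := by
  rw [shadow, side_comm, shadow]

lemma shadow_neg (u : Pt d) (S : Config (Pt d)) (s s' : Pt d) :
    shadow (-u) S s s' = shadow u S s s' := by
  simp only [shadow, projPerp_neg]

lemma shadow_le_side {u : Pt d} (hu : ‖u‖ = 1) (S : Config (Pt d)) (s s' : Pt d) :
    shadow u S s s' ≤ μHE[d - 1] (side S s s') :=
  euclideanHausdorffMeasure_image_le (lipschitzWith_projPerp u hu) _ _

/-- The point in which the line through `y` in direction `u` meets the bisector of `s` and `s'`
(where `u` is not parallel to the bisector). -/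
def lift (u s s' y : Pt d) : Pt d :=
  y + ((‖s' - s‖ ^ 2 / 2 - inner ℝ (y - s) (s' - s)) / inner ℝ u (s' - s)) • u

lemma inner_lift {u s s' : Pt d} (hw : (inner ℝ u (s' - s) : ℝ) ≠ 0) (y : Pt d) :
    2 * (inner ℝ (lift u s s' y - s) (s' - s) : ℝ) = ‖s' - s‖ ^ 2 := by
  have e : lift u s s' y - s = (y - s) +
      ((‖s' - s‖ ^ 2 / 2 - inner ℝ (y - s) (s' - s)) / inner ℝ u (s' - s)) • u := by
    rw [lift]; abel
  rw [e, inner_add_left, inner_smul_left]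
  simp only [conj_trivial]
  field_simp
  ring

lemma lift_eq {u s s' x : Pt d} (hw : (inner ℝ u (s' - s) : ℝ) ≠ 0)
    (hx : 2 * (inner ℝ (x - s) (s' - s) : ℝ) = ‖s' - s‖ ^ 2) : lift u s s' (projPerp u x) = x := by
  have e : projPerp u x - s = (x - s) - (inner ℝ x u : ℝ) • u := by rw [projPerp]; abel
  have e2 : (‖s' - s‖ ^ 2 / 2 - inner ℝ (projPerp u x - s) (s' - s)) / inner ℝ u (s' - s)
      = (inner ℝ x u : ℝ) := by
    rw [e, inner_sub_left, inner_smul_left, ← hx]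
    simp only [conj_trivial]
    field_simp
    ring
  rw [lift, e2, projPerp]
  abel

lemma projPerp_lift {u : Pt d} (hu : ‖u‖ = 1) (s s' : Pt d) (y : perp u) :
    projPerp u (lift u s s' y) = y := by
  have hy : (inner ℝ (y : Pt d) u : ℝ) = 0 :=
    Submodule.mem_orthogonal_singleton_iff_inner_left.1 y.2
  rw [projPerp, lift, inner_add_left, inner_smul_left, hy, real_inner_self_eq_norm_sq, hu]
  simp

lemma continuous_lift (u s s' : Pt d) : Continuous (lift u s s') := by
  unfold lift
  fun_prop

lemma projPerp_image_side {u : Pt d} (hu : ‖u‖ = 1) {S : Config (Pt d)} {s s' : Pt d} (hs : s ∈ S)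
    (hs' : s' ∈ S) (hw : (inner ℝ u (s' - s) : ℝ) ≠ 0) :
    projPerp u '' side S s s'
      = ((↑) '' {y : perp u | lift u s s' y ∈ vor S s} : Set (Pt d)) := by
  ext z
  constructor
  · rintro ⟨x, hx, rfl⟩
    obtain ⟨h1, h2⟩ := (mem_side_iff hs hs').1 hx
    refine ⟨⟨projPerp u x, projPerp_mem u hu x⟩, ?_, rfl⟩
    change lift u s s' (projPerp u x) ∈ vor S s
    rwa [lift_eq hw h2]
  · rintro ⟨y, hy, rfl⟩
    exact ⟨lift u s s' y, (mem_side_iff hs hs').2 ⟨hy, inner_lift hw y⟩, projPerp_lift hu s s' y⟩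

lemma measurableSet_projPerp_image_side {u : Pt d} (hu : ‖u‖ = 1) {S : Config (Pt d)} {s s' : Pt d}
    (hs : s ∈ S) (hs' : s' ∈ S) (hw : (inner ℝ u (s' - s) : ℝ) ≠ 0) :
    MeasurableSet (projPerp u '' side S s s') := by
  rw [projPerp_image_side hu hs hs' hw]
  have h1 : IsClosed {y : perp u | lift u s s' y ∈ vor S s} :=
    (isClosed_vor S s).preimage ((continuous_lift u s s').comp continuous_subtype_val)
  exact ((perp u).closed_of_finiteDimensional.isClosedEmbedding_subtypeVal.isClosedMap _
    h1).measurableSet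

lemma shadow_eq_volume {u : Pt d} (hu : ‖u‖ = 1) {S : Config (Pt d)} {s s' : Pt d} (hs : s ∈ S)
    (hs' : s' ∈ S) (hw : (inner ℝ u (s' - s) : ℝ) ≠ 0) :
    shadow u S s s' = (volume : Measure (perp u)) {y : perp u | lift u s s' y ∈ vor S s} := by
  rw [shadow, projPerp_image_side hu hs hs' hw, euclideanHausdorffMeasure_image_coe hu]

lemma measurable_volume_lift (u : Pt d) : Measurable fun p : Pt d × Pt d × Config (Pt d) =>
    (volume : Measure (perp u)) {y : perp u | lift u p.1 p.2.1 y ∈ vor p.2.2 p.1} := by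
  have hl : Measurable fun q : (Pt d × Pt d × Config (Pt d)) × perp u =>
      lift u q.1.1 q.1.2.1 q.2 := by
    unfold lift
    fun_prop
  have h : MeasurableSet {q : (Pt d × Pt d × Config (Pt d)) × perp u |
      lift u q.1.1 q.1.2.1 q.2 ∈ vor q.1.2.2 q.1.1} :=
    measurableSet_mem_vor.preimage (hl.prodMk (by fun_prop :
      Measurable fun q : (Pt d × Pt d × Config (Pt d)) × perp u => (q.1.1, q.1.2.2)))
  exact measurable_measure_prodMk_left h

/-- Two points are neighbours if and only if their common side has a projection of positive area
along some coordinate direction that is not parallel to it. Unlike the dimension of the side, these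
areas visibly depend measurably on the configuration. -/
lemma isNeighbour_iff_shadow {S : Config (Pt d)} {s s' : Pt d} :
    IsNeighbour S s s' ↔ s ∈ S ∧ s' ∈ S ∧ ∃ i : Fin d,
      (inner ℝ (EuclideanSpace.single i (1 : ℝ)) (s' - s) : ℝ) ≠ 0 ∧
        (volume : Measure (perp (EuclideanSpace.single i (1 : ℝ))))
          {y | lift (EuclideanSpace.single i 1) s s' y ∈ vor S s} ≠ 0 := by
  have hu : ∀ i : Fin d, ‖(EuclideanSpace.single i (1 : ℝ) : Pt d)‖ = 1 := fun i => by simp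
  constructor
  · rintro ⟨hs, hs', hne, hnon, hdim⟩
    refine ⟨hs, hs', ?_⟩
    have hw : s' - s ≠ 0 := sub_ne_zero.2 hne.symm
    obtain ⟨i, hi⟩ : ∃ i, (s' - s) i ≠ 0 := by
      by_contra! h
      exact hw (by ext i; simpa using h i)
    have hi' : (inner ℝ (EuclideanSpace.single i (1 : ℝ)) (s' - s) : ℝ) ≠ 0 := by
      rw [EuclideanSpace.inner_single_left]
      simpa using hi
    refine ⟨i, hi', ?_⟩
    rw [← shadow_eq_volume (hu i) hs hs' hi']
    exact (projPerp_image_pos (hu i) hi' ((convex_vor S s).inter (convex_vor S s')) hnon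
      (vectorSpan_side_le hs hs') hdim).ne'
  · rintro ⟨hs, hs', i, hi, hpos⟩
    by_contra hn
    have hne : s ≠ s' := by
      rintro rfl
      simp at hi
    rw [← shadow_eq_volume (hu i) hs hs' hi] at hpos
    have := shadow_le_side (hu i) S s s'
    rw [euclideanHausdorffMeasure_side_eq_zero hs hs' hne hn] at this
    exact hpos (le_antisymm this bot_le)

lemma measurableSet_isNeighbour :
    MeasurableSet {p : Pt d × Pt d × Config (Pt d) | IsNeighbour p.2.2 p.1 p.2.1} := by
  classical
  have e : {p : Pt d × Pt d × Config (Pt d) | IsNeighbour p.2.2 p.1 p.2.1}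
      = {p | p.1 ∈ p.2.2} ∩ ({p | p.2.1 ∈ p.2.2} ∩ ⋃ i : Fin d,
        ({p | (inner ℝ (EuclideanSpace.single i (1 : ℝ)) (p.2.1 - p.1) : ℝ) = 0}ᶜ ∩
          {p | (volume : Measure (perp (EuclideanSpace.single i (1 : ℝ))))
            {y | lift (EuclideanSpace.single i 1) p.1 p.2.1 y ∈ vor p.2.2 p.1} = 0}ᶜ)) := by
    ext p
    simp only [mem_ofPred_eq, isNeighbour_iff_shadow, mem_inter_iff, mem_iUnion, mem_compl_iff]
  rw [e]
  refine (measurableSet_mem.preimage (by fun_prop :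
      Measurable fun p : Pt d × Pt d × Config (Pt d) => (p.1, p.2.2))).inter
    ((measurableSet_mem.preimage (by fun_prop :
      Measurable fun p : Pt d × Pt d × Config (Pt d) => (p.2.1, p.2.2))).inter
    (MeasurableSet.iUnion fun i => (MeasurableSet.compl ?_).inter (MeasurableSet.compl ?_)))
  · exact measurableSet_eq_fun (by fun_prop) measurable_const
  · exact measurable_volume_lift _ (measurableSet_singleton 0)

/-- The area of the projection along `u`, for neighbours `s` and `s'` such that `s'` lies ahead of
`s` in direction `u`. -/
def posShadow (u : Pt d) (S : Config (Pt d)) (s s' : Pt d) : ℝ≥0∞ :=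
  {s' | IsNeighbour S s s' ∧ 0 < (inner ℝ u (s' - s) : ℝ)}.indicator (shadow u S s) s'

lemma measurable_posShadow {u : Pt d} (hu : ‖u‖ = 1) :
    Measurable fun p : Pt d × Pt d × Config (Pt d) => posShadow u p.2.2 p.1 p.2.1 := by
  have hA : MeasurableSet {p : Pt d × Pt d × Config (Pt d) |
      IsNeighbour p.2.2 p.1 p.2.1 ∧ 0 < (inner ℝ u (p.2.1 - p.1) : ℝ)} :=
    measurableSet_isNeighbour.inter (measurableSet_lt measurable_const
      (by fun_prop : Measurable fun p : Pt d × Pt d × Config (Pt d) =>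
        (inner ℝ u (p.2.1 - p.1) : ℝ)))
  have : (fun p : Pt d × Pt d × Config (Pt d) => posShadow u p.2.2 p.1 p.2.1)
      = {p : Pt d × Pt d × Config (Pt d) | IsNeighbour p.2.2 p.1 p.2.1 ∧
        0 < (inner ℝ u (p.2.1 - p.1) : ℝ)}.indicator fun p =>
          (volume : Measure (perp u)) {y : perp u | lift u p.1 p.2.1 y ∈ vor p.2.2 p.1} := by
    ext p
    by_cases h : IsNeighbour p.2.2 p.1 p.2.1 ∧ 0 < (inner ℝ u (p.2.1 - p.1) : ℝ)
    · rw [posShadow, indicator_of_mem (by exact h), indicator_of_mem (by exact h),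
        shadow_eq_volume hu h.1.1 h.1.2.1 h.2.ne']
    · rw [posShadow, indicator_of_notMem (by exact h), indicator_of_notMem (by exact h)]
  rw [this]
  exact (measurable_volume_lift u).indicator hA

/-- Following the direction `u` from a point of the cell of `s`, one leaves the cell through the
side shared with some `s'` ahead of `s`, as soon as there is any point ahead of `s`. -/
lemma exists_mem_side_of_mem_vor {u : Pt d} {S : Config (Pt d)} {s : Pt d} (hs : s ∈ S)
    (hex : ∃ s' ∈ S, 0 < (inner ℝ u (s' - s) : ℝ)) {x : Pt d} (hx : x ∈ vor S s) :
    ∃ s' ∈ S, 0 < (inner ℝ u (s' - s) : ℝ) ∧ ∃ r : ℝ, x + r • u ∈ side S s s' := by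
  -- the line from `x` in direction `u` meets the bisector of `s` and `s'` at `x + ρ s' • u`
  let ρ : Pt d → ℝ := fun s' => (‖s' - s‖ ^ 2 / 2 - inner ℝ (x - s) (s' - s)) / inner ℝ u (s' - s)
  have hadd : ∀ (r : ℝ) (s' : Pt d), (inner ℝ (x + r • u - s) (s' - s) : ℝ)
      = inner ℝ (x - s) (s' - s) + r * inner ℝ u (s' - s) := by
    intro r s'
    have : x + r • u - s = (x - s) + r • u := by abel
    rw [this, inner_add_left, inner_smul_left]
    simp
  obtain ⟨s₀, hs₀, hpos₀⟩ := hex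
  have hρ : ∀ s' ∈ S, 0 < (inner ℝ u (s' - s) : ℝ) → 0 ≤ ρ s' := fun s' hs' hpos =>
    div_nonneg (by linarith [mem_vor_iff.1 hx s' hs']) hpos.le
  let F : Set (Pt d) := {s' | s' ∈ S ∧ 0 < (inner ℝ u (s' - s) : ℝ) ∧ ρ s' ≤ ρ s₀}
  have hF : F.Finite := by
    -- a point of `F` is as close as `s` to a point of a bounded segment
    refine (S.locallyFinite (Metric.closedBall x (‖x - s‖ + 2 * (ρ s₀ * ‖u‖)))
      Metric.isBounded_closedBall).subset ?_
    rintro s' ⟨hs', hpos, hle⟩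
    refine ⟨hs', ?_⟩
    have hd : dist (x + ρ s' • u) s' ≤ dist (x + ρ s' • u) s := by
      have h2 : 2 * (inner ℝ (x + ρ s' • u - s) (s' - s) : ℝ) = ‖s' - s‖ ^ 2 := by
        rw [hadd]
        simp only [ρ]
        field_simp
        ring
      rw [dist_le_dist_iff_inner, inner_sub_swap, norm_sub_rev s s']
      linarith
    have hn : ‖ρ s' • u‖ ≤ ρ s₀ * ‖u‖ := by
      rw [norm_smul, Real.norm_eq_abs, abs_of_nonneg (hρ s' hs' hpos)]
      gcongr
    rw [Metric.mem_closedBall, dist_comm]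
    have h1 : dist x s' ≤ dist x (x + ρ s' • u) + dist (x + ρ s' • u) s' := dist_triangle _ _ _
    have h2 : dist (x + ρ s' • u) s ≤ dist (x + ρ s' • u) x + dist x s := dist_triangle _ _ _
    rw [dist_self_add_right] at h1
    rw [dist_self_add_left, dist_eq_norm x s] at h2
    linarith
  obtain ⟨s₁, ⟨hs₁, hpos₁, hle₁⟩, hmin⟩ :=
    Set.exists_min_image F ρ hF ⟨s₀, hs₀, hpos₀, le_rfl⟩
  have hbis : 2 * (inner ℝ (x + ρ s₁ • u - s) (s₁ - s) : ℝ) = ‖s₁ - s‖ ^ 2 := by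
    rw [hadd]
    simp only [ρ]
    field_simp
    ring
  refine ⟨s₁, hs₁, hpos₁, ρ s₁, (mem_side_iff hs hs₁).2 ⟨mem_vor_iff.2 fun s' hs' => ?_, hbis⟩⟩
  rw [hadd]
  have h1 := mem_vor_iff.1 hx s' hs'
  rcases le_or_gt (inner ℝ u (s' - s) : ℝ) 0 with hneg | hpos
  · nlinarith [mul_nonneg (hρ s₁ hs₁ hpos₁) (neg_nonneg.2 hneg)]
  · have h2 : ρ s₁ ≤ ρ s' := by
      rcases le_or_gt (ρ s') (ρ s₀) with h | h
      · exact hmin s' ⟨hs', hpos, h⟩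
      · linarith
    have h3 : ρ s₁ * inner ℝ u (s' - s) ≤ ‖s' - s‖ ^ 2 / 2 - inner ℝ (x - s) (s' - s) :=
      (le_div_iff₀ hpos).1 h2
    linarith

/-- The sides ahead of `s` cover, essentially without overlap, the projection of the cell. -/
lemma tsum_posShadow_eq {u : Pt d} (hu : ‖u‖ = 1) {S : Config (Pt d)} {s : Pt d} (hs : s ∈ S)
    (hex : ∃ s' ∈ S, 0 < (inner ℝ u (s' - s) : ℝ)) :
    ∑' s' : S.carrier, posShadow u S s s' = μHE[d - 1] (projPerp u '' vor S s) := by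
  let I := {s' : S.carrier | 0 < (inner ℝ u ((s' : Pt d) - s) : ℝ)}
  have hne : ∀ i : I, s ≠ ((i : S.carrier) : Pt d) := fun i h => by
    have h2 := i.2
    simp only [I, mem_ofPred_eq, ← h] at h2
    simp at h2
  have h1 : projPerp u '' vor S s = ⋃ i : I, projPerp u '' side S s (i : S.carrier) := by
    ext z
    simp only [mem_iUnion]
    constructor
    · rintro ⟨x, hx, rfl⟩
      obtain ⟨s', hs', hpos, r, hr⟩ := exists_mem_side_of_mem_vor hs hex hx
      refine ⟨⟨⟨s', hs'⟩, hpos⟩, x + r • u, hr, ?_⟩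
      rw [projPerp, projPerp, inner_add_left, inner_smul_left, real_inner_self_eq_norm_sq, hu]
      simp only [conj_trivial, one_pow, mul_one]
      module
    · rintro ⟨i, x, hx, rfl⟩
      exact ⟨x, hx.1, rfl⟩
  rw [h1, measure_iUnion₀]
  · have h2 : ∑' i : I, shadow u S s (i : S.carrier)
        = ∑' s' : S.carrier, I.indicator (fun s' : S.carrier => shadow u S s s') s' :=
      tsum_subtype I fun s' : S.carrier => shadow u S s s'
    refine Eq.trans ?_ h2.symm
    refine tsum_congr fun s' => ?_
    rw [posShadow]
    by_cases hpos : 0 < (inner ℝ u ((s' : Pt d) - s) : ℝ)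
    · rw [indicator_of_mem (s := I) (by exact hpos)]
      by_cases hn : IsNeighbour S s s'
      · rw [indicator_of_mem (by exact ⟨hn, hpos⟩)]
      · rw [indicator_of_notMem (by exact fun h => hn h.1)]
        refine (le_antisymm ((shadow_le_side hu S s s').trans ?_) bot_le).symm
        exact (euclideanHausdorffMeasure_side_eq_zero hs s'.2 (hne ⟨s', hpos⟩) hn).le
    · rw [indicator_of_notMem (s := I) (by exact hpos),
        indicator_of_notMem (by exact fun h => hpos h.2)]
  · -- two sides ahead of `s` meet a given line in the same point, if at all
    have key : ∀ (i j : I) (x y : Pt d), x ∈ side S s (i : S.carrier) →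
        y ∈ side S s (j : S.carrier) → projPerp u x = projPerp u y →
          (inner ℝ y u : ℝ) ≤ inner ℝ x u := by
      intro i j x y hx hy hxy
      have h2 := ((mem_side_iff hs (i : S.carrier).2).1 hx).2
      have h3 := mem_vor_iff.1 ((mem_side_iff hs (j : S.carrier).2).1 hy).1 _ (i : S.carrier).2
      have hi : 0 < (inner ℝ u (((i : S.carrier) : Pt d) - s) : ℝ) := i.2
      have e : y - s = (x - s) + ((inner ℝ y u : ℝ) - inner ℝ x u) • u := by
        have hxy' : y = x - (inner ℝ x u : ℝ) • u + (inner ℝ y u : ℝ) • u :=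
          eq_add_of_sub_eq hxy.symm
        nth_rewrite 1 [hxy']
        module
      rw [e, inner_add_left, inner_smul_left] at h3
      simp only [conj_trivial] at h3
      by_contra! hlt
      nlinarith [mul_pos (sub_pos.2 hlt) hi]
    intro i j hij
    refine measure_mono_null (t := projPerp u '' (side S s (i : S.carrier) ∩
      side S s (j : S.carrier))) ?_ ?_
    · rintro _ ⟨⟨x, hx, rfl⟩, ⟨y, hy, hxy⟩⟩
      have e : (inner ℝ x u : ℝ) = inner ℝ y u :=
        le_antisymm (key j i y x hy hx hxy) (key i j x y hx hy hxy.symm)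
      have : y = x := by
        simp only [projPerp, e] at hxy
        exact sub_left_injective hxy
      subst this
      exact ⟨y, ⟨hx, hy⟩, rfl⟩
    · refine le_antisymm ?_ bot_le
      refine (euclideanHausdorffMeasure_image_le (lipschitzWith_projPerp u hu) _ _).trans
        (le_of_eq ?_)
      exact euclideanHausdorffMeasure_side_inter_side hs (i : S.carrier).2 (j : S.carrier).2
        (hne i) (hne j) fun h => hij (Subtype.ext (Subtype.ext h))
  · intro i
    have hi : 0 < (inner ℝ u (((i : S.carrier) : Pt d) - s) : ℝ) := i.2
    exact (measurableSet_projPerp_image_side hu hs (i : S.carrier).2 hi.ne').nullMeasurableSet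

/-- The projected areas of the sides ahead of `s` and of those behind `s` balance: both families
cover the projection of the cell. This is the divergence theorem for the field `ω_u`. -/
lemma tsum_posShadow_eq_tsum_posShadow_neg {u : Pt d} (hu : ‖u‖ = 1) {S : Config (Pt d)} {s : Pt d}
    (hs : s ∈ S) (hex : ∃ s' ∈ S, 0 < (inner ℝ u (s' - s) : ℝ))
    (hex' : ∃ s' ∈ S, 0 < (inner ℝ (-u) (s' - s) : ℝ)) :
    ∑' s' : S.carrier, posShadow u S s s' = ∑' s' : S.carrier, posShadow (-u) S s s' := by
  rw [tsum_posShadow_eq hu hs hex, tsum_posShadow_eq (by simpa using hu) hs hex']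
  simp only [projPerp_neg]

lemma tsum_posShadow_le_frontier {u : Pt d} (hu : ‖u‖ = 1) {S : Config (Pt d)} {s : Pt d}
    (hs : s ∈ S) :
    ∑' s' : S.carrier, posShadow u S s s' ≤ μHE[d - 1] (frontier (vor S s)) := by
  refine le_trans ?_ (tsum_side_le_frontier hs)
  have h1 : ∑' s' : S.carrier, posShadow u S s s'
      ≤ ∑' s' : S.carrier, (neighbours S s).indicator (fun s' => μHE[d - 1] (side S s s')) s' := by
    refine ENNReal.tsum_le_tsum fun s' => ?_
    rw [posShadow]
    by_cases hn : IsNeighbour S s s'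
    · rw [indicator_of_mem (s := neighbours S s) (by exact hn)]
      refine (indicator_le_self' (fun _ _ => bot_le) _).trans (shadow_le_side hu S s s')
    · rw [indicator_of_notMem (by exact fun h => hn h.1)]
      exact bot_le
  refine h1.trans (le_of_eq ?_)
  rw [tsum_subtype S.carrier, tsum_subtype (neighbours S s) fun s' => μHE[d - 1] (side S s s'),
    indicator_indicator]
  congr 2
  ext s'
  congr 1
  exact inter_eq_right.2 fun s'' (h : IsNeighbour S s s'') => h.2.1

end

section

/-! ### Independent Poisson clocks -/

section Poisson

variable {Ω : Type*}

/-- The event that the `m`-th clock has no epoch in `U m`, for every `m`. -/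
def voidEvent (T : ℕ → Ω → Config ℝ) (U : ℕ → Set ℝ) : Set Ω :=
  {ω | ∀ m, (T m ω).carrier ∩ U m = ∅}

/-- The last epoch of the `n`-th clock in the window `(0, r)`. -/
def lastEpoch (T : ℕ → Ω → Config ℝ) (n : ℕ) (p : ℝ × Ω) : ℝ :=
  sSup ((T n p.2).carrier ∩ Ioo 0 p.1)

/-- The `n`-th clock has an epoch in the window `(0, r)`. -/
def hasEpoch (T : ℕ → Ω → Config ℝ) (n : ℕ) : Set (ℝ × Ω) :=
  {p | ((T n p.2).carrier ∩ Ioo 0 p.1).Nonempty}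

/-- The set of pairs `(r, ω)` for which the clocks tell a walk that starts at (the point with index)
`n` at time `r` and runs backward in time to jump exactly as many times as the list `l` is long,
provided that it moves through the successive entries of `l`. -/
def pathEvent (T : ℕ → Ω → Config ℝ) : ℕ → List ℕ → Set (ℝ × Ω)
  | n, [] => (hasEpoch T n)ᶜ
  | n, m :: l => hasEpoch T n ∩ (fun p => (lastEpoch T n p, p.2)) ⁻¹' pathEvent T m l

lemma lt_lastEpoch_iff (T : ℕ → Ω → Config ℝ) (n : ℕ) {a : ℝ} (ha : 0 ≤ a) (p : ℝ × Ω) :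
    a < lastEpoch T n p ↔ ((T n p.2).carrier ∩ Ioo a p.1).Nonempty := by
  have hfin : ((T n p.2).carrier ∩ Ioo 0 p.1).Finite :=
    (T n p.2).locallyFinite _ (Metric.isBounded_Ioo _ _)
  constructor
  · intro h
    have hne : ((T n p.2).carrier ∩ Ioo 0 p.1).Nonempty := by
      by_contra hne
      rw [not_nonempty_iff_eq_empty] at hne
      rw [lastEpoch, hne, Real.sSup_empty] at h
      linarith
    have := hne.csSup_mem hfin
    exact ⟨_, this.1, h, this.2.2⟩
  · rintro ⟨τ, hτ, h1, h2⟩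
    exact h1.trans_le (le_csSup hfin.bddAbove ⟨hτ, ha.trans_lt h1, h2⟩)

/-- The generating sets `(a, ∞) × V` of the predictable σ-algebra, where `V` is a void event
for sets contained in `(0, a]`. -/
def predictableSets (T : ℕ → Ω → Config ℝ) : Set (Set (ℝ × Ω)) :=
  {D | ∃ (a : ℝ) (U : ℕ → Set ℝ) (M : ℕ), 0 ≤ a ∧ (∀ m, MeasurableSet (U m)) ∧
    (∀ m, U m ⊆ Ioc 0 a) ∧ (∀ m, M ≤ m → U m = ∅) ∧ D = Ioi a ×ˢ voidEvent T U}

/-- The predictable σ-algebra of the clocks, with time running backward: whether `(r, ω)` belongs to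
a predictable set is decided by the epochs of `ω` before `r`. -/
abbrev predictable (T : ℕ → Ω → Config ℝ) : MeasurableSpace (ℝ × Ω) :=
  MeasurableSpace.generateFrom (predictableSets T)

lemma voidEvent_inter (T : ℕ → Ω → Config ℝ) (U U' : ℕ → Set ℝ) :
    voidEvent T U ∩ voidEvent T U' = voidEvent T fun m => U m ∪ U' m := by
  ext ω
  simp only [voidEvent, mem_inter_iff, mem_ofPred_eq, inter_union_distrib_left, union_empty_iff]
  exact ⟨fun h m => ⟨h.1 m, h.2 m⟩, fun h => ⟨fun m => (h m).1, fun m => (h m).2⟩⟩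

lemma isPiSystem_predictableSets (T : ℕ → Ω → Config ℝ) : IsPiSystem (predictableSets T) := by
  rintro _ ⟨a, U, M, ha, hU, hUa, hM, rfl⟩ _ ⟨a', U', M', ha', hU', hUa', hM', rfl⟩ -
  refine ⟨max a a', fun m => U m ∪ U' m, max M M', le_max_of_le_left ha,
    fun m => (hU m).union (hU' m), fun m => union_subset
      ((hUa m).trans (Ioc_subset_Ioc_right (le_max_left _ _)))
      ((hUa' m).trans (Ioc_subset_Ioc_right (le_max_right _ _))), fun m hm => ?_, ?_⟩
  · simp only [hM m ((le_max_left _ _).trans hm), hM' m ((le_max_right _ _).trans hm), union_empty]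
  · rw [prod_inter_prod, Ioi_inter_Ioi, voidEvent_inter]

/-- One more void condition, on the `n`-th clock. -/
def addVoid (U : ℕ → Set ℝ) (n : ℕ) (V : Set ℝ) : ℕ → Set ℝ :=
  fun m => U m ∪ if m = n then V else ∅

lemma mem_voidEvent_addVoid {T : ℕ → Ω → Config ℝ} {U : ℕ → Set ℝ} {n : ℕ} {V : Set ℝ} {ω : Ω} :
    ω ∈ voidEvent T (addVoid U n V) ↔ ω ∈ voidEvent T U ∧ (T n ω).carrier ∩ V = ∅ := by
  have : voidEvent T (addVoid U n V) = voidEvent T U ∩ voidEvent T fun m =>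
      if m = n then V else ∅ := (voidEvent_inter T U _).symm
  rw [this]
  refine and_congr_right fun _ => ?_
  constructor
  · intro h; simpa using h n
  · intro h m
    by_cases hm : m = n
    · subst hm; simpa using h
    · simp [hm]

lemma predictableSet_addVoid {T : ℕ → Ω → Config ℝ} {a b : ℝ} {U : ℕ → Set ℝ} {M : ℕ} (ha : 0 ≤ a)
    (hab : a ≤ b) (hU : ∀ m, MeasurableSet (U m)) (hUa : ∀ m, U m ⊆ Ioc 0 a)
    (hM : ∀ m, M ≤ m → U m = ∅) (n : ℕ) :
    Ioi b ×ˢ voidEvent T (addVoid U n (Ioc a b)) ∈ predictableSets T := by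
  refine ⟨b, _, max M (n + 1), ha.trans hab, fun m => ?_, fun m => ?_, fun m hm => ?_, rfl⟩
  · simp only [addVoid]
    split_ifs
    · exact (hU m).union measurableSet_Ioc
    · simpa using hU m
  · refine union_subset ((hUa m).trans (Ioc_subset_Ioc_right hab)) ?_
    split_ifs
    · exact Ioc_subset_Ioc_left ha
    · exact empty_subset _
  · have h1 : m ≠ n := by
      have := (le_max_right M (n + 1)).trans hm
      omega
    simp [addVoid, h1, hM m ((le_max_left _ _).trans hm)]

/-- The event that the last epoch before `r` falls into `(a, r)`, intersected with a void event up
to time `a`, is predictable. -/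
lemma measurableSet_predictable_aux {T : ℕ → Ω → Config ℝ} {a : ℝ} {U : ℕ → Set ℝ} {M : ℕ}
    (ha : 0 ≤ a) (hU : ∀ m, MeasurableSet (U m)) (hUa : ∀ m, U m ⊆ Ioc 0 a)
    (hM : ∀ m, M ≤ m → U m = ∅) (n : ℕ) :
    MeasurableSet[predictable T]
      {p : ℝ × Ω | ((T n p.2).carrier ∩ Ioo a p.1).Nonempty ∧ p.2 ∈ voidEvent T U} := by
  have e : {p : ℝ × Ω | ((T n p.2).carrier ∩ Ioo a p.1).Nonempty ∧ p.2 ∈ voidEvent T U}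
      = ⋃ q : {q : ℚ // a < q}, (Ioi ((q : ℚ) : ℝ) ×ˢ voidEvent T U) \
        (Ioi ((q : ℚ) : ℝ) ×ˢ voidEvent T (addVoid U n (Ioc a (q : ℚ)))) := by
    ext ⟨r, ω⟩
    simp only [mem_iUnion, Set.mem_sdiff, mem_prod, mem_Ioi, mem_ofPred_eq, mem_voidEvent_addVoid,
      Subtype.exists, exists_prop]
    constructor
    · rintro ⟨⟨τ, hτ, h1, h2⟩, hω⟩
      obtain ⟨q, hq1, hq2⟩ := exists_rat_btwn h2
      refine ⟨q, h1.trans hq1, ⟨hq2, hω⟩, fun h => ?_⟩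
      have : τ ∈ (T n ω).carrier ∩ Ioc a q := ⟨hτ, h1, hq1.le⟩
      rw [h.2.2] at this
      exact this
    · rintro ⟨q, hq, ⟨hqr, hω⟩, h⟩
      refine ⟨?_, hω⟩
      have hne : ((T n ω).carrier ∩ Ioc a q).Nonempty := by
        rw [nonempty_iff_ne_empty]
        exact fun h0 => h ⟨hqr, hω, h0⟩
      obtain ⟨τ, hτ, h1, h2⟩ := hne
      exact ⟨τ, hτ, h1, h2.trans_lt hqr⟩
  rw [e]
  refine MeasurableSet.iUnion fun q => MeasurableSet.diff ?_ ?_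
  · exact MeasurableSpace.measurableSet_generateFrom ⟨_, U, M, ha.trans q.2.le, hU,
      fun m => (hUa m).trans (Ioc_subset_Ioc_right q.2.le), hM, rfl⟩
  · exact MeasurableSpace.measurableSet_generateFrom (predictableSet_addVoid ha q.2.le hU hUa hM n)

lemma measurableSet_predictable_hasEpoch (T : ℕ → Ω → Config ℝ) (n : ℕ) :
    MeasurableSet[predictable T] (hasEpoch T n) := by
  have h := measurableSet_predictable_aux (T := T) (a := 0) (U := fun _ => ∅) (M := 0) le_rfl
    (fun _ => MeasurableSet.empty) (fun _ => empty_subset _) (fun _ _ => rfl) n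
  convert h using 1
  ext p
  simp [hasEpoch, voidEvent]

/-- Whether the walk follows a path is decided by the epochs before its start. -/
lemma measurableSet_predictable_pathEvent (T : ℕ → Ω → Config ℝ) (l : List ℕ) :
    ∀ n, MeasurableSet[predictable T] (pathEvent T n l) := by
  induction l with
  | nil => exact fun n => (measurableSet_predictable_hasEpoch T n).compl
  | cons m l ih =>
    intro n
    have key : ∀ D, MeasurableSet[predictable T] D → MeasurableSet[predictable T]
        (hasEpoch T n ∩ (fun p : ℝ × Ω => (lastEpoch T n p, p.2)) ⁻¹' D) := by
      intro D hD
      induction D, hD using MeasurableSpace.generateFrom_induction with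
      | hC D hD _ =>
        obtain ⟨a, U, M, ha, hU, hUa, hM, rfl⟩ := hD
        convert measurableSet_predictable_aux ha hU hUa hM n using 1
        ext p
        simp only [mem_inter_iff, mem_preimage, mem_prod, mem_Ioi, mem_ofPred_eq,
          lt_lastEpoch_iff T n ha, hasEpoch]
        refine ⟨fun h => h.2, fun h => ⟨?_, h⟩⟩
        exact h.1.mono (inter_subset_inter_right _ (Ioo_subset_Ioo_left ha))
      | empty => simp
      | compl D _ ih =>
        have e : hasEpoch T n ∩ (fun p : ℝ × Ω => (lastEpoch T n p, p.2)) ⁻¹' Dᶜ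
            = hasEpoch T n \
              (hasEpoch T n ∩ (fun p : ℝ × Ω => (lastEpoch T n p, p.2)) ⁻¹' D) := by
          ext p; simp
        rw [e]
        exact (measurableSet_predictable_hasEpoch T n).diff ih
      | iUnion D _ ih =>
        rw [preimage_iUnion, inter_iUnion]
        exact MeasurableSet.iUnion ih
    exact key _ (ih m)

variable [MeasurableSpace Ω] {P : Measure Ω} {T : ℕ → Ω → Config ℝ}

lemma measurableSet_voidEvent (hT : ∀ n, IsPoissonProcess P (T n)) {U : ℕ → Set ℝ}
    (hU : ∀ m, MeasurableSet (U m)) : MeasurableSet (voidEvent T U) := by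
  have : voidEvent T U = ⋂ m, (T m) ⁻¹' {S : Config ℝ | ∃ s ∈ S, s ∈ U m}ᶜ := by
    ext ω
    simp only [voidEvent, mem_ofPred_eq, mem_iInter, mem_preimage, mem_compl_iff,
      eq_empty_iff_forall_notMem, mem_inter_iff, not_exists, not_and]
    rfl
  rw [this]
  refine MeasurableSet.iInter fun m => (hT m).measurable ?_
  exact (measurableSet_exists_mem (g := fun S : Config ℝ => S) measurable_id
    (P := fun _ s => s ∈ U m) (measurable_snd (hU m))).compl

lemma predictable_le (hT : ∀ n, IsPoissonProcess P (T n)) :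
    predictable T ≤ (inferInstance : MeasurableSpace (ℝ × Ω)) := by
  refine MeasurableSpace.generateFrom_le ?_
  rintro _ ⟨a, U, M, -, hU, -, -, rfl⟩
  exact measurableSet_Ioi.prod (measurableSet_voidEvent hT hU)

lemma measurableSet_pathEvent (hT : ∀ n, IsPoissonProcess P (T n)) (n : ℕ) (l : List ℕ) :
    MeasurableSet (pathEvent T n l) :=
  predictable_le hT _ (measurableSet_predictable_pathEvent T l n)

/-- Void probabilities of one clock. -/
lemma prob_void (hT : ∀ n, IsPoissonProcess P (T n)) (n : ℕ) {B : Set ℝ}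
    (hb : Bornology.IsBounded B) (hB : MeasurableSet B) :
    P {ω | (T n ω).carrier ∩ B = ∅} = ENNReal.ofReal (Real.exp (-(volume B).toReal)) := by
  have h := congrArg (fun μ => μ {0}) ((hT n).law B hb hB)
  beta_reduce at h
  have hm : Measurable fun ω => ((T n ω).carrier ∩ B).ncard :=
    (measurable_ncard hb hB).comp (hT n).measurable
  rw [Measure.map_apply hm (measurableSet_singleton 0), poissonMeasure_singleton] at h
  have e : {ω | (T n ω).carrier ∩ B = ∅}
      = (fun ω => ((T n ω).carrier ∩ B).ncard) ⁻¹' {0} := by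
    ext ω
    simp only [mem_ofPred_eq, mem_preimage, mem_singleton_iff]
    rw [ncard_eq_zero ((T n ω).locallyFinite B hb)]
  rw [e, h, pow_zero, Nat.factorial_zero, Nat.cast_one, mul_one, div_one]
  rfl

/-- Void probabilities of all the clocks together. -/
lemma prob_voidEvent [IsProbabilityMeasure P] (hT : ∀ n, IsPoissonProcess P (T n))
    (hTi : iIndepFun T P) {U : ℕ → Set ℝ} {M : ℕ} (hU : ∀ m, MeasurableSet (U m))
    (hb : ∀ m, Bornology.IsBounded (U m)) (hM : ∀ m, M ≤ m → U m = ∅) :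
    P (voidEvent T U)
      = ENNReal.ofReal (Real.exp (-∑ m ∈ Finset.range M, (volume (U m)).toReal)) := by
  have hset : ∀ m, MeasurableSet {S : Config ℝ | S.carrier ∩ U m = ∅} := fun m => by
    have : {S : Config ℝ | S.carrier ∩ U m = ∅} = {S : Config ℝ | ∃ s ∈ S, s ∈ U m}ᶜ := by
      ext S
      simp only [mem_ofPred_eq, mem_compl_iff, eq_empty_iff_forall_notMem, mem_inter_iff,
        not_exists, not_and]
      rfl
    rw [this]
    exact (measurableSet_exists_mem (g := fun S : Config ℝ => S) measurable_id
      (P := fun _ s => s ∈ U m) (measurable_snd (hU m))).compl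
  have e : voidEvent T U
      = ⋂ m ∈ Finset.range M, T m ⁻¹' {S : Config ℝ | S.carrier ∩ U m = ∅} := by
    ext ω
    simp only [voidEvent, mem_ofPred_eq, mem_iInter, Finset.mem_range, mem_preimage]
    refine ⟨fun h m _ => h m, fun h m => ?_⟩
    rcases lt_or_ge m M with hm | hm
    · exact h m hm
    · simp [hM m hm]
  rw [e, hTi.measure_inter_preimage_eq_mul (Finset.range M) fun m _ => hset m]
  have h1 : ∀ m ∈ Finset.range M, P (T m ⁻¹' {S : Config ℝ | S.carrier ∩ U m = ∅})
      = ENNReal.ofReal (Real.exp (-(volume (U m)).toReal)) := fun m _ =>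
    prob_void hT m (hb m) (hU m)
  rw [Finset.prod_congr rfl h1, ← ENNReal.ofReal_prod_of_nonneg fun _ _ => (Real.exp_pos _).le,
    ← Real.exp_sum, Finset.sum_neg_distrib]

lemma prob_voidEvent_addVoid [IsProbabilityMeasure P] (hT : ∀ n, IsPoissonProcess P (T n))
    (hTi : iIndepFun T P) {U : ℕ → Set ℝ} {M : ℕ} (hU : ∀ m, MeasurableSet (U m))
    (hb : ∀ m, Bornology.IsBounded (U m)) (hM : ∀ m, M ≤ m → U m = ∅) (n : ℕ) {V : Set ℝ}
    (hV : MeasurableSet V) (hbV : Bornology.IsBounded V) (hd : Disjoint (U n) V) :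
    P (voidEvent T (addVoid U n V))
      = P (voidEvent T U) * ENNReal.ofReal (Real.exp (-(volume V).toReal)) := by
  rw [prob_voidEvent hT hTi hU hb (M := max M (n + 1))
      fun m hm => hM m ((le_max_left _ _).trans hm),
    prob_voidEvent hT hTi (M := max M (n + 1)), ← ENNReal.ofReal_mul (Real.exp_pos _).le,
    ← Real.exp_add]
  · congr 2
    rw [← neg_add]
    congr 1
    have h1 : ∀ m, (volume (addVoid U n V m)).toReal
        = (volume (U m)).toReal + if m = n then (volume V).toReal else 0 := by
      intro m
      by_cases hm : m = n
      · subst hm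
        simp only [addVoid, if_true]
        rw [measure_union hd hV, ENNReal.toReal_add (hb m).measure_lt_top.ne hbV.measure_lt_top.ne]
      · simp [addVoid, hm]
    simp_rw [h1]
    rw [Finset.sum_add_distrib, Finset.sum_ite_eq']
    simp
  · intro m
    simp only [addVoid]
    split_ifs
    · exact (hU m).union hV
    · simpa using hU m
  · intro m
    simp only [addVoid]
    split_ifs
    · exact (hb m).union hbV
    · simpa using hb m
  · intro m hm
    have h1 : m ≠ n := by
      have := (le_max_right M (n + 1)).trans hm
      omega
    simp [addVoid, h1, hM m ((le_max_left _ _).trans hm)]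

/-- The law of the last epoch before `t`, on the event that it exists. -/
def lastEpochLaw (t : ℝ) : Measure ℝ :=
  (volume.restrict (Ioo 0 t)).withDensity fun r => ENNReal.ofReal (Real.exp (-(t - r)))

lemma lintegral_Ioo_exp {a t : ℝ} (hat : a ≤ t) :
    ∫⁻ r in Ioo a t, ENNReal.ofReal (Real.exp (-(t - r)))
      = ENNReal.ofReal (1 - Real.exp (-(t - a))) := by
  rw [← ofReal_integral_eq_lintegral_ofReal]
  · congr 1
    rw [← integral_Ioc_eq_integral_Ioo, ← intervalIntegral.integral_of_le hat]
    have hd : ∀ r ∈ uIcc a t,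
        HasDerivAt (fun r => Real.exp (-(t - r))) (Real.exp (-(t - r))) r := by
      intro r _
      have h1 : HasDerivAt (fun r : ℝ => -(t - r)) 1 r := by
        have h := (hasDerivAt_id r).sub_const t
        simp only [id, neg_sub] at h ⊢
        exact h
      simpa using h1.exp
    rw [intervalIntegral.integral_eq_sub_of_hasDerivAt hd
      (Continuous.intervalIntegrable (by fun_prop) _ _)]
    simp
  · exact (Continuous.integrableOn_Icc (by fun_prop)).mono_set Ioo_subset_Icc_self
  · exact Eventually.of_forall fun r => (Real.exp_pos _).le

lemma lastEpochLaw_Ioi {a t : ℝ} (ha : 0 ≤ a) :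
    lastEpochLaw t (Ioi a) = ENNReal.ofReal (1 - Real.exp (-(volume (Ioo a t)).toReal)) := by
  rw [lastEpochLaw, withDensity_apply _ measurableSet_Ioi,
    Measure.restrict_restrict measurableSet_Ioi]
  have e : Ioi a ∩ Ioo 0 t = Ioo a t := by
    ext r
    simp only [mem_inter_iff, mem_Ioi, mem_Ioo]
    exact ⟨fun h => ⟨h.1, h.2.2⟩, fun h => ⟨h.1, ha.trans_lt h.1, h.2⟩⟩
  rw [e]
  rcases le_total a t with h | h
  · rw [lintegral_Ioo_exp h, Real.volume_Ioo, ENNReal.toReal_ofReal (by linarith)]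
  · simp [Ioo_eq_empty_of_le h]

instance (t : ℝ) : IsFiniteMeasure (lastEpochLaw t) := by
  refine ⟨?_⟩
  rw [lastEpochLaw, withDensity_apply _ MeasurableSet.univ, Measure.restrict_univ]
  rcases le_total 0 t with h | h
  · rw [lintegral_Ioo_exp h]
    exact ENNReal.ofReal_lt_top
  · simp [Ioo_eq_empty_of_le h]

lemma measurable_lastEpoch (hT : ∀ n, IsPoissonProcess P (T n)) (n : ℕ) :
    Measurable (lastEpoch T n) := by
  refine measurable_of_Ioi fun a => ?_
  rcases lt_or_ge a 0 with ha | ha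
  · have : lastEpoch T n ⁻¹' Ioi a = univ := by
      ext p
      simp only [mem_preimage, mem_Ioi, mem_univ, iff_true]
      exact ha.trans_le (Real.sSup_nonneg fun x hx => hx.2.1.le)
    rw [this]
    exact MeasurableSet.univ
  · have h := predictable_le hT _ (measurableSet_predictable_aux (T := T) (a := a)
      (U := fun _ => ∅) (M := 0) ha (fun _ => MeasurableSet.empty) (fun _ => empty_subset _)
      (fun _ _ => rfl) n)
    convert h using 1
    ext p
    simp [lt_lastEpoch_iff T n ha, voidEvent]

/-- On predictable sets, the last epoch before `t` of a clock is distributed as if it were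
independent of all the clocks. On the generating sets this is a relation between
void probabilities. Hence a walk that jumps at `r` finds fresh clocks before `r`, even if it returns
to a point where it has been before. -/
lemma prob_lastEpoch_mem [IsProbabilityMeasure P] (hT : ∀ n, IsPoissonProcess P (T n))
    (hTi : iIndepFun T P) (n : ℕ) (t : ℝ) {D : Set (ℝ × Ω)} (hD : MeasurableSet[predictable T] D) :
    P {ω | (t, ω) ∈ hasEpoch T n ∧ (lastEpoch T n (t, ω), ω) ∈ D}
      = ∫⁻ r, P {ω | (r, ω) ∈ D} ∂lastEpochLaw t := by
  have hE : MeasurableSet {ω | (t, ω) ∈ hasEpoch T n} :=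
    measurable_prodMk_left (predictable_le hT _ (measurableSet_predictable_hasEpoch T n))
  have hφ : Measurable fun ω => (lastEpoch T n (t, ω), ω) :=
    ((measurable_lastEpoch hT n).comp measurable_prodMk_left).prodMk measurable_id
  let μ : Measure (ℝ × Ω) := (P.restrict {ω | (t, ω) ∈ hasEpoch T n}).map
    fun ω => (lastEpoch T n (t, ω), ω)
  have hμ : ∀ D, MeasurableSet D →
      μ D = P {ω | (t, ω) ∈ hasEpoch T n ∧ (lastEpoch T n (t, ω), ω) ∈ D} := fun D hD => by
    rw [Measure.map_apply hφ hD, Measure.restrict_apply (hφ hD), inter_comm]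
    rfl
  have hC : ∀ D ∈ predictableSets T, μ D = (lastEpochLaw t).prod P D := by
    rintro _ ⟨a, U, M, ha, hU, hUa, hM, rfl⟩
    rw [hμ _ (measurableSet_Ioi.prod (measurableSet_voidEvent hT hU)), Measure.prod_prod,
      lastEpochLaw_Ioi ha]
    have hb : ∀ m, Bornology.IsBounded (U m) := fun m => (Metric.isBounded_Ioc 0 a).subset (hUa m)
    have e : {ω | (t, ω) ∈ hasEpoch T n ∧ (lastEpoch T n (t, ω), ω) ∈ Ioi a ×ˢ voidEvent T U}
        = voidEvent T U \ voidEvent T (addVoid U n (Ioo a t)) := by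
      ext ω
      simp only [mem_ofPred_eq, mem_prod, mem_Ioi, lt_lastEpoch_iff T n ha, hasEpoch, Set.mem_sdiff,
        mem_voidEvent_addVoid, not_and, ← nonempty_iff_ne_empty]
      refine ⟨fun h => ⟨h.2.2, fun _ => h.2.1⟩, fun h => ⟨?_, h.2 h.1, h.1⟩⟩
      exact (h.2 h.1).mono (inter_subset_inter_right _ (Ioo_subset_Ioo_left ha))
    have hUV : ∀ m, MeasurableSet (addVoid U n (Ioo a t) m) := fun m => by
      simp only [addVoid]
      split_ifs
      · exact (hU m).union measurableSet_Ioo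
      · simpa using hU m
    rw [e, measure_sdiff (fun ω h => (mem_voidEvent_addVoid.1 h).1)
      (measurableSet_voidEvent hT hUV).nullMeasurableSet (measure_ne_top _ _),
      prob_voidEvent_addVoid hT hTi hU hb hM n measurableSet_Ioo (Metric.isBounded_Ioo _ _)]
    · rw [ENNReal.ofReal_sub _ (Real.exp_pos _).le, ENNReal.ofReal_one,
        ENNReal.sub_mul (fun _ _ => measure_ne_top _ _), one_mul, mul_comm]
    · exact Set.disjoint_left.2 fun x h1 h2 => absurd (hUa n h1).2 (not_le.2 h2.1)
  have h0 : (Ioi (0 : ℝ) ×ˢ voidEvent T fun _ => ∅) ∈ predictableSets T :=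
    ⟨0, _, 0, le_rfl, fun _ => MeasurableSet.empty, fun _ => empty_subset _, fun _ _ => rfl, rfl⟩
  have hv : voidEvent T (fun _ => ∅) = univ := by ext; simp [voidEvent]
  rw [hv] at h0
  have huniv : μ univ = (lastEpochLaw t).prod P univ := by
    have h1 : μ univ = μ (Ioi (0 : ℝ) ×ˢ univ) := by
      rw [hμ _ MeasurableSet.univ, hμ _ (measurableSet_Ioi.prod MeasurableSet.univ)]
      congr 1
      ext ω
      simp only [mem_ofPred_eq, mem_univ, and_true, mem_prod, mem_Ioi, lt_lastEpoch_iff T n le_rfl,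
        hasEpoch, and_self]
    have h2 : lastEpochLaw t univ = lastEpochLaw t (Ioi 0) := by
      refine (measure_eq_measure_of_null_sdiff (subset_univ _) ?_).symm
      rw [lastEpochLaw, withDensity_apply _ (MeasurableSet.univ.diff measurableSet_Ioi),
        Measure.restrict_restrict (MeasurableSet.univ.diff measurableSet_Ioi)]
      have : (univ \ Ioi (0 : ℝ)) ∩ Ioo 0 t = ∅ := by
        ext r
        simp only [mem_inter_iff, Set.mem_sdiff, mem_univ, true_and, mem_Ioi, mem_Ioo,
          mem_empty_iff_false, iff_false, not_and]
        exact fun h1 h2 => absurd h2 h1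
      rw [this]
      simp
    rw [h1, hC _ h0, Measure.prod_prod, ← univ_prod_univ, Measure.prod_prod, h2]
  have hDm := predictable_le hT _ hD
  have := ext_on_measurableSpace_of_generate_finite _ (predictableSets T) hC (predictable_le hT) rfl
    (isPiSystem_predictableSets T) huniv hD
  rw [hμ D hDm, Measure.prod_apply hDm] at this
  exact this

/-- The walk directed by the clocks makes `k` jumps in time `t` with Poisson probability, along any
sequence of points. -/
theorem prob_pathEvent [IsProbabilityMeasure P] (hT : ∀ n, IsPoissonProcess P (T n))
    (hTi : iIndepFun T P) (l : List ℕ) : ∀ (n : ℕ) {t : ℝ}, 0 ≤ t →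
    P {ω | (t, ω) ∈ pathEvent T n l}
      = ENNReal.ofReal (Real.exp (-t) * t ^ l.length / (l.length).factorial) := by
  induction l with
  | nil =>
    intro n t ht
    have e : {ω | (t, ω) ∈ pathEvent T n []} = {ω | (T n ω).carrier ∩ Ioo 0 t = ∅} := by
      ext ω
      simp [pathEvent, hasEpoch, not_nonempty_iff_eq_empty]
    rw [e, prob_void hT n (Metric.isBounded_Ioo _ _) measurableSet_Ioo]
    simp [ht]
  | cons m l ih =>
    intro n t ht
    have h := prob_lastEpoch_mem hT hTi n t (measurableSet_predictable_pathEvent T l m)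
    have e : {ω | (t, ω) ∈ pathEvent T n (m :: l)}
        = {ω | (t, ω) ∈ hasEpoch T n ∧ (lastEpoch T n (t, ω), ω) ∈ pathEvent T m l} := rfl
    rw [e, h, lastEpochLaw, lintegral_withDensity_eq_lintegral_mul₀ (by fun_prop)]
    · have h1 : ∀ r ∈ Ioo 0 t, ((fun r => ENNReal.ofReal (Real.exp (-(t - r)))) *
          fun r => P {ω | (r, ω) ∈ pathEvent T m l}) r
          = ENNReal.ofReal (Real.exp (-t) * r ^ l.length / (l.length).factorial) := by
        intro r hr
        rw [Pi.mul_apply, ih m hr.1.le, ← ENNReal.ofReal_mul (Real.exp_pos _).le]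
        congr 1
        rw [mul_div_assoc, mul_div_assoc, ← mul_assoc, ← Real.exp_add]
        congr 2
        ring
      rw [setLIntegral_congr_fun measurableSet_Ioo h1, ← ofReal_integral_eq_lintegral_ofReal]
      · congr 1
        rw [← integral_Ioc_eq_integral_Ioo, ← intervalIntegral.integral_of_le ht]
        rw [intervalIntegral.integral_div, intervalIntegral.integral_const_mul, integral_pow]
        rw [List.length_cons, Nat.factorial_succ]
        push_cast
        field_simp
        ring
      · exact (Continuous.integrableOn_Icc (by fun_prop)).mono_set Ioo_subset_Icc_self
      · filter_upwards [ae_restrict_mem measurableSet_Ioo] with r hr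
        have := hr.1
        positivity
    · exact (measurable_measure_prodMk_left (measurableSet_pathEvent hT m l)).aemeasurable

lemma ae_notMem_clock (hT : ∀ n, IsPoissonProcess P (T n)) [IsProbabilityMeasure P] (t : ℝ) :
    ∀ᵐ ω ∂P, ∀ n, t ∉ T n ω := by
  refine ae_all_iff.2 fun n => ?_
  have h := prob_void hT n (B := {t}) Bornology.isBounded_singleton (measurableSet_singleton t)
  simp only [Real.volume_singleton, ENNReal.toReal_zero, neg_zero, Real.exp_zero,
    ENNReal.ofReal_one] at h
  have hm : MeasurableSet {ω | (T n ω).carrier ∩ {t} = ∅} := by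
    have e : {ω | (T n ω).carrier ∩ {t} = ∅}
        = (fun ω => ((T n ω).carrier ∩ {t}).ncard) ⁻¹' {0} := by
      ext ω
      simp only [mem_ofPred_eq, mem_preimage, mem_singleton_iff]
      rw [ncard_eq_zero ((T n ω).locallyFinite _ Bornology.isBounded_singleton)]
    rw [e]
    exact (measurable_ncard Bornology.isBounded_singleton (measurableSet_singleton t)).comp
      (hT n).measurable (measurableSet_singleton 0)
  have h2 := (mem_ae_iff_prob_eq_one hm).2 h
  filter_upwards [h2] with ω hω hmem
  have : t ∈ (T n ω).carrier ∩ {t} := ⟨hmem, rfl⟩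
  rw [hω] at this
  exact this

end Poisson

end

section

/-! ### Covariance and additive functionals of the walk -/

variable {d : ℕ}

lemma vor_translate (x s : Pt d) (S : Config (Pt d)) :
    vor (translate x S) (s - x) = (fun y => y - x) '' vor S s := by
  ext y
  constructor
  · intro h
    refine ⟨y + x, fun s' hs' => ?_, by simp⟩
    have := h (s' - x) (mem_translate.2 (by simpa using hs'))
    have e1 : y - (s - x) = y + x - s := by abel
    have e2 : y - (s' - x) = y + x - s' := by abel
    rw [dist_eq_norm, dist_eq_norm, e1, e2] at this
    rwa [dist_eq_norm, dist_eq_norm]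
  · rintro ⟨z, hz, rfl⟩ s' hs'
    have := hz (s' + x) (mem_translate.1 hs')
    have e1 : z - x - (s - x) = z - s := by abel
    have e2 : z - x - s' = z - (s' + x) := by abel
    rw [dist_eq_norm, dist_eq_norm] at this
    rwa [dist_eq_norm, dist_eq_norm, e1, e2]

lemma side_translate (x s s' : Pt d) (S : Config (Pt d)) :
    side (translate x S) (s - x) (s' - x) = (fun y => y - x) '' side S s s' := by
  rw [side, vor_translate, vor_translate, ← image_inter (sub_left_injective), side]

open scoped Pointwise in
lemma isNeighbour_translate {x s s' : Pt d} {S : Config (Pt d)} :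
    IsNeighbour (translate x S) (s - x) (s' - x) ↔ IsNeighbour S s s' := by
  have h : vectorSpan ℝ ((fun y => y - x) '' side S s s') = vectorSpan ℝ (side S s s') := by
    have e : ((fun y => y - x) '' side S s s') = (-x) +ᵥ side S s s' := by
      rw [← image_vadd]
      congr 1
      ext1 y
      simp only [vadd_eq_add, sub_eq_neg_add]
    rw [e, vectorSpan_vadd]
  unfold IsNeighbour
  rw [side_translate, h, image_nonempty, mem_translate, mem_translate, sub_add_cancel,
    sub_add_cancel, Ne, sub_left_inj]

lemma shadow_translate (u x s s' : Pt d) (S : Config (Pt d)) :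
    shadow u (translate x S) (s - x) (s' - x) = shadow u S s s' := by
  have e : projPerp u '' side (translate x S) (s - x) (s' - x)
      = (fun y => y - projPerp u x) '' (projPerp u '' side S s s') := by
    rw [side_translate, image_image, image_image]
    congr 1
    ext1 y
    simp only [projPerp, inner_sub_left]
    module
  rw [shadow, e, shadow]
  exact (IsometryEquiv.subRight (projPerp u x)).isometry.euclideanHausdorffMeasure_image _

/-- A covariant nonnegative field, in the form required to hold for all points. -/
def Covariant (K : Pt d → Pt d → Config (Pt d) → ℝ≥0∞) : Prop :=
  ∀ x s s' S, K (s - x) (s' - x) (translate x S) = K s s' S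

/-- Joint measurability of a field. -/
abbrev MeasurableField (K : Pt d → Pt d → Config (Pt d) → ℝ≥0∞) : Prop :=
  Measurable fun p : Pt d × Pt d × Config (Pt d) => K p.1 p.2.1 p.2.2

lemma covariant_posShadow (u : Pt d) : Covariant fun s s' S => posShadow u S s s' := by
  intro x s s' S
  simp only [posShadow]
  by_cases h : IsNeighbour S s s' ∧ 0 < (inner ℝ u (s' - s) : ℝ)
  · rw [indicator_of_mem, indicator_of_mem (by exact h), shadow_translate]
    exact ⟨isNeighbour_translate.2 h.1, by simpa using h.2⟩
  · rw [indicator_of_notMem, indicator_of_notMem (by exact h)]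
    exact fun h' => h ⟨isNeighbour_translate.1 h'.1, by simpa using h'.2⟩

/-- The mass transport principle for covariant fields. -/
lemma lintegral_palm_swap {Q : Measure (Config (Pt d))}
    (hQ : ∀ x : Pt d, MeasurePreserving (translate x) Q Q)
    {K : Pt d → Pt d → Config (Pt d) → ℝ≥0∞} (hK : MeasurableField K) (hKc : Covariant K) :
    ∫⁻ S, ∑' s : S.carrier, K 0 s S ∂palm Q = ∫⁻ S, ∑' s : S.carrier, K s 0 S ∂palm Q := by
  have h := lintegral_palm_mass_transport hQ (f := fun s S => K 0 s S)
    (hK.comp (by fun_prop : Measurable fun p : Pt d × Config (Pt d) => ((0 : Pt d), p.1, p.2)))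
  rw [h]
  congr 1
  ext S
  refine tsum_congr fun s => ?_
  have := hKc s s 0 S
  rwa [sub_self, zero_sub] at this

open Classical in
/-- The conductance as an extended nonnegative number. -/
def adj (S : Config (Pt d)) (s s' : Pt d) : ℝ≥0∞ := if IsNeighbour S s s' then 1 else 0

lemma adj_comm (S : Config (Pt d)) (s s' : Pt d) : adj S s s' = adj S s' s := by
  simp only [adj]
  congr 1
  exact propext isNeighbour_comm

lemma covariant_adj : Covariant fun s s' (S : Config (Pt d)) => adj S s s' := by
  intro x s s' S
  simp only [adj]
  congr 1
  exact propext isNeighbour_translate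

lemma measurableField_adj : MeasurableField fun s s' (S : Config (Pt d)) => adj S s s' :=
  Measurable.ite measurableSet_isNeighbour measurable_const measurable_const

/-- The number of neighbours, as a sum over all points. -/
def deg (S : Config (Pt d)) (s : Pt d) : ℝ≥0∞ := ∑' s' : S.carrier, adj S s s'

lemma tsum_adj_mul (S : Config (Pt d)) (s : Pt d) (f : Pt d → ℝ≥0∞) :
    ∑' s' : S.carrier, adj S s s' * f s' = ∑' s' : ↥(neighbours S s), f s' := by
  have h1 : ∑' s' : S.carrier, adj S s s' * f s'
      = ∑' s' : S.carrier, (neighbours S s).indicator f s' := by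
    refine tsum_congr fun s' => ?_
    by_cases h : IsNeighbour S s s'
    · rw [adj, if_pos h, one_mul, indicator_of_mem (by exact h)]
    · rw [adj, if_neg h, zero_mul, indicator_of_notMem (by exact h)]
  have h2 : neighbours S s ⊆ S.carrier := fun s'' h => h.2.1
  rw [h1, tsum_subtype S.carrier, tsum_subtype (neighbours S s) f, indicator_indicator,
    inter_eq_right.2 h2]

lemma deg_eq_degree {S : Config (Pt d)} {s : Pt d} (h : (neighbours S s).Finite) :
    deg S s = (degree S s : ℝ≥0∞) := by
  have h1 := tsum_adj_mul S s 1
  simp only [Pi.one_apply, mul_one] at h1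
  rw [deg, h1, ENNReal.tsum_set_one, ← h.cast_ncard_eq, degree]
  rfl

lemma deg_ne_zero {S : Config (Pt d)} {s s' : Pt d} (h : IsNeighbour S s s') : deg S s ≠ 0 := by
  intro h0
  have := ENNReal.tsum_eq_zero.1 h0 ⟨s', h.2.1⟩
  simp [adj, h] at this

lemma measurable_deg : Measurable fun p : Pt d × Config (Pt d) => deg p.2 p.1 :=
  Measurable.tsum_points (f := fun (p : Pt d × Config (Pt d)) s' => adj p.2 p.1 s') measurable_snd
    (measurableField_adj.comp (by fun_prop :
      Measurable fun q : (Pt d × Config (Pt d)) × Pt d => (q.1.1, q.2, q.1.2)))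

lemma deg_translate (x s : Pt d) (S : Config (Pt d)) : deg (translate x S) (s - x) = deg S s := by
  rw [deg, tsum_translate x S fun s' => adj (translate x S) (s - x) s', deg]
  exact tsum_congr fun s' => covariant_adj x s s' S

/-- The mean of the sum of `F` along the first `k` steps of the simple random walk on the neighbour
graph that starts from `s`. -/
def meanSum (F : Pt d → Pt d → Config (Pt d) → ℝ≥0∞) : ℕ → Pt d → Config (Pt d) → ℝ≥0∞
  | 0, _, _ => 0
  | k + 1, s, S => (deg S s)⁻¹ * ∑' s' : S.carrier, adj S s s' * (F s s' S + meanSum F k s' S)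

variable {F : Pt d → Pt d → Config (Pt d) → ℝ≥0∞}

lemma measurable_meanSum (hF : MeasurableField F) (k : ℕ) :
    Measurable fun p : Pt d × Config (Pt d) => meanSum F k p.1 p.2 := by
  induction k with
  | zero => exact measurable_const
  | succ k ih =>
    refine measurable_deg.inv.mul ?_
    refine Measurable.tsum_points (f := fun (p : Pt d × Config (Pt d)) s' =>
      adj p.2 p.1 s' * (F p.1 s' p.2 + meanSum F k s' p.2)) measurable_snd ?_
    have hm : Measurable fun q : (Pt d × Config (Pt d)) × Pt d => (q.1.1, q.2, q.1.2) := by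
      fun_prop
    have hm' : Measurable fun q : (Pt d × Config (Pt d)) × Pt d => (q.2, q.1.2) := by fun_prop
    exact (measurableField_adj.comp hm).mul ((hF.comp hm).add (ih.comp hm'))

lemma meanSum_translate (hF : Covariant F) (k : ℕ) (x s : Pt d) (S : Config (Pt d)) :
    meanSum F k (s - x) (translate x S) = meanSum F k s S := by
  induction k generalizing s with
  | zero => rfl
  | succ k ih =>
    rw [meanSum, deg_translate, tsum_translate x S fun s' => adj (translate x S) (s - x) s' *
      (F (s - x) s' (translate x S) + meanSum F k s' (translate x S)), meanSum]
    congr 1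
    refine tsum_congr fun s' => ?_
    have h1 := covariant_adj x s s' S
    simp only at h1
    rw [h1, hF x s s' S, ih]

/-- Mass received equals mass sent, for mass `f` sent from every point to each neighbour. -/
lemma lintegral_palm_tsum_adj_mul {Q : Measure (Config (Pt d))}
    (hQ : ∀ x : Pt d, MeasurePreserving (translate x) Q Q) {f : Pt d → Config (Pt d) → ℝ≥0∞}
    (hf : Measurable fun p : Pt d × Config (Pt d) => f p.1 p.2)
    (hfc : ∀ x s S, f (s - x) (translate x S) = f s S) :
    ∫⁻ S, ∑' s : S.carrier, adj S 0 s * f s S ∂palm Q = ∫⁻ S, deg S 0 * f 0 S ∂palm Q := by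
  have h := lintegral_palm_swap hQ (K := fun s s' S => adj S s s' * f s' S)
    (measurableField_adj.mul (hf.comp (by fun_prop :
      Measurable fun p : Pt d × Pt d × Config (Pt d) => (p.2.1, p.2.2)))) (by
        intro x s s' S
        have h1 := covariant_adj x s s' S
        simp only at h1 ⊢
        rw [h1, hfc])
  rw [h]
  congr 1
  ext S
  rw [ENNReal.tsum_mul_right, deg]
  simp_rw [adj_comm S 0]

/-- The degree-biased Palm measure is stationary for the walk, so each step contributes the same to
the mean of an additive functional. -/
lemma lintegral_palm_deg_mul_meanSum_le {Q : Measure (Config (Pt d))}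
    (hQ : ∀ x : Pt d, MeasurePreserving (translate x) Q Q) (hF : MeasurableField F)
    (hFc : Covariant F) (k : ℕ) :
    ∫⁻ S, deg S 0 * meanSum F k 0 S ∂palm Q
      ≤ k * ∫⁻ S, ∑' s : S.carrier, adj S 0 s * F 0 s S ∂palm Q := by
  induction k with
  | zero => simp [meanSum]
  | succ k ih =>
    have hm : Measurable fun q : Config (Pt d) × Pt d => ((0 : Pt d), q.2, q.1) := by fun_prop
    have h1 : Measurable fun S : Config (Pt d) => ∑' s : S.carrier, adj S 0 s * F 0 s S :=
      Measurable.tsum_points (f := fun S s => adj S 0 s * F 0 s S) measurable_id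
        ((measurableField_adj.mul hF).comp hm)
    calc ∫⁻ S, deg S 0 * meanSum F (k + 1) 0 S ∂palm Q
        ≤ ∫⁻ S, ∑' s : S.carrier, adj S 0 s * F 0 s S
            + ∑' s : S.carrier, adj S 0 s * meanSum F k s S ∂palm Q := by
          refine lintegral_mono fun S => ?_
          rw [meanSum, ← mul_assoc, ← ENNReal.tsum_add]
          simp_rw [mul_add]
          exact mul_le_of_le_one_left bot_le (ENNReal.mul_inv_le_one _)
      _ ≤ _ := by
          rw [lintegral_add_left h1, lintegral_palm_tsum_adj_mul hQ (measurable_meanSum hF k)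
            (fun x s S => meanSum_translate hFc k x s S)]
          push_cast
          rw [add_mul, one_mul, add_comm]
          gcongr

lemma meanSum_eq_zero_of_deg_eq_zero {S : Config (Pt d)} {s : Pt d} (h : deg S s = 0) (k : ℕ) :
    meanSum F k s S = 0 := by
  cases k with
  | zero => rfl
  | succ k =>
    have h1 := ENNReal.tsum_eq_zero.1 h
    rw [meanSum]
    simp [h1]

end

section

/-! ### Sums over paths -/

/-- A sum over lists, split according to the first entry. -/
lemma tsum_list (f : List ℕ → ℝ≥0∞) : ∑' l, f l = f [] + ∑' m, ∑' l, f (m :: l) := by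
  let φ : Option (ℕ × List ℕ) ≃ List ℕ :=
    { toFun := fun o => o.elim [] fun p => p.1 :: p.2
      invFun := fun l => match l with
        | [] => none
        | m :: l => some (m, l)
      left_inv := by rintro (_ | ⟨m, l⟩) <;> rfl
      right_inv := by rintro (_ | ⟨m, l⟩) <;> rfl }
  rw [← φ.tsum_eq f, ← (Equiv.optionEquivSumPUnit.{0} (ℕ × List ℕ)).symm.tsum_eq,
    Summable.tsum_sum ENNReal.summable ENNReal.summable, add_comm, ENNReal.tsum_prod']
  simp [φ]

lemma tsum_list_length_zero (f : List ℕ → ℝ≥0∞) :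
    ∑' l, (if l.length = 0 then f l else 0) = f [] := by
  rw [tsum_list]
  simp

lemma tsum_list_length_succ (k : ℕ) (f : List ℕ → ℝ≥0∞) :
    ∑' l, (if l.length = k + 1 then f l else 0)
      = ∑' m, ∑' l, if l.length = k then f (m :: l) else 0 := by
  rw [tsum_list]
  simp

lemma tsum_list_length (f : List ℕ → ℝ≥0∞) :
    ∑' l, f l = ∑' k, ∑' l, if l.length = k then f l else 0 := by
  rw [ENNReal.tsum_comm]
  refine tsum_congr fun l => ?_
  rw [tsum_eq_single l.length fun k hk => if_neg (Ne.symm hk), if_pos rfl]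

/-- A form of Jensen's inequality, with a spare factor `2` that spares a division. -/
lemma tsum_mul_sq_le {ι : Type*} {q : ι → ℝ≥0∞} (hq : ∑' i, q i ≤ 1) (f : ι → ℝ≥0∞) :
    (∑' i, q i * f i) ^ 2 ≤ 2 * ∑' i, q i * f i ^ 2 := by
  have h1 : ∀ a b : ℝ≥0∞, a * b ≤ a ^ 2 + b ^ 2 := by
    intro a b
    rcases le_total a b with h | h
    · calc a * b ≤ b * b := by gcongr
        _ = b ^ 2 := (sq b).symm
        _ ≤ _ := le_add_self
    · calc a * b ≤ a * a := by gcongr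
        _ = a ^ 2 := (sq a).symm
        _ ≤ _ := le_self_add
  calc (∑' i, q i * f i) ^ 2 = ∑' i, ∑' j, q i * f i * (q j * f j) := by
        rw [sq, ← ENNReal.tsum_mul_right]
        exact tsum_congr fun i => ENNReal.tsum_mul_left.symm
    _ ≤ ∑' i, ∑' j, (q j * (q i * f i ^ 2) + q i * (q j * f j ^ 2)) := by
        refine ENNReal.tsum_le_tsum fun i => ENNReal.tsum_le_tsum fun j => ?_
        calc q i * f i * (q j * f j) = q i * q j * (f i * f j) := by ring
          _ ≤ q i * q j * (f i ^ 2 + f j ^ 2) := by gcongr; exact h1 _ _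
          _ = _ := by ring
    _ = (∑' j, q j) * ∑' i, q i * f i ^ 2 + (∑' j, q j) * ∑' i, q i * f i ^ 2 := by
        simp_rw [ENNReal.tsum_add, ENNReal.tsum_mul_right, ENNReal.tsum_mul_left,
          ENNReal.tsum_mul_right]
    _ ≤ _ := by
        rw [two_mul]
        gcongr <;> exact mul_le_of_le_one_left bot_le hq

variable {d : ℕ}

/-- The jump probability of the walk from the `n`-th to the `m`-th point. -/
def stepWeight (S : Config (Pt d)) (x : ℕ → Pt d) (n m : ℕ) : ℝ≥0∞ :=
  (deg S (x n))⁻¹ * adj S (x n) (x m)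

/-- The probability that the walk from the `n`-th point jumps along the path `l`. -/
def pathWeight (S : Config (Pt d)) (x : ℕ → Pt d) : ℕ → List ℕ → ℝ≥0∞
  | _, [] => 1
  | n, m :: l => stepWeight S x n m * pathWeight S x m l

/-- The last point of the path from `n` through the entries of `l`. -/
def pathEnd : ℕ → List ℕ → ℕ
  | n, [] => n
  | _, m :: l => pathEnd m l

/-- The sum of `F` over the steps of a path. -/
def pathSum (F : Pt d → Pt d → Config (Pt d) → ℝ≥0∞) (S : Config (Pt d)) (x : ℕ → Pt d) :
    ℕ → List ℕ → ℝ≥0∞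
  | _, [] => 0
  | n, m :: l => F (x n) (x m) S + pathSum F S x m l

variable {S : Config (Pt d)} {x : ℕ → Pt d} {F : Pt d → Pt d → Config (Pt d) → ℝ≥0∞}

/-- The points of `S` are enumerated by `x`, and their numbers of neighbours are finite. -/
structure IsEnumeration (S : Config (Pt d)) (x : ℕ → Pt d) : Prop where
  injective : Function.Injective x
  range_eq : range x = S.carrier
  finite : ∀ s ∈ S, (neighbours S s).Finite

namespace IsEnumeration

lemma mem (h : IsEnumeration S x) (n : ℕ) : x n ∈ S := by
  change x n ∈ S.carrier
  rw [← h.range_eq]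
  exact mem_range_self n

lemma exists_eq (h : IsEnumeration S x) {s : Pt d} (hs : s ∈ S) : ∃ n, x n = s := by
  have : s ∈ range x := by rw [h.range_eq]; exact hs
  exact this

lemma tsum_eq (h : IsEnumeration S x) (f : Pt d → ℝ≥0∞) :
    ∑' s : S.carrier, f s = ∑' n, f (x n) := by
  rw [← h.range_eq, tsum_range f h.injective]

lemma deg_ne_top (h : IsEnumeration S x) (n : ℕ) : deg S (x n) ≠ ⊤ := by
  rw [deg_eq_degree (h.finite _ (h.mem n))]
  exact ENNReal.natCast_ne_top _

lemma tsum_stepWeight_mul (h : IsEnumeration S x) (n : ℕ) (f : Pt d → ℝ≥0∞) :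
    ∑' m, stepWeight S x n m * f (x m)
      = (deg S (x n))⁻¹ * ∑' s : S.carrier, adj S (x n) s * f s := by
  rw [h.tsum_eq fun s => adj S (x n) s * f s, ← ENNReal.tsum_mul_left]
  exact tsum_congr fun m => mul_assoc _ _ _

lemma tsum_stepWeight (h : IsEnumeration S x) (n : ℕ) :
    ∑' m, stepWeight S x n m = (deg S (x n))⁻¹ * deg S (x n) := by
  have := h.tsum_stepWeight_mul n 1
  simpa [deg] using this

lemma tsum_stepWeight_le_one (h : IsEnumeration S x) (n : ℕ) : ∑' m, stepWeight S x n m ≤ 1 := by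
  rw [h.tsum_stepWeight, mul_comm]
  exact ENNReal.mul_inv_le_one _

end IsEnumeration

lemma isNeighbour_of_stepWeight_ne_zero {n m : ℕ} (h : stepWeight S x n m ≠ 0) :
    IsNeighbour S (x n) (x m) := by
  by_contra hn
  exact h (by simp [stepWeight, adj, hn])

/-- A walk that starts from a point with a neighbour never gets stuck. -/
lemma tsum_pathWeight_length (h : IsEnumeration S x) (k : ℕ) :
    ∀ n, deg S (x n) ≠ 0 → ∑' l, (if l.length = k then pathWeight S x n l else 0) = 1 := by
  induction k with
  | zero =>
    intro n _
    rw [tsum_list_length_zero]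
    rfl
  | succ k ih =>
    intro n hn
    rw [tsum_list_length_succ]
    have h1 : ∀ m, (∑' l : List ℕ, if l.length = k then pathWeight S x n (m :: l) else 0)
        = stepWeight S x n m := by
      intro m
      by_cases hm : stepWeight S x n m = 0
      · simp [pathWeight, hm]
      · have hd := deg_ne_zero (isNeighbour_comm.1 (isNeighbour_of_stepWeight_ne_zero hm))
        calc _ = stepWeight S x n m *
              ∑' l : List ℕ, (if l.length = k then pathWeight S x m l else 0) := by
              rw [← ENNReal.tsum_mul_left]
              exact tsum_congr fun l => by simp [pathWeight]
          _ = _ := by rw [ih m hd, mul_one]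
    simp_rw [h1]
    rw [h.tsum_stepWeight, ENNReal.inv_mul_cancel hn (h.deg_ne_top n)]

/-- Sums of an additive functional over all paths of a given length give its mean along the walk. -/
lemma tsum_pathWeight_mul_pathSum (h : IsEnumeration S x)
    (F : Pt d → Pt d → Config (Pt d) → ℝ≥0∞) (k : ℕ) :
    ∀ n, ∑' l, (if l.length = k then pathWeight S x n l * pathSum F S x n l else 0)
      = meanSum F k (x n) S := by
  induction k with
  | zero =>
    intro n
    rw [tsum_list_length_zero]
    simp [pathSum, meanSum]
  | succ k ih =>
    intro n
    rw [tsum_list_length_succ, meanSum,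
      ← h.tsum_stepWeight_mul n fun s' => F (x n) s' S + meanSum F k s' S]
    refine tsum_congr fun m => ?_
    by_cases hm : stepWeight S x n m = 0
    · simp [pathWeight, hm]
    · have hd := deg_ne_zero (isNeighbour_comm.1 (isNeighbour_of_stepWeight_ne_zero hm))
      calc _ = stepWeight S x n m * (F (x n) (x m) S *
              (∑' l : List ℕ, if l.length = k then pathWeight S x m l else 0) +
              ∑' l : List ℕ,
                if l.length = k then pathWeight S x m l * pathSum F S x m l else 0) := by
            rw [← ENNReal.tsum_mul_left, ← ENNReal.tsum_add, ← ENNReal.tsum_mul_left]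
            refine tsum_congr fun l => ?_
            simp only [pathWeight, pathSum]
            split_ifs
            · ring
            · simp
        _ = _ := by rw [tsum_pathWeight_length h k m hd, ih m, mul_one]

lemma pathSum_sq_le (F : Pt d → Pt d → Config (Pt d) → ℝ≥0∞) (l : List ℕ) :
    ∀ n, pathSum F S x n l ^ 2
      ≤ 2 ^ l.length * pathSum (fun s s' S => F s s' S ^ 2) S x n l := by
  have h1 : ∀ a b : ℝ≥0∞, (a + b) ^ 2 ≤ 2 * a ^ 2 + 2 * b ^ 2 := by
    intro a b
    have := ENNReal.rpow_add_le_mul_rpow_add_rpow a b (p := 2) (by norm_num)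
    norm_num at this
    rwa [mul_add] at this
  induction l with
  | nil => intro n; simp [pathSum]
  | cons m l ih =>
    intro n
    simp only [pathSum, List.length_cons]
    calc _ ≤ 2 * F (x n) (x m) S ^ 2 + 2 * pathSum F S x m l ^ 2 := h1 _ _
      _ ≤ 2 ^ (l.length + 1) * F (x n) (x m) S ^ 2 +
          2 * (2 ^ l.length * pathSum (fun s s' S => F s s' S ^ 2) S x m l) := by
        gcongr
        · exact le_self_pow₀ (by norm_num) (by omega)
        · exact ih m
      _ = _ := by ring

lemma pathSum_ne_top (hF : ∀ s s', F s s' S ≠ ⊤) (l : List ℕ) : ∀ n, pathSum F S x n l ≠ ⊤ := by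
  induction l with
  | nil => intro n; simp [pathSum]
  | cons m l ih => exact fun n => ENNReal.add_ne_top.2 ⟨hF _ _, ih m⟩

/-- Heights change along a path by the sum of the gradient over its steps. -/
lemma height_pathEnd {γ : Pt d → ℝ} {Fp Fm : Pt d → Pt d → Config (Pt d) → ℝ≥0∞}
    (hp : ∀ s s', Fp s s' S ≠ ⊤) (hm : ∀ s s', Fm s s' S ≠ ⊤)
    (hγ : ∀ s s', IsNeighbour S s s' → γ s' - γ s = (Fp s s' S).toReal - (Fm s s' S).toReal)
    (l : List ℕ) : ∀ n, pathWeight S x n l ≠ 0 →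
      γ (x (pathEnd n l))
        = γ (x n) + (pathSum Fp S x n l).toReal - (pathSum Fm S x n l).toReal := by
  induction l with
  | nil => intro n _; simp [pathEnd, pathSum]
  | cons m l ih =>
    intro n hn
    have h1 := hγ _ _ (isNeighbour_of_stepWeight_ne_zero (left_ne_zero_of_mul hn))
    have h2 := ih m (right_ne_zero_of_mul hn)
    simp only [pathEnd, pathSum]
    rw [h2, ENNReal.toReal_add (hp _ _) (pathSum_ne_top hp l m),
      ENNReal.toReal_add (hm _ _) (pathSum_ne_top hm l m)]
    linarith

/-! ### The walk directed by the clocks -/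

variable {Ω : Type*} {T : ℕ → Ω → Config ℝ}

/-- The probability, given the clocks, that the walk that starts from the `n`-th point moves exactly
along the path `l`. -/
def walkWeight (S : Config (Pt d)) (x : ℕ → Pt d) (T : ℕ → Ω → Config ℝ) (p : ℝ × Ω) (n : ℕ)
    (l : List ℕ) : ℝ≥0∞ :=
  pathWeight S x n l * (pathEvent T n l).indicator 1 p

lemma walkWeight_nil (p : ℝ × Ω) (n : ℕ) :
    walkWeight S x T p n [] = (hasEpoch T n)ᶜ.indicator 1 p := by
  simp [walkWeight, pathWeight, pathEvent]

lemma walkWeight_cons (p : ℝ × Ω) (n m : ℕ) (l : List ℕ) :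
    walkWeight S x T p n (m :: l) = (hasEpoch T n).indicator 1 p *
      (stepWeight S x n m * walkWeight S x T (lastEpoch T n p, p.2) m l) := by
  have : (pathEvent T n (m :: l)).indicator (1 : ℝ × Ω → ℝ≥0∞) p = (hasEpoch T n).indicator 1 p *
      (pathEvent T m l).indicator 1 (lastEpoch T n p, p.2) := by
    rw [pathEvent, inter_indicator_one]
    rfl
  rw [walkWeight, walkWeight, this, pathWeight]
  ring

lemma tsum_walkWeight_le_one (h : IsEnumeration S x) (p : ℝ × Ω) (n : ℕ) :
    ∑' l, walkWeight S x T p n l ≤ 1 := by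
  have key : ∀ k, ∀ (p : ℝ × Ω) (n : ℕ),
      ∑' l : List ℕ, (if l.length < k then walkWeight S x T p n l else 0) ≤ 1 := by
    intro k
    induction k with
    | zero => intro p n; simp
    | succ k ih =>
      intro p n
      rw [tsum_list]
      simp only [List.length_nil, Nat.zero_lt_succ, if_true, List.length_cons,
        Nat.succ_lt_succ_iff, walkWeight_nil]
      have h1 : ∀ m, (∑' l : List ℕ, if l.length < k then walkWeight S x T p n (m :: l) else 0)
          ≤ (hasEpoch T n).indicator 1 p * stepWeight S x n m := by
        intro m
        calc _ = (hasEpoch T n).indicator 1 p * stepWeight S x n m * ∑' l : List ℕ,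
              (if l.length < k then walkWeight S x T (lastEpoch T n p, p.2) m l else 0) := by
              rw [← ENNReal.tsum_mul_left]
              refine tsum_congr fun l => ?_
              split_ifs
              · rw [walkWeight_cons, mul_assoc]
              · rw [mul_zero]
          _ ≤ _ := mul_le_of_le_one_right bot_le (ih _ m)
      calc _ ≤ (hasEpoch T n)ᶜ.indicator (1 : ℝ × Ω → ℝ≥0∞) p +
            ∑' m, (hasEpoch T n).indicator 1 p * stepWeight S x n m := by
            gcongr with m
            exact h1 m
        _ ≤ (hasEpoch T n)ᶜ.indicator 1 p + (hasEpoch T n).indicator 1 p := by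
            rw [ENNReal.tsum_mul_left]
            gcongr
            exact mul_le_of_le_one_right bot_le (h.tsum_stepWeight_le_one n)
        _ = 1 := by
            by_cases hp : p ∈ hasEpoch T n <;> simp [hp]
  rw [ENNReal.tsum_eq_iSup_sum]
  refine iSup_le fun s => ?_
  let k := s.sup List.length + 1
  refine le_trans ?_ (key k p n)
  refine le_trans ?_ (ENNReal.sum_le_tsum s)
  refine Finset.sum_le_sum fun l hl => ?_
  rw [if_pos (Nat.lt_succ_of_le (Finset.le_sup (f := List.length) hl))]

variable {clk : Pt d → Set ℝ} {ω : Ω}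

lemma walkProb_nonneg (k : ℕ) : ∀ (s : Pt d) (I : Set ℝ) (s' : Pt d),
    0 ≤ walkProb S clk k s I s' := by
  induction k with
  | zero => intro s I s'; rw [walkProb]; split_ifs <;> norm_num
  | succ k ih =>
    intro s I s'
    rw [walkProb]
    split_ifs
    · exact mul_nonneg (by positivity) (tsum_nonneg fun s'' => ih _ _ _)
    · exact le_rfl

/-- The walk only sees the epochs that lie in the window. -/
lemma walkProb_congr (k : ℕ) : ∀ {s : Pt d} {I J : Set ℝ} (s' : Pt d), s ∈ S →
    (∀ s ∈ S, clk s ∩ I = clk s ∩ J) → walkProb S clk k s I s' = walkProb S clk k s J s' := by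
  induction k with
  | zero => intro s I J s' hs h; rw [walkProb, walkProb, h s hs]
  | succ k ih =>
    intro s I J s' hs h
    rw [walkProb, walkProb, h s hs]
    congr 2
    refine tsum_congr fun s'' => ?_
    have hs'' : IsNeighbour S s s'' := s''.2
    refine ih s' hs''.2.1 fun y hy => ?_
    rw [← inter_assoc, ← inter_assoc, h y hy]

/-- The transition probabilities of the definition, as sums over paths. -/
lemma ofReal_walkProb (h : IsEnumeration S x) (hclk : ∀ n, clk (x n) = (T n ω).carrier)
    (s' : Pt d) (k : ℕ) : ∀ (n : ℕ) (r : ℝ),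
    ENNReal.ofReal (walkProb S clk k (x n) (Ioo 0 r) s')
      = ∑' l : List ℕ, if l.length = k then
          (if x (pathEnd n l) = s' then walkWeight S x T (r, ω) n l else 0) else 0 := by
  classical
  induction k with
  | zero =>
    intro n r
    rw [tsum_list_length_zero, walkProb, hclk, walkWeight_nil, pathEnd]
    by_cases h1 : x n = s' <;> by_cases h2 : (T n ω).carrier ∩ Ioo 0 r = ∅ <;>
      simp [h1, h2, hasEpoch, nonempty_iff_ne_empty]
  | succ k ih =>
    intro n r
    rw [tsum_list_length_succ, walkProb, hclk]
    by_cases hne : ((T n ω).carrier ∩ Ioo 0 r).Nonempty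
    · rw [if_pos hne]
      have hσ : Ioo 0 r ∩ Iio (sSup ((T n ω).carrier ∩ Ioo 0 r))
          = Ioo 0 (lastEpoch T n (r, ω)) := by
        have hmem := hne.csSup_mem ((T n ω).locallyFinite _ (Metric.isBounded_Ioo _ _))
        ext y
        simp only [mem_inter_iff, mem_Ioo, mem_Iio, lastEpoch]
        exact ⟨fun hy => ⟨hy.1.1, hy.2⟩, fun hy => ⟨⟨hy.1, hy.2.trans hmem.2.2⟩, hy.2⟩⟩
      rw [hσ]
      have hfin := h.finite _ (h.mem n)
      have : Finite ↥(neighbours S (x n)) := hfin.to_subtype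
      have hR : ∀ m, (∑' l : List ℕ, if l.length = k then
            (if x (pathEnd n (m :: l)) = s' then walkWeight S x T (r, ω) n (m :: l) else 0) else 0)
          = stepWeight S x n m * ENNReal.ofReal
            (walkProb S clk k (x m) (Ioo 0 (lastEpoch T n (r, ω))) s') := by
        intro m
        rw [ih m, ← ENNReal.tsum_mul_left]
        refine tsum_congr fun l => ?_
        rw [walkWeight_cons, indicator_of_mem (by exact hne), pathEnd]
        split_ifs <;> simp
      simp_rw [hR]
      rw [h.tsum_stepWeight_mul n fun s => ENNReal.ofReal
          (walkProb S clk k s (Ioo 0 (lastEpoch T n (r, ω))) s'),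
        tsum_adj_mul S (x n) fun s => ENNReal.ofReal
          (walkProb S clk k s (Ioo 0 (lastEpoch T n (r, ω))) s'),
        ENNReal.ofReal_mul (by positivity),
        ENNReal.ofReal_tsum_of_nonneg (fun _ => walkProb_nonneg _ _ _ _) (Summable.of_finite),
        deg_eq_degree hfin]
      rcases Nat.eq_zero_or_pos (degree S (x n)) with h0 | hpos
      · have : IsEmpty ↥(neighbours S (x n)) := by
          rw [isEmpty_coe_sort]
          exact (ncard_eq_zero hfin).1 h0
        simp
      · rw [ENNReal.ofReal_inv_of_pos (by exact_mod_cast hpos), ENNReal.ofReal_natCast]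
    · rw [if_neg hne]
      have : ∀ m l, walkWeight S x T (r, ω) n (m :: l) = 0 := fun m l => by
        rw [walkWeight_cons, indicator_of_notMem (by exact hne), zero_mul]
      simp [this]

/-- The window `(0, t]` of the definition may be replaced by the open one, since no clock has an
epoch at time `t`. -/
lemma ofReal_transProb (h : IsEnumeration S x) (hclk : ∀ n, clk (x n) = (T n ω).carrier) {t : ℝ}
    (ht : ∀ n, t ∉ T n ω) (n : ℕ) (s' : Pt d) :
    ENNReal.ofReal (transProb S clk t (x n) s')
      = ∑' l : List ℕ, if x (pathEnd n l) = s' then walkWeight S x T (t, ω) n l else 0 := by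
  classical
  have hw : ∀ k, walkProb S clk k (x n) (Ioc 0 t) s' = walkProb S clk k (x n) (Ioo 0 t) s' := by
    refine fun k => walkProb_congr k s' (h.mem n) fun s hs => ?_
    obtain ⟨m, rfl⟩ := h.exists_eq hs
    ext τ
    simp only [hclk, mem_inter_iff, mem_Ioc, mem_Ioo]
    refine and_congr_right fun hτ => and_congr_right fun _ => ⟨fun hle => ?_, le_of_lt⟩
    exact lt_of_le_of_ne hle fun he => ht m (he ▸ hτ)
  have hsum : ∑' k, ENNReal.ofReal (walkProb S clk k (x n) (Ioc 0 t) s')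
      = ∑' l : List ℕ, if x (pathEnd n l) = s' then walkWeight S x T (t, ω) n l else 0 := by
    rw [tsum_list_length]
    exact tsum_congr fun k => by rw [hw, ofReal_walkProb h hclk]
  have hle : ∑' l : List ℕ, (if x (pathEnd n l) = s' then walkWeight S x T (t, ω) n l else 0) ≤ 1 :=
    (ENNReal.tsum_le_tsum fun l => by split_ifs; exacts [le_rfl, bot_le]).trans
      (tsum_walkWeight_le_one h (t, ω) n)
  have hsummable : Summable fun k => walkProb S clk k (x n) (Ioc 0 t) s' := by
    have := ENNReal.summable_toReal (hsum.trans_le hle |>.trans_lt ENNReal.one_lt_top).ne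
    exact this.congr fun k => ENNReal.toReal_ofReal (walkProb_nonneg _ _ _ _)
  rw [transProb, ENNReal.ofReal_tsum_of_nonneg (fun k => walkProb_nonneg _ _ _ _) hsummable, hsum]

/-- The mean, given the clocks, of the sum of `F` along the walk from the `n`-th point. -/
def walkMean (F : Pt d → Pt d → Config (Pt d) → ℝ≥0∞) (S : Config (Pt d)) (x : ℕ → Pt d)
    (T : ℕ → Ω → Config ℝ) (p : ℝ × Ω) (n : ℕ) : ℝ≥0∞ :=
  ∑' l, walkWeight S x T p n l * pathSum F S x n l

/-- The series that defines the harness process converges, and the new height differs from the old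
one by the mean of the gradient along the walk. -/
lemma hasSum_harness (h : IsEnumeration S x) (hclk : ∀ n, clk (x n) = (T n ω).carrier) {t : ℝ}
    (ht : ∀ n, t ∉ T n ω)
    {γ : Pt d → ℝ} {Fp Fm : Pt d → Pt d → Config (Pt d) → ℝ≥0∞}
    (hp : ∀ s s', Fp s s' S ≠ ⊤) (hm : ∀ s s', Fm s s' S ≠ ⊤)
    (hγ : ∀ s s', IsNeighbour S s s' → γ s' - γ s = (Fp s s' S).toReal - (Fm s s' S).toReal)
    (n : ℕ) (hwp : walkMean Fp S x T (t, ω) n ≠ ⊤) (hwm : walkMean Fm S x T (t, ω) n ≠ ⊤) :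
    HasSum (fun s' : S.carrier => transProb S clk t (x n) s' * γ s')
      (γ (x n) * (∑' l, walkWeight S x T (t, ω) n l).toReal
        + (walkMean Fp S x T (t, ω) n).toReal - (walkMean Fm S x T (t, ω) n).toReal) := by
  classical
  set q : List ℕ → ℝ≥0∞ := walkWeight S x T (t, ω) n with hq
  have hq1 : ∑' l, q l ≠ ⊤ :=
    ((tsum_walkWeight_le_one h (t, ω) n).trans_lt ENNReal.one_lt_top).ne
  have hqt : ∀ l, q l ≠ ⊤ := ENNReal.ne_top_of_tsum_ne_top hq1
  have hsum : ∀ {f : List ℕ → ℝ≥0∞}, ∑' l, f l ≠ ⊤ →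
      HasSum (fun l => (f l).toReal) (∑' l, f l).toReal := fun {f} hf => by
    rw [ENNReal.tsum_toReal_eq (ENNReal.ne_top_of_tsum_ne_top hf)]
    exact ENNReal.hasSum_toReal hf
  have h1 : HasSum (fun l => (q l).toReal * γ (x (pathEnd n l)))
      (γ (x n) * (∑' l, q l).toReal + (walkMean Fp S x T (t, ω) n).toReal
        - (walkMean Fm S x T (t, ω) n).toReal) := by
    have h0 := (((hsum hq1).mul_left (γ (x n))).add (hsum hwp)).sub (hsum hwm)
    refine Eq.subst (motive := fun f => HasSum f _) (funext fun l => Eq.symm ?_) h0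
    by_cases hl : q l = 0
    · rw [← hq]
      simp [hl]
    · have hl' : pathWeight S x n l ≠ 0 := fun h0 => hl (by simp [hq, walkWeight, h0])
      rw [height_pathEnd hp hm hγ l n hl', ENNReal.toReal_mul, ENNReal.toReal_mul]
      ring
  let g : List ℕ → S.carrier := fun l => ⟨x (pathEnd n l), h.mem _⟩
  have h2 := h1.tsum_fiberwise g
  refine Eq.subst (motive := fun f => HasSum f _) (funext fun s' => Eq.symm ?_) h2
  have h3 : transProb S clk t (x n) s' = ∑' l : g ⁻¹' {s'}, (q l).toReal := by
    have hnonneg : 0 ≤ transProb S clk t (x n) s' := tsum_nonneg fun k => walkProb_nonneg _ _ _ _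
    rw [← ENNReal.toReal_ofReal hnonneg, ofReal_transProb h hclk ht,
      ← ENNReal.tsum_toReal_eq (f := fun l : g ⁻¹' {s'} => q l) fun l => hqt l,
      tsum_subtype (g ⁻¹' {s'}) q]
    congr 1
    refine tsum_congr fun l => ?_
    simp only [indicator_apply, mem_preimage, mem_singleton_iff, g, Subtype.ext_iff]
    rfl
  rw [h3, ← tsum_mul_right]
  refine tsum_congr fun l => ?_
  have hl : x (pathEnd n l) = s' := congrArg Subtype.val (show g l = s' from l.2)
  rw [hl]

/-! ### Averaging over the clocks -/

variable [MeasurableSpace Ω] {P : Measure Ω}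

/-- The Poisson probability of `k` jumps in time `t`. -/
def jumpProb (t : ℝ) (k : ℕ) : ℝ≥0∞ := ENNReal.ofReal (Real.exp (-t) * t ^ k / k.factorial)

lemma tsum_jumpProb_mul_pow {t : ℝ} (ht : 0 ≤ t) {c : ℝ} (hc : 0 ≤ c) :
    ∑' k, jumpProb t k * ENNReal.ofReal c ^ k = ENNReal.ofReal (Real.exp (c * t - t)) := by
  have h := (NormedSpace.expSeries_div_hasSum_exp (c * t)).mul_left (Real.exp (-t))
  rw [← Real.exp_eq_exp_ℝ, ← Real.exp_add, neg_add_eq_sub] at h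
  rw [← h.tsum_eq, ENNReal.ofReal_tsum_of_nonneg (fun k => by positivity) h.summable]
  refine tsum_congr fun k => ?_
  rw [jumpProb, ← ENNReal.ofReal_pow hc, ← ENNReal.ofReal_mul (by positivity)]
  congr 1
  ring

lemma tsum_jumpProb {t : ℝ} (ht : 0 ≤ t) : ∑' k, jumpProb t k = 1 := by
  have h := tsum_jumpProb_mul_pow ht (c := 1) zero_le_one
  simpa using h

lemma measurable_walkWeight_right (hT : ∀ n, IsPoissonProcess P (T n)) (t : ℝ) (n : ℕ)
    (l : List ℕ) : Measurable fun ω => walkWeight S x T (t, ω) n l :=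
  ((measurable_one.indicator (measurableSet_pathEvent hT n l)).comp
    measurable_prodMk_left).const_mul _

/-- Averaged over the clocks, the walk is a simple random walk that jumps at rate one. -/
lemma lintegral_tsum_walkWeight_mul [IsProbabilityMeasure P]
    (hT : ∀ n, IsPoissonProcess P (T n)) (hTi : iIndepFun T P) {t : ℝ} (ht : 0 ≤ t) (n : ℕ)
    (f : List ℕ → ℝ≥0∞) :
    ∫⁻ ω, ∑' l, walkWeight S x T (t, ω) n l * f l ∂P
      = ∑' k, jumpProb t k * ∑' l, if l.length = k then pathWeight S x n l * f l else 0 := by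
  rw [lintegral_tsum fun l => ((measurable_walkWeight_right hT t n l).mul_const _).aemeasurable,
    tsum_list_length]
  refine tsum_congr fun k => ?_
  rw [← ENNReal.tsum_mul_left]
  refine tsum_congr fun l => ?_
  split_ifs with hl
  · have hm : MeasurableSet {ω | (t, ω) ∈ pathEvent T n l} :=
      measurable_prodMk_left (measurableSet_pathEvent hT n l)
    have e : ∀ ω, walkWeight S x T (t, ω) n l * f l
        = pathWeight S x n l * f l * {ω | (t, ω) ∈ pathEvent T n l}.indicator 1 ω := by
      intro ω
      rw [walkWeight, mul_right_comm]
      rfl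
    simp_rw [e]
    rw [lintegral_const_mul _ (measurable_one.indicator hm), lintegral_indicator_one hm,
      prob_pathEvent hT hTi l n ht, hl, mul_comm]
    rfl
  · simp

lemma lintegral_walkMean [IsProbabilityMeasure P] (h : IsEnumeration S x)
    (hT : ∀ n, IsPoissonProcess P (T n)) (hTi : iIndepFun T P) {t : ℝ} (ht : 0 ≤ t) (n : ℕ)
    (F : Pt d → Pt d → Config (Pt d) → ℝ≥0∞) :
    ∫⁻ ω, walkMean F S x T (t, ω) n ∂P = ∑' k, jumpProb t k * meanSum F k (x n) S := by
  simp_rw [walkMean]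
  rw [lintegral_tsum_walkWeight_mul hT hTi ht]
  simp_rw [tsum_pathWeight_mul_pathSum h]

lemma lintegral_walkMean_sq_le [IsProbabilityMeasure P] (h : IsEnumeration S x)
    (hT : ∀ n, IsPoissonProcess P (T n)) (hTi : iIndepFun T P) {t : ℝ} (ht : 0 ≤ t) (n : ℕ)
    (F : Pt d → Pt d → Config (Pt d) → ℝ≥0∞) :
    ∫⁻ ω, walkMean F S x T (t, ω) n ^ 2 ∂P
      ≤ 2 * ∑' k, jumpProb t k * (2 ^ k * meanSum (fun s s' S => F s s' S ^ 2) k (x n) S) := by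
  have h1 : ∀ ω, walkMean F S x T (t, ω) n ^ 2 ≤ 2 * ∑' l, walkWeight S x T (t, ω) n l *
      (2 ^ l.length * pathSum (fun s s' S => F s s' S ^ 2) S x n l) := fun ω => by
    refine (tsum_mul_sq_le (tsum_walkWeight_le_one h (t, ω) n) _).trans ?_
    gcongr with l
    exact pathSum_sq_le F l n
  refine (lintegral_mono h1).trans (le_of_eq ?_)
  rw [lintegral_const_mul _ (Measurable.tsum fun l =>
    (measurable_walkWeight_right hT t n l).mul_const _), lintegral_tsum_walkWeight_mul hT hTi ht]
  refine congrArg (2 * ·) (tsum_congr fun k => congrArg (jumpProb t k * ·) ?_)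
  rw [← tsum_pathWeight_mul_pathSum h, ← ENNReal.tsum_mul_left]
  refine tsum_congr fun l => ?_
  split_ifs with hl
  · rw [hl]; ring
  · simp

/-- The walk does not explode: almost surely it makes finitely many jumps. -/
lemma ae_tsum_walkWeight_eq_one [IsProbabilityMeasure P] (h : IsEnumeration S x)
    (hT : ∀ n, IsPoissonProcess P (T n)) (hTi : iIndepFun T P) {t : ℝ} (ht : 0 ≤ t) :
    ∀ᵐ ω ∂P, ∀ n, deg S (x n) ≠ 0 → ∑' l, walkWeight S x T (t, ω) n l = 1 := by
  refine ae_all_iff.2 fun n => ?_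
  by_cases hn : deg S (x n) = 0
  · exact Eventually.of_forall fun ω h => absurd hn h
  have hI := lintegral_tsum_walkWeight_mul (S := S) (x := x) hT hTi ht n fun _ => 1
  simp only [mul_one, tsum_pathWeight_length h _ n hn, tsum_jumpProb ht] at hI
  have := ae_eq_of_ae_le_of_lintegral_le (μ := P)
    (f := fun ω => ∑' l, walkWeight S x T (t, ω) n l) (g := fun _ => 1)
    (Eventually.of_forall fun ω => tsum_walkWeight_le_one h (t, ω) n) (by rw [hI]; simp)
    aemeasurable_const (by rw [hI]; simp)
  filter_upwards [this] with ω hω _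
  exact hω

end

section

/-! ### Integrals with respect to the measure `𝒞` -/

variable {d : ℕ}

section Campbell

variable {α : Type*} [MeasurableSpace α] {μ : Measure α} {conf : α → Config (Pt d)}

lemma measurable_campbellKernel (hc : Measurable conf) :
    Measurable fun z => Measure.sum fun s : ↥(neighbours (conf z) 0) =>
      Measure.dirac ((0 : Pt d), (s : Pt d), z) := by
  refine Measure.measurable_of_measurable_coe _ fun A hA => ?_
  have : (fun z => (Measure.sum fun s : ↥(neighbours (conf z) 0) =>
      Measure.dirac ((0 : Pt d), (s : Pt d), z)) A)
      = fun z => ∑' s : (conf z).carrier, adj (conf z) 0 s *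
        A.indicator (1 : Pt d × Pt d × α → ℝ≥0∞) (0, (s : Pt d), z) := by
    ext z
    rw [Measure.sum_apply _ hA, tsum_adj_mul (conf z) 0 fun s =>
      A.indicator (1 : Pt d × Pt d × α → ℝ≥0∞) (0, s, z)]
    simp [Measure.dirac_apply' _ hA]
  rw [this]
  refine Measurable.tsum_points (f := fun z s => adj (conf z) 0 s *
    A.indicator (1 : Pt d × Pt d × α → ℝ≥0∞) (0, s, z)) hc ?_
  exact (measurableField_adj.comp (by fun_prop :
    Measurable fun p : α × Pt d => ((0 : Pt d), p.2, conf p.1))).mul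
    ((measurable_one.indicator hA).comp (by fun_prop))

lemma lintegral_campbell (hc : Measurable conf) {f : Pt d × Pt d × α → ℝ≥0∞}
    (hf : Measurable f) :
    ∫⁻ p, f p ∂campbell μ conf
      = 2⁻¹ * ∫⁻ z, ∑' s : (conf z).carrier, adj (conf z) 0 s * f (0, (s : Pt d), z) ∂μ := by
  rw [campbell, lintegral_smul_measure, smul_eq_mul,
    Measure.lintegral_bind (measurable_campbellKernel hc).aemeasurable hf.aemeasurable]
  congr 2
  ext z
  rw [lintegral_sum_measure, tsum_adj_mul (conf z) 0 fun s => f (0, s, z)]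
  exact tsum_congr fun s => lintegral_dirac' _ hf

lemma measurable_tsum_adj_mul (hc : Measurable conf) {f : Pt d × Pt d × α → ℝ≥0∞}
    (hf : Measurable f) : Measurable fun z =>
      ∑' s : (conf z).carrier, adj (conf z) 0 s * f (0, (s : Pt d), z) :=
  Measurable.tsum_points (f := fun z s => adj (conf z) 0 s * f (0, s, z)) hc
    ((measurableField_adj.comp (by fun_prop :
      Measurable fun p : α × Pt d => ((0 : Pt d), p.2, conf p.1))).mul (hf.comp (by fun_prop)))

lemma ae_campbell (hc : Measurable conf) {p : Pt d × Pt d × α → Prop}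
    (h : ∀ᵐ z ∂μ, ∀ s, IsNeighbour (conf z) 0 s → p (0, s, z)) :
    ∀ᵐ q ∂campbell μ conf, p q := by
  set Z := toMeasurable μ {z | ¬ ∀ s, IsNeighbour (conf z) 0 s → p (0, s, z)}
  have hZ : MeasurableSet Z := measurableSet_toMeasurable _ _
  have hZ0 : μ Z = 0 := by rw [measure_toMeasurable]; exact h
  let A : Set (Pt d × Pt d × α) := {q | q.2.2 ∈ Z ∨ q.1 ≠ 0 ∨ ¬ IsNeighbour (conf q.2.2) q.1 q.2.1}
  have hA : MeasurableSet A := by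
    refine (hZ.preimage (by fun_prop)).union (MeasurableSet.union ?_ ?_)
    · exact (measurable_fst (measurableSet_singleton (0 : Pt d))).compl
    · exact (measurableSet_isNeighbour.preimage (by fun_prop : Measurable
        fun q : Pt d × Pt d × α => (q.1, q.2.1, conf q.2.2))).compl
  have hA0 : campbell μ conf A = 0 := by
    rw [← lintegral_indicator_one hA, lintegral_campbell hc (measurable_one.indicator hA)]
    have : ∫⁻ z, ∑' s : (conf z).carrier, adj (conf z) 0 s *
        A.indicator (1 : Pt d × Pt d × α → ℝ≥0∞) (0, (s : Pt d), z) ∂μ = 0 := by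
      refine lintegral_eq_zero_of_ae_eq_zero ?_
      filter_upwards [measure_eq_zero_iff_ae_notMem.1 hZ0] with z hz
      refine ENNReal.tsum_eq_zero.2 fun s => ?_
      by_cases hs : IsNeighbour (conf z) 0 s
      · rw [indicator_of_notMem, mul_zero]
        rintro (h | h | h)
        · exact hz h
        · exact h rfl
        · exact h hs
      · simp [adj, hs]
    rw [this, mul_zero]
  filter_upwards [measure_eq_zero_iff_ae_notMem.1 hA0] with q hq
  obtain ⟨a, s, z⟩ := q
  simp only [A, mem_ofPred_eq, not_or, not_not] at hq
  obtain ⟨h1, rfl, h3⟩ := hq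
  by_contra hp
  exact h1 (subset_toMeasurable _ _ fun h => hp (h s h3))

lemma ae_of_ae_campbell (hc : Measurable conf) {p : Pt d × Pt d × α → Prop}
    (h : ∀ᵐ q ∂campbell μ conf, p q) :
    ∀ᵐ z ∂μ, ∀ s, IsNeighbour (conf z) 0 s → p (0, s, z) := by
  set A := toMeasurable (campbell μ conf) {q | ¬ p q}
  have hA : MeasurableSet A := measurableSet_toMeasurable _ _
  have hA0 : campbell μ conf A = 0 := by rw [measure_toMeasurable]; exact h
  rw [← lintegral_indicator_one hA, lintegral_campbell hc (measurable_one.indicator hA)] at hA0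
  have h1 := (lintegral_eq_zero_iff (measurable_tsum_adj_mul hc (measurable_one.indicator hA))).1
    ((mul_eq_zero.1 hA0).resolve_left (by simp))
  filter_upwards [h1] with z hz s hs
  by_contra hp
  have h2 := ENNReal.tsum_eq_zero.1 hz ⟨s, hs.2.1⟩
  have h3 : ((0 : Pt d), s, z) ∈ A := subset_toMeasurable _ _ hp
  simp [adj, hs, h3] at h2

end Campbell

lemma conductance_of_isNeighbour {S : Config (Pt d)} {s s' : Pt d} (h : IsNeighbour S s s') :
    conductance S s s' = 1 := by simp [conductance, h]

lemma posShadow_neg_swap (u : Pt d) (S : Config (Pt d)) (s s' : Pt d) :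
    posShadow (-u) S s s' = posShadow u S s' s := by
  have h : (IsNeighbour S s s' ∧ 0 < (inner ℝ (-u) (s' - s) : ℝ)) ↔
      (IsNeighbour S s' s ∧ 0 < (inner ℝ u (s - s') : ℝ)) := by
    rw [isNeighbour_comm, ← neg_sub s s', inner_neg_neg]
  rw [posShadow, posShadow]
  by_cases h1 : IsNeighbour S s' s ∧ 0 < (inner ℝ u (s - s') : ℝ)
  · rw [indicator_of_mem (by exact h.2 h1), indicator_of_mem (by exact h1), shadow_neg,
      shadow_comm]
  · rw [indicator_of_notMem (by exact fun h2 => h1 (h.1 h2)), indicator_of_notMem (by exact h1)]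

lemma adj_mul_posShadow (u : Pt d) (S : Config (Pt d)) (s s' : Pt d) :
    adj S s s' * posShadow u S s s' = posShadow u S s s' := by
  by_cases h : IsNeighbour S s s'
  · simp [adj, h]
  · rw [posShadow, indicator_of_notMem (by exact fun h' => h h'.1), mul_zero]

/-- The positive and negative parts of the field `ω_u`. -/
lemma omega_eq {α : Type*} (conf : α → Config (Pt d)) (u s s' : Pt d) (z : α) :
    omega conf u s s' z
      = (posShadow u (conf z) s s').toReal - (posShadow (-u) (conf z) s s').toReal := by
  rw [omega]
  by_cases hn : IsNeighbour (conf z) s s'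
  · rw [conductance_of_isNeighbour hn, mul_one, real_inner_comm]
    change _ * (shadow u (conf z) s s').toReal = _
    rcases lt_trichotomy (inner ℝ u (s' - s) : ℝ) 0 with h | h | h
    · rw [Real.sign_of_neg h, posShadow, posShadow,
        indicator_of_notMem (by exact fun h' => h'.2.not_gt h),
        indicator_of_mem (by exact ⟨hn, by rw [inner_neg_left]; linarith⟩), shadow_neg]
      simp
    · rw [h, Real.sign_zero, posShadow, posShadow,
        indicator_of_notMem (by exact fun h' => h'.2.ne' h),
        indicator_of_notMem (by exact fun h' => h'.2.ne' (by rw [inner_neg_left, h, neg_zero]))]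
      simp
    · have hneg : ¬ 0 < (inner ℝ (-u) (s' - s) : ℝ) := by rw [inner_neg_left]; linarith
      rw [Real.sign_of_pos h, posShadow, posShadow, indicator_of_mem (by exact ⟨hn, h⟩),
        indicator_of_notMem (by exact fun h' => hneg h'.2)]
      simp
  · rw [posShadow, posShadow, indicator_of_notMem (by exact fun h' => hn h'.1),
      indicator_of_notMem (by exact fun h' => hn h'.1)]
    simp [conductance, hn]

section L2

variable {β : Type*} [MeasurableSpace β] {ν : Measure β}

lemma memLp_two_toReal {K : β → ℝ≥0∞} (hK : Measurable K) (h : ∫⁻ p, K p ^ 2 ∂ν < ⊤) :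
    MemLp (fun p => (K p).toReal) 2 ν := by
  refine ⟨hK.ennreal_toReal.aestronglyMeasurable, ?_⟩
  rw [eLpNorm_lt_top_iff_lintegral_rpow_enorm_lt_top (by norm_num) (by norm_num)]
  refine lt_of_le_of_lt (lintegral_mono fun p => ?_) h
  have h1 : ‖(K p).toReal‖ₑ ≤ K p := by
    rw [Real.enorm_of_nonneg ENNReal.toReal_nonneg]
    exact ENNReal.ofReal_toReal_le
  calc ‖(K p).toReal‖ₑ ^ (2 : ℝ≥0∞).toReal ≤ K p ^ (2 : ℝ≥0∞).toReal := by gcongr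
    _ = K p ^ 2 := by norm_num

/-- Integrals of products of square integrable nonnegative functions. -/
lemma integral_toReal_mul_toReal {K W : β → ℝ≥0∞} (hK : Measurable K) (hW : Measurable W)
    (hK2 : ∫⁻ p, K p ^ 2 ∂ν < ⊤) (hW2 : ∫⁻ p, W p ^ 2 ∂ν < ⊤) :
    Integrable (fun p => (K p).toReal * (W p).toReal) ν ∧
      ∫ p, (K p).toReal * (W p).toReal ∂ν = (∫⁻ p, K p * W p ∂ν).toReal := by
  refine ⟨(memLp_two_toReal hK hK2).integrable_mul (memLp_two_toReal hW hW2), ?_⟩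
  simp_rw [← ENNReal.toReal_mul]
  have hfin : ∀ {K : β → ℝ≥0∞}, Measurable K → ∫⁻ p, K p ^ 2 ∂ν < ⊤ → ∀ᵐ p ∂ν, K p < ⊤ := by
    intro K hK h
    filter_upwards [ae_lt_top (hK.pow_const 2) h.ne] with p hp
    exact lt_top_iff_ne_top.2 fun h0 => by simp [h0] at hp
  refine integral_toReal (hK.mul hW).aemeasurable ?_
  filter_upwards [hfin hK hK2, hfin hW hW2] with p h1 h2
  exact ENNReal.mul_lt_top h1 h2

lemma integral_toReal_mul_sub {K W W' : β → ℝ≥0∞} (hK : Measurable K) (hW : Measurable W)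
    (hW' : Measurable W') (hK2 : ∫⁻ p, K p ^ 2 ∂ν < ⊤) (hW2 : ∫⁻ p, W p ^ 2 ∂ν < ⊤)
    (hW2' : ∫⁻ p, W' p ^ 2 ∂ν < ⊤) :
    Integrable (fun p => (K p).toReal * ((W p).toReal - (W' p).toReal)) ν ∧
      ∫ p, (K p).toReal * ((W p).toReal - (W' p).toReal) ∂ν
        = (∫⁻ p, K p * W p ∂ν).toReal - (∫⁻ p, K p * W' p ∂ν).toReal := by
  obtain ⟨h1, h2⟩ := integral_toReal_mul_toReal hK hW hK2 hW2
  obtain ⟨h3, h4⟩ := integral_toReal_mul_toReal hK hW' hK2 hW2'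
  simp_rw [mul_sub]
  exact ⟨h1.sub h3, by rw [integral_sub h1 h3, h2, h4]⟩

end L2

/-! ### Almost sure properties of the Palm version -/

/-- The field `ω_u` is square integrable because the area of the boundary of the cell is. -/
lemma lintegral_campbell_posShadow_sq_lt_top {Q : Measure (Config (Pt d))} [IsProbabilityMeasure Q]
    (hQ : StandingAssumptions Q) {u : Pt d} (hu : ‖u‖ = 1) {α : Type*} [MeasurableSpace α]
    {μ : Measure α} {conf : α → Config (Pt d)} (hc : MeasurePreserving conf μ (palm Q)) :
    ∫⁻ p, posShadow u (conf p.2.2) p.1 p.2.1 ^ 2 ∂campbell μ conf < ⊤ := by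
  have hm : Measurable fun p : Pt d × Pt d × α => posShadow u (conf p.2.2) p.1 p.2.1 :=
    (measurable_posShadow hu).comp (by have := hc.measurable; fun_prop :
      Measurable fun p : Pt d × Pt d × α => (p.1, p.2.1, conf p.2.2))
  rw [lintegral_campbell hc.measurable (hm.pow_const 2)]
  refine ENNReal.mul_lt_top (by simp) ?_
  have hm2 : Measurable fun S : Config (Pt d) =>
      ∑' s : S.carrier, adj S 0 s * posShadow u S 0 s ^ 2 :=
    measurable_tsum_adj_mul (conf := fun S : Config (Pt d) => S) measurable_id
      (f := fun p => posShadow u p.2.2 p.1 p.2.1 ^ 2) ((measurable_posShadow hu).pow_const 2)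
  have h1 : ∫⁻ z, ∑' s : (conf z).carrier, adj (conf z) 0 s * posShadow u (conf z) 0 s ^ 2 ∂μ
      = ∫⁻ S, ∑' s : S.carrier, adj S 0 s * posShadow u S 0 s ^ 2 ∂palm Q :=
    hc.lintegral_comp hm2
  change ∫⁻ z, ∑' s : (conf z).carrier, adj (conf z) 0 s * posShadow u (conf z) 0 s ^ 2 ∂μ < ⊤
  rw [h1]
  refine lt_of_le_of_lt (lintegral_mono_ae ?_) hQ.surface_sq
  filter_upwards [ae_palm_zero_mem Q] with S hS
  calc ∑' s : S.carrier, adj S 0 s * posShadow u S 0 s ^ 2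
      ≤ ∑' s : S.carrier, posShadow u S 0 s * ∑' s' : S.carrier, posShadow u S 0 s' := by
        refine ENNReal.tsum_le_tsum fun s => ?_
        rw [sq, ← mul_assoc, adj_mul_posShadow]
        gcongr
        exact ENNReal.le_tsum s
    _ = (∑' s : S.carrier, posShadow u S 0 s) ^ 2 := by rw [ENNReal.tsum_mul_right, sq]
    _ ≤ _ := by
        gcongr
        exact tsum_posShadow_le_frontier hu hS

/-- The divergence of `ω_u` vanishes at the origin. -/
lemma ae_palm_tsum_posShadow_eq {Q : Measure (Config (Pt d))} [IsProbabilityMeasure Q]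
    (hQ : StandingAssumptions Q) {u : Pt d} (hu : ‖u‖ = 1) :
    ∀ᵐ S ∂palm Q,
      ∑' s : S.carrier, posShadow u S 0 s = ∑' s : S.carrier, posShadow (-u) S 0 s := by
  filter_upwards [ae_palm_zero_mem Q, ae_palm_exists_inner_pos hQ.stationary hu,
    ae_palm_exists_inner_pos hQ.stationary (u := -u) (by rwa [norm_neg])] with S h0 h1 h2
  refine tsum_posShadow_eq_tsum_posShadow_neg hu h0 ?_ ?_
  · obtain ⟨s, hs, h⟩ := h1
    exact ⟨s, hs, by rwa [sub_zero, real_inner_comm]⟩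
  · obtain ⟨s, hs, h⟩ := h2
    exact ⟨s, hs, by rwa [sub_zero, real_inner_comm]⟩

lemma ae_palm_isEnumeration {Q : Measure (Config (Pt d))} (hQ : StandingAssumptions Q)
    {e : Config (Pt d) → ℕ → Pt d}
    (he : ∀ᵐ S ∂palm Q, Function.Injective (e S) ∧ Set.range (e S) = S.carrier) :
    ∀ᵐ S ∂palm Q, IsEnumeration S (e S) := by
  filter_upwards [he, ae_palm_forall_mem hQ.stationary hQ.degree_exp.1] with S h1 h2
  refine ⟨h1.1, h1.2, fun s hs => ?_⟩
  have h3 := h2 s hs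
  refine (h3.image fun y => y + s).subset ?_
  intro s' hs'
  have h4 : IsNeighbour (translate s S) (s - s) (s' - s) := isNeighbour_translate.2 hs'
  rw [sub_self] at h4
  exact ⟨s' - s, h4, by simp⟩

/-- A square integrable covariant gradient agrees almost surely, on all pairs of neighbours, with a
measurable covariant field. -/
lemma exists_measurable_gradient {Q : Measure (Config (Pt d))} (hQ : StandingAssumptions Q)
    {γ : Pt d → Config (Pt d) → ℝ} (hγ : IsCovariant (grad id γ))
    (hγH : MemH (palm Q) id (grad id γ)) :
    ∃ G : Pt d → Pt d → Config (Pt d) → ℝ,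
      Measurable (fun p : Pt d × Pt d × Config (Pt d) => G p.1 p.2.1 p.2.2) ∧
      (∀ x s s' S, G (s - x) (s' - x) (translate x S) = G s s' S) ∧
      (∀ᵐ S ∂palm Q, ∀ s s', IsNeighbour S s s' → γ s' S - γ s S = G s s' S) ∧
      ∫⁻ S, ∑' s : S.carrier, adj S 0 s * ‖G 0 s S‖ₑ ^ 2 ∂palm Q < ⊤ := by
  have hmeas : AEStronglyMeasurable (fun p : Pt d × Pt d × Config (Pt d) =>
    grad id γ p.1 p.2.1 p.2.2) (campbell (palm Q) id) := hγH.1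
  let g := hmeas.mk
  have hg : Measurable g := hmeas.stronglyMeasurable_mk.measurable
  refine ⟨fun s s' S => g (0, s' - s, translate s S), ?_, ?_, ?_, ?_⟩
  · refine hg.comp (measurable_const.prodMk (Measurable.prodMk (by fun_prop) ?_))
    exact measurable_translate.comp (by fun_prop :
      Measurable fun p : Pt d × Pt d × Config (Pt d) => (p.1, p.2.2))
  · intro x s s' S
    simp only [translate_translate, sub_sub_sub_cancel_right, add_sub_cancel]
  · have h1 := ae_of_ae_campbell (conf := id) measurable_id hmeas.ae_eq_mk
    filter_upwards [ae_palm_forall_mem hQ.stationary h1] with S hS s s' hn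
    have hn' : IsNeighbour (translate s S) (s - s) (s' - s) := isNeighbour_translate.2 hn
    have hc := hγ S s hn.1 s hn.1 s' hn.2.1
    rw [sub_self] at hn' hc
    have h2 := hS s hn.1 (s' - s) hn'
    rw [hc] at h2
    refine Eq.trans ?_ h2
    rw [grad, id, conductance_of_isNeighbour hn, one_mul]
  · have h2 := hγH.2
    rw [eLpNorm_lt_top_iff_lintegral_rpow_enorm_lt_top (by norm_num) (by norm_num)] at h2
    have h3 : ∫⁻ p, ‖g p‖ₑ ^ 2 ∂campbell (palm Q) id < ⊤ := by
      refine lt_of_le_of_lt (le_of_eq (lintegral_congr_ae ?_)) h2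
      filter_upwards [hmeas.ae_eq_mk] with p hp
      rw [hp]
      norm_num [g]
    rw [lintegral_campbell measurable_id (hg.enorm.pow_const 2)] at h3
    have h4 := ENNReal.lt_top_of_mul_ne_top_right h3.ne (by simp)
    simpa [translate_zero] using h4

end

section

/-! ### The mean of a field along the walk -/

variable {d : ℕ}

lemma measurable_pathWeight {e : Config (Pt d) → ℕ → Pt d} (he : ∀ n, Measurable fun S => e S n)
    (l : List ℕ) : ∀ n, Measurable fun S => pathWeight S (e S) n l := by
  induction l with
  | nil => exact fun n => measurable_const
  | cons m l ih =>
    intro n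
    have h1 : Measurable fun S => deg S (e S n) :=
      measurable_deg.comp ((he n).prodMk measurable_id)
    have h2 : Measurable fun S => adj S (e S n) (e S m) :=
      measurableField_adj.comp ((he n).prodMk ((he m).prodMk measurable_id))
    exact (h1.inv.mul h2).mul (ih m)

lemma measurable_pathSum {F : Pt d → Pt d → Config (Pt d) → ℝ≥0∞} (hF : MeasurableField F)
    {e : Config (Pt d) → ℕ → Pt d} (he : ∀ n, Measurable fun S => e S n) (l : List ℕ) :
    ∀ n, Measurable fun S => pathSum F S (e S) n l := by
  induction l with
  | nil => exact fun n => measurable_const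
  | cons m l ih =>
    intro n
    have h : Measurable fun S => F (e S n) (e S m) S :=
      hF.comp ((he n).prodMk ((he m).prodMk measurable_id))
    exact h.add (ih m)

variable {Ω : Type*} {T : ℕ → Ω → Config ℝ}

open Classical in
/-- The mean, given the clocks, of the sum of `F` along the walk from the point `s`, as a function
of the point instead of its number. -/
def pointMean (F : Pt d → Pt d → Config (Pt d) → ℝ≥0∞) (e : Config (Pt d) → ℕ → Pt d)
    (T : ℕ → Ω → Config ℝ) (t : ℝ) (s : Pt d) (z : Config (Pt d) × Ω) : ℝ≥0∞ :=
  ∑' n, if e z.1 n = s then walkMean F z.1 (e z.1) T (t, z.2) n else 0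

lemma pointMean_apply {F : Pt d → Pt d → Config (Pt d) → ℝ≥0∞} {e : Config (Pt d) → ℕ → Pt d}
    {t : ℝ} {z : Config (Pt d) × Ω} (h : IsEnumeration z.1 (e z.1)) (n : ℕ) :
    pointMean F e T t (e z.1 n) z = walkMean F z.1 (e z.1) T (t, z.2) n := by
  rw [pointMean, tsum_eq_single n fun m hm => if_neg fun h' => hm (h.injective h'), if_pos rfl]

variable [MeasurableSpace Ω] {P : Measure Ω}
  {e : Config (Pt d) → ℕ → Pt d} {F : Pt d → Pt d → Config (Pt d) → ℝ≥0∞}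
  {Q : Measure (Config (Pt d))} {t : ℝ}

lemma measurable_walkWeight (hT : ∀ n, IsPoissonProcess P (T n))
    (he : ∀ n, Measurable fun S => e S n) (t : ℝ) (n : ℕ) (l : List ℕ) :
    Measurable fun z : Config (Pt d) × Ω => walkWeight z.1 (e z.1) T (t, z.2) n l :=
  ((measurable_pathWeight he l n).comp measurable_fst).mul
    ((measurable_one.indicator (measurableSet_pathEvent hT n l)).comp
      (measurable_const.prodMk measurable_snd))

lemma measurable_walkMean (hT : ∀ n, IsPoissonProcess P (T n))
    (he : ∀ n, Measurable fun S => e S n) (hF : MeasurableField F) (t : ℝ) (n : ℕ) :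
    Measurable fun z : Config (Pt d) × Ω => walkMean F z.1 (e z.1) T (t, z.2) n :=
  Measurable.tsum fun l => (measurable_walkWeight hT he t n l).mul
    ((measurable_pathSum hF he l n).comp measurable_fst)

lemma measurable_pointMean (hT : ∀ n, IsPoissonProcess P (T n))
    (he : ∀ n, Measurable fun S => e S n) (hF : MeasurableField F) (t : ℝ) :
    Measurable fun p : Pt d × Config (Pt d) × Ω => pointMean F e T t p.1 p.2 := by
  refine Measurable.tsum fun n => Measurable.ite ?_
    ((measurable_walkMean hT he hF t n).comp measurable_snd) measurable_const
  exact measurableSet_eq_fun ((he n).comp (by fun_prop)) measurable_fst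

/-! ### Moments of the mean along the walk -/

variable [IsProbabilityMeasure P]

/-- The mean of the sum of `F` along a walk that jumps at rate one up to time `t`. -/
def timeMean (F : Pt d → Pt d → Config (Pt d) → ℝ≥0∞) (t : ℝ) (s : Pt d) (S : Config (Pt d)) :
    ℝ≥0∞ := ∑' k, jumpProb t k * meanSum F k s S

/-- A bound for the second moment of the sum of `F` along a walk that jumps at rate one, where the
square of a sum of `k` terms is bounded by `2 ^ k` times the sum of the squares. -/
def squareBound (F : Pt d → Pt d → Config (Pt d) → ℝ≥0∞) (t : ℝ) (s : Pt d) (S : Config (Pt d)) :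
    ℝ≥0∞ := ∑' k, jumpProb t k * (2 ^ k * meanSum (fun s s' S => F s s' S ^ 2) k s S)

lemma covariant_sq (hFc : Covariant F) : Covariant fun s s' S => F s s' S ^ 2 :=
  fun x s s' S => by simp only [hFc x s s' S]

lemma measurable_timeMean (hF : MeasurableField F) (t : ℝ) :
    Measurable fun p : Pt d × Config (Pt d) => timeMean F t p.1 p.2 :=
  Measurable.tsum fun k => (measurable_meanSum hF k).const_mul _

lemma measurable_squareBound (hF : MeasurableField F) (t : ℝ) :
    Measurable fun p : Pt d × Config (Pt d) => squareBound F t p.1 p.2 :=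
  Measurable.tsum fun k => ((measurable_meanSum (hF.pow_const 2) k).const_mul _).const_mul _

lemma timeMean_translate (hFc : Covariant F) (t : ℝ) (x s : Pt d) (S : Config (Pt d)) :
    timeMean F t (s - x) (translate x S) = timeMean F t s S := by
  simp only [timeMean, meanSum_translate hFc]

lemma squareBound_translate (hFc : Covariant F) (t : ℝ) (x s : Pt d) (S : Config (Pt d)) :
    squareBound F t (s - x) (translate x S) = squareBound F t s S := by
  simp only [squareBound, meanSum_translate (covariant_sq hFc)]

/-- The number of jumps has exponential moments, and every step contributes the same. -/
lemma lintegral_palm_deg_mul_squareBound_lt_top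
    (hQ : ∀ x : Pt d, MeasurePreserving (translate x) Q Q) (hF : MeasurableField F)
    (hFc : Covariant F) (ht : 0 ≤ t)
    (hN : ∫⁻ S, ∑' s : S.carrier, adj S 0 s * F 0 s S ^ 2 ∂palm Q < ⊤) :
    ∫⁻ S, deg S 0 * squareBound F t 0 S ∂palm Q < ⊤ := by
  set N := ∫⁻ S, ∑' s : S.carrier, adj S 0 s * F 0 s S ^ 2 ∂palm Q
  have h0 : Measurable fun S : Config (Pt d) => ((0 : Pt d), S) := by fun_prop
  have hm : ∀ k, Measurable fun S : Config (Pt d) =>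
      deg S 0 * meanSum (fun s s' S => F s s' S ^ 2) k 0 S := fun k =>
    (measurable_deg.comp h0).mul ((measurable_meanSum (hF.pow_const 2) k).comp h0)
  calc ∫⁻ S, deg S 0 * squareBound F t 0 S ∂palm Q
      = ∑' k, jumpProb t k * 2 ^ k *
          ∫⁻ S, deg S 0 * meanSum (fun s s' S => F s s' S ^ 2) k 0 S ∂palm Q := by
        simp_rw [← lintegral_const_mul _ (hm _)]
        rw [← lintegral_tsum fun k => ((hm k).const_mul _).aemeasurable]
        refine lintegral_congr fun S => ?_
        rw [squareBound, ← ENNReal.tsum_mul_left]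
        exact tsum_congr fun k => by ring
    _ ≤ ∑' k, jumpProb t k * ENNReal.ofReal 4 ^ k * N := by
        refine ENNReal.tsum_le_tsum fun k => ?_
        have h1 := lintegral_palm_deg_mul_meanSum_le hQ (hF.pow_const 2) (covariant_sq hFc) k
        have h2 : (k : ℝ≥0∞) ≤ 2 ^ k := by exact_mod_cast k.lt_two_pow_self.le
        have h4 : ENNReal.ofReal 4 = 2 * 2 := by norm_num
        calc _ ≤ jumpProb t k * 2 ^ k * (2 ^ k * N) := by
              gcongr
              exact h1.trans (by gcongr)
          _ = _ := by rw [h4, mul_pow]; ring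
    _ < ⊤ := by
        rw [ENNReal.tsum_mul_right, tsum_jumpProb_mul_pow ht (by norm_num)]
        exact ENNReal.mul_lt_top ENNReal.ofReal_lt_top hN

/-- Finiteness at the origin extends to all points at once by mass transport. An isolated origin,
where the factor `deg S 0` would lose information, contributes nothing. -/
lemma ae_palm_squareBound_lt_top
    (hQ : ∀ x : Pt d, MeasurePreserving (translate x) Q Q) (hF : MeasurableField F)
    (hFc : Covariant F) (ht : 0 ≤ t)
    (hN : ∫⁻ S, ∑' s : S.carrier, adj S 0 s * F 0 s S ^ 2 ∂palm Q < ⊤) :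
    ∀ᵐ S ∂palm Q, ∀ s ∈ S, squareBound F t s S < ⊤ := by
  have h0 : Measurable fun S : Config (Pt d) => ((0 : Pt d), S) := by fun_prop
  have h1 : ∀ᵐ S ∂palm Q, squareBound F t 0 S < ⊤ := by
    filter_upwards [ae_lt_top ((measurable_deg.comp h0).mul
      ((measurable_squareBound hF t).comp h0))
      (lintegral_palm_deg_mul_squareBound_lt_top hQ hF hFc ht hN).ne] with S hS
    by_cases h : deg S 0 = 0
    · simp [squareBound, meanSum_eq_zero_of_deg_eq_zero h]
    · exact ENNReal.lt_top_of_mul_ne_top_right hS.ne h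
  filter_upwards [ae_palm_forall_mem hQ h1] with S hS s hs
  have := hS s hs
  rwa [← sub_self s, squareBound_translate hFc] at this

lemma lintegral_pointMean (hT : ∀ n, IsPoissonProcess P (T n)) (hTi : iIndepFun T P)
    (ht : 0 ≤ t) {S : Config (Pt d)} (h : IsEnumeration S (e S)) {s : Pt d} (hs : s ∈ S) :
    ∫⁻ ω, pointMean F e T t s (S, ω) ∂P = timeMean F t s S := by
  obtain ⟨n, rfl⟩ := h.exists_eq hs
  rw [timeMean, ← lintegral_walkMean h hT hTi ht n F]
  exact lintegral_congr fun ω => pointMean_apply (z := (S, ω)) h n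

lemma lintegral_pointMean_sq_le (hT : ∀ n, IsPoissonProcess P (T n)) (hTi : iIndepFun T P)
    (ht : 0 ≤ t) {S : Config (Pt d)} (h : IsEnumeration S (e S)) {s : Pt d} (hs : s ∈ S) :
    ∫⁻ ω, pointMean F e T t s (S, ω) ^ 2 ∂P ≤ 2 * squareBound F t s S := by
  obtain ⟨n, rfl⟩ := h.exists_eq hs
  refine le_of_eq_of_le (lintegral_congr fun ω => ?_) (lintegral_walkMean_sq_le h hT hTi ht n F)
  rw [pointMean_apply (z := (S, ω)) h n]

/-- Integrals over the product space, with the clocks integrated first. -/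
lemma lintegral_campbell_prod {f : Pt d × Pt d × Config (Pt d) × Ω → ℝ≥0∞} (hf : Measurable f) :
    ∫⁻ p, f p ∂campbell ((palm Q).prod P) Prod.fst
      = 2⁻¹ * ∫⁻ S, ∑' s : S.carrier, adj S 0 s * ∫⁻ ω, f (0, (s : Pt d), S, ω) ∂P ∂palm Q := by
  rw [lintegral_campbell measurable_fst hf,
    lintegral_prod _ (measurable_tsum_adj_mul measurable_fst hf).aemeasurable]
  congr 2
  ext S
  have hm : ∀ s : Pt d, Measurable fun ω => f (0, s, S, ω) := fun s =>
    hf.comp (by fun_prop)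
  change ∫⁻ ω, ∑' s : S.carrier, adj S 0 s * f (0, (s : Pt d), S, ω) ∂P = _
  rw [lintegral_tsum fun s : S.carrier => ((hm s).const_mul _).aemeasurable]
  exact tsum_congr fun s => lintegral_const_mul _ (hm s)

/-- The mean along the walk from the endpoint of an edge is square integrable. -/
lemma lintegral_campbell_pointMean_snd_sq_lt_top
    (hQ : ∀ x : Pt d, MeasurePreserving (translate x) Q Q)
    (hT : ∀ n, IsPoissonProcess P (T n)) (hTi : iIndepFun T P)
    (he : ∀ n, Measurable fun S => e S n) (hE : ∀ᵐ S ∂palm Q, IsEnumeration S (e S))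
    (hF : MeasurableField F) (hFc : Covariant F) (ht : 0 ≤ t)
    (hN : ∫⁻ S, ∑' s : S.carrier, adj S 0 s * F 0 s S ^ 2 ∂palm Q < ⊤) :
    ∫⁻ p, pointMean F e T t p.2.1 p.2.2 ^ 2 ∂campbell ((palm Q).prod P) Prod.fst < ⊤ := by
  have hm : Measurable fun p : Pt d × Pt d × Config (Pt d) × Ω => pointMean F e T t p.2.1 p.2.2 :=
    (measurable_pointMean hT he hF t).comp (by fun_prop)
  rw [lintegral_campbell_prod (hm.pow_const 2)]
  refine ENNReal.mul_lt_top (by simp) (lt_of_le_of_lt (lintegral_mono_ae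
    (g := fun S => ∑' s : S.carrier, adj S 0 s * (2 * squareBound F t s S)) ?_) ?_)
  · filter_upwards [hE] with S hS
    gcongr with s
    exact lintegral_pointMean_sq_le hT hTi ht hS s.2
  · rw [lintegral_palm_tsum_adj_mul hQ (f := fun s S => 2 * squareBound F t s S)
      ((measurable_squareBound hF t).const_mul _)
      fun x s S => by simp only [squareBound_translate hFc]]
    simp_rw [mul_left_comm _ (2 : ℝ≥0∞)]
    rw [lintegral_const_mul' _ _ (by simp)]
    exact ENNReal.mul_lt_top (by simp)
      (lintegral_palm_deg_mul_squareBound_lt_top hQ hF hFc ht hN)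

/-- The mean along the walk from the starting point of an edge is square integrable. -/
lemma lintegral_campbell_pointMean_fst_sq_lt_top
    (hQ : ∀ x : Pt d, MeasurePreserving (translate x) Q Q)
    (hT : ∀ n, IsPoissonProcess P (T n)) (hTi : iIndepFun T P)
    (he : ∀ n, Measurable fun S => e S n) (hE : ∀ᵐ S ∂palm Q, IsEnumeration S (e S))
    (hF : MeasurableField F) (hFc : Covariant F) (ht : 0 ≤ t)
    (hN : ∫⁻ S, ∑' s : S.carrier, adj S 0 s * F 0 s S ^ 2 ∂palm Q < ⊤) :
    ∫⁻ p, pointMean F e T t p.1 p.2.2 ^ 2 ∂campbell ((palm Q).prod P) Prod.fst < ⊤ := by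
  have hm : Measurable fun p : Pt d × Pt d × Config (Pt d) × Ω => pointMean F e T t p.1 p.2.2 :=
    (measurable_pointMean hT he hF t).comp (by fun_prop :
      Measurable fun p : Pt d × Pt d × Config (Pt d) × Ω => (p.1, p.2.2))
  rw [lintegral_campbell_prod (hm.pow_const 2)]
  refine ENNReal.mul_lt_top (by simp) (lt_of_le_of_lt (lintegral_mono_ae
    (g := fun S => 2 * (deg S 0 * squareBound F t 0 S)) ?_) ?_)
  · filter_upwards [hE, ae_palm_zero_mem Q] with S hS h0
    rw [ENNReal.tsum_mul_right, mul_left_comm]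
    change deg S 0 * _ ≤ _
    gcongr
    exact lintegral_pointMean_sq_le hT hTi ht hS h0
  · rw [lintegral_const_mul' _ _ (by simp)]
    exact ENNReal.mul_lt_top (by simp)
      (lintegral_palm_deg_mul_squareBound_lt_top hQ hF hFc ht hN)

/-- A covariant height has the same pairing with the two ends of the edges, since `ω_u` has no
divergence. -/
lemma lintegral_campbell_pointMean_mul_posShadow
    (hQ : ∀ x : Pt d, MeasurePreserving (translate x) Q Q)
    (hT : ∀ n, IsPoissonProcess P (T n)) (hTi : iIndepFun T P)
    (he : ∀ n, Measurable fun S => e S n) (hE : ∀ᵐ S ∂palm Q, IsEnumeration S (e S))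
    (hF : MeasurableField F) (hFc : Covariant F) (ht : 0 ≤ t) {u : Pt d} (hu : ‖u‖ = 1)
    (hdiv : ∀ᵐ S ∂palm Q,
      ∑' s : S.carrier, posShadow u S 0 s = ∑' s : S.carrier, posShadow (-u) S 0 s) :
    ∫⁻ p, pointMean F e T t p.2.1 p.2.2 * posShadow u p.2.2.1 p.1 p.2.1
        ∂campbell ((palm Q).prod P) Prod.fst
      = ∫⁻ p, pointMean F e T t p.1 p.2.2 * posShadow u p.2.2.1 p.1 p.2.1
        ∂campbell ((palm Q).prod P) Prod.fst := by
  have hmW : Measurable fun p : Pt d × Pt d × Config (Pt d) × Ω =>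
      posShadow u p.2.2.1 p.1 p.2.1 := (measurable_posShadow hu).comp (by fun_prop :
    Measurable fun p : Pt d × Pt d × Config (Pt d) × Ω => (p.1, p.2.1, p.2.2.1))
  have hm2 : Measurable fun p : Pt d × Pt d × Config (Pt d) × Ω => pointMean F e T t p.2.1 p.2.2 :=
    (measurable_pointMean hT he hF t).comp (by fun_prop)
  have hm1 : Measurable fun p : Pt d × Pt d × Config (Pt d) × Ω => pointMean F e T t p.1 p.2.2 :=
    (measurable_pointMean hT he hF t).comp (by fun_prop :
      Measurable fun p : Pt d × Pt d × Config (Pt d) × Ω => (p.1, p.2.2))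
  have hmω : ∀ (s : Pt d) (S : Config (Pt d)), Measurable fun ω => pointMean F e T t s (S, ω) :=
    fun s S => (measurable_pointMean hT he hF t).comp
      (by fun_prop : Measurable fun ω : Ω => (s, S, ω))
  have h2 := lintegral_campbell_prod (Q := Q) (P := P)
    (f := fun p => pointMean F e T t p.2.1 p.2.2 * posShadow u p.2.2.1 p.1 p.2.1) (hm2.mul hmW)
  have h1 := lintegral_campbell_prod (Q := Q) (P := P)
    (f := fun p => pointMean F e T t p.1 p.2.2 * posShadow u p.2.2.1 p.1 p.2.1) (hm1.mul hmW)
  rw [h2, h1]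
  congr 1
  calc ∫⁻ S, ∑' s : S.carrier, adj S 0 s *
        ∫⁻ ω, pointMean F e T t s (S, ω) * posShadow u S 0 s ∂P ∂palm Q
      = ∫⁻ S, ∑' s : S.carrier, timeMean F t s S * posShadow u S 0 s ∂palm Q := by
        refine lintegral_congr_ae ?_
        filter_upwards [hE] with S hS
        refine tsum_congr fun s => ?_
        rw [lintegral_mul_const _ (hmω _ _), lintegral_pointMean hT hTi ht hS s.2, mul_left_comm,
          adj_mul_posShadow]
    _ = ∫⁻ S, ∑' s : S.carrier, timeMean F t 0 S * posShadow u S s 0 ∂palm Q := by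
        refine lintegral_palm_swap hQ (K := fun s s' S => timeMean F t s' S * posShadow u S s s')
          (((measurable_timeMean hF t).comp (by fun_prop :
            Measurable fun p : Pt d × Pt d × Config (Pt d) => (p.2.1, p.2.2))).mul
            (measurable_posShadow hu)) fun x s s' S => ?_
        have h := covariant_posShadow u x s s' S
        simp only at h ⊢
        rw [timeMean_translate hFc, h]
    _ = ∫⁻ S, ∑' s : S.carrier, timeMean F t 0 S * posShadow u S 0 s ∂palm Q := by
        refine lintegral_congr_ae ?_
        filter_upwards [hdiv] with S hS
        rw [ENNReal.tsum_mul_left, ENNReal.tsum_mul_left, hS]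
        simp_rw [posShadow_neg_swap]
    _ = _ := by
        refine lintegral_congr_ae ?_
        filter_upwards [hE, ae_palm_zero_mem Q] with S hS h0
        refine tsum_congr fun s => ?_
        rw [lintegral_mul_const _ (hmω _ _), lintegral_pointMean hT hTi ht hS h0, mul_left_comm,
          adj_mul_posShadow]

end

section

/-! ### The harness process as the mean of the gradient along the walk -/

variable {d : ℕ} {Ω : Type*} [MeasurableSpace Ω] {P : Measure Ω} [IsProbabilityMeasure P]
  {T : ℕ → Ω → Config ℝ} {e : Config (Pt d) → ℕ → Pt d} {Q : Measure (Config (Pt d))} {t : ℝ}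

lemma clock_apply (T : ℕ → Config ℝ) {S : Config (Pt d)} (h : IsEnumeration S (e S)) (n : ℕ) :
    clock e T S (e S n) = (T n).carrier := by
  ext τ
  constructor
  · rintro ⟨m, hm, hτ⟩
    rwa [← h.injective hm]
  · exact fun hτ => ⟨n, rfl, hτ⟩

lemma ae_prod_walkMean_ne_top {F : Pt d → Pt d → Config (Pt d) → ℝ≥0∞}
    (hQ : ∀ x : Pt d, MeasurePreserving (translate x) Q Q)
    (hT : ∀ n, IsPoissonProcess P (T n)) (hTi : iIndepFun T P)
    (he : ∀ n, Measurable fun S => e S n) (hE : ∀ᵐ S ∂palm Q, IsEnumeration S (e S))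
    (hF : MeasurableField F) (hFc : Covariant F) (ht : 0 ≤ t)
    (hN : ∫⁻ S, ∑' s : S.carrier, adj S 0 s * F 0 s S ^ 2 ∂palm Q < ⊤) :
    ∀ᵐ z ∂(palm Q).prod P, ∀ n, walkMean F z.1 (e z.1) T (t, z.2) n ≠ ⊤ := by
  refine ae_all_iff.2 fun n => ?_
  have hm := measurable_walkMean hT he hF t n
  refine (Measure.ae_prod_iff_ae_ae ((hm (measurableSet_singleton ⊤)).compl)).2 ?_
  filter_upwards [hE, ae_palm_squareBound_lt_top hQ hF hFc ht hN] with S hS hX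
  have h1 : ∫⁻ ω, walkMean F S (e S) T (t, ω) n ^ 2 ∂P < ⊤ :=
    (lintegral_walkMean_sq_le hS hT hTi ht n F).trans_lt
      (ENNReal.mul_lt_top (by simp) (hX _ (hS.mem n)))
  have h2 : Measurable fun ω => walkMean F S (e S) T (t, ω) n := hm.comp measurable_prodMk_left
  filter_upwards [ae_lt_top (h2.pow_const 2) h1.ne] with ω hω h
  have h' : walkMean F S (e S) T (t, ω) n = ⊤ := h
  simp [h'] at hω

lemma ae_prod_tsum_walkWeight_eq_one
    (hT : ∀ n, IsPoissonProcess P (T n)) (hTi : iIndepFun T P)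
    (he : ∀ n, Measurable fun S => e S n) (hE : ∀ᵐ S ∂palm Q, IsEnumeration S (e S))
    (ht : 0 ≤ t) :
    ∀ᵐ z ∂(palm Q).prod P, ∀ n, deg z.1 (e z.1 n) ≠ 0 →
      ∑' l, walkWeight z.1 (e z.1) T (t, z.2) n l = 1 := by
  refine ae_all_iff.2 fun n => ?_
  have hm1 : Measurable fun z : Config (Pt d) × Ω => deg z.1 (e z.1 n) :=
    measurable_deg.comp (((he n).comp measurable_fst).prodMk measurable_fst)
  have hm2 : Measurable fun z : Config (Pt d) × Ω =>
      ∑' l, walkWeight z.1 (e z.1) T (t, z.2) n l :=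
    Measurable.tsum fun l => measurable_walkWeight hT he t n l
  have hms : MeasurableSet {z : Config (Pt d) × Ω | deg z.1 (e z.1 n) ≠ 0 →
      ∑' l, walkWeight z.1 (e z.1) T (t, z.2) n l = 1} :=
    MeasurableSet.imp (hm1 (measurableSet_singleton 0)).compl (hm2 (measurableSet_singleton 1))
  refine (Measure.ae_prod_iff_ae_ae hms).2 ?_
  filter_upwards [hE] with S hS
  filter_upwards [ae_tsum_walkWeight_eq_one hS hT hTi ht] with ω hω
  exact hω n

variable {γ : Pt d → Config (Pt d) → ℝ} {Fp Fm : Pt d → Pt d → Config (Pt d) → ℝ≥0∞}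

/-- The heights of the harness process, in terms of the means of the gradient along the walk. At an
isolated point the walk is killed at its first epoch, and the height is lost, but no gradient ever
involves such a point. -/
lemma ae_prod_hasSum_harness
    (hQ : ∀ x : Pt d, MeasurePreserving (translate x) Q Q)
    (hT : ∀ n, IsPoissonProcess P (T n)) (hTi : iIndepFun T P)
    (he : ∀ n, Measurable fun S => e S n) (hE : ∀ᵐ S ∂palm Q, IsEnumeration S (e S))
    (ht : 0 ≤ t) (hFp : MeasurableField Fp) (hFpc : Covariant Fp)
    (hNp : ∫⁻ S, ∑' s : S.carrier, adj S 0 s * Fp 0 s S ^ 2 ∂palm Q < ⊤)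
    (hFm : MeasurableField Fm) (hFmc : Covariant Fm)
    (hNm : ∫⁻ S, ∑' s : S.carrier, adj S 0 s * Fm 0 s S ^ 2 ∂palm Q < ⊤)
    (hp : ∀ s s' S, Fp s s' S ≠ ⊤) (hm : ∀ s s' S, Fm s s' S ≠ ⊤)
    (hγ : ∀ᵐ S ∂palm Q, ∀ s s', IsNeighbour S s s' →
      γ s' S - γ s S = (Fp s s' S).toReal - (Fm s s' S).toReal) :
    ∀ᵐ z ∂(palm Q).prod P, ∀ s ∈ z.1,
      HasSum (fun s' : z.1.carrier =>
          transProb z.1 (clock e (fun n => T n z.2) z.1) t s s' * γ s' z.1)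
        (harness e T γ t s z) ∧
      (deg z.1 s ≠ 0 → harness e T γ t s z
        = γ s z.1 + (pointMean Fp e T t s z).toReal - (pointMean Fm e T t s z).toReal) := by
  filter_upwards [Measure.quasiMeasurePreserving_fst.ae hE,
    Measure.quasiMeasurePreserving_fst.ae hγ,
    Measure.quasiMeasurePreserving_snd.ae (ae_notMem_clock hT t),
    ae_prod_walkMean_ne_top hQ hT hTi he hE hFp hFpc ht hNp,
    ae_prod_walkMean_ne_top hQ hT hTi he hE hFm hFmc ht hNm,
    ae_prod_tsum_walkWeight_eq_one hT hTi he hE ht] with z hE hγ ht hwp hwm h1 s hs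
  obtain ⟨n, rfl⟩ := hE.exists_eq hs
  have h := hasSum_harness hE (ω := z.2) (fun n => clock_apply (fun n => T n z.2) hE n) ht
    (γ := fun s => γ s z.1) (fun s s' => hp s s' _) (fun s s' => hm s s' _) hγ n (hwp n) (hwm n)
  refine ⟨h.summable.hasSum, fun hd => ?_⟩
  rw [h1 n hd] at h
  rw [harness, h.tsum_eq, pointMean_apply hE, pointMean_apply hE, ENNReal.toReal_one, mul_one]

/-! ### Invariance of the tilt -/

/-- The tilt in terms of the positive and negative parts of `ω_u`. -/
lemma tilt_eq_integral {α : Type*} [MeasurableSpace α] {μ : Measure α} {conf : α → Config (Pt d)}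
    (hc : Measurable conf) (u : Pt d) (η : Pt d → α → ℝ) :
    tilt μ conf u η = ∫ p, grad conf η p.1 p.2.1 p.2.2 *
      ((posShadow u (conf p.2.2) p.1 p.2.1).toReal
        - (posShadow (-u) (conf p.2.2) p.1 p.2.1).toReal) ∂campbell μ conf := by
  refine integral_congr_ae (ae_campbell hc ?_)
  refine Eventually.of_forall fun z s hs => ?_
  simp only
  rw [omega_eq, conductance_of_isNeighbour hs, one_mul]

lemma grad_of_isNeighbour {α : Type*} {conf : α → Config (Pt d)} {η : Pt d → α → ℝ} {s s' : Pt d}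
    {z : α} (h : IsNeighbour (conf z) s s') : grad conf η s s' z = η s' z - η s z := by
  rw [grad, conductance_of_isNeighbour h, one_mul]

lemma memH_omega [IsProbabilityMeasure Q] (hQ : StandingAssumptions Q) {u : Pt d} (hu : ‖u‖ = 1) :
    MemH (palm Q) id (omega id u) := by
  have hm : ∀ {v : Pt d}, ‖v‖ = 1 → Measurable fun p : Pt d × Pt d × Config (Pt d) =>
      posShadow v (id p.2.2) p.1 p.2.1 := fun hv => measurable_posShadow hv
  have hu' : ‖-u‖ = 1 := by rwa [norm_neg]
  have h := (memLp_two_toReal (hm hu) (lintegral_campbell_posShadow_sq_lt_top hQ hu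
    (MeasurePreserving.id _))).sub (memLp_two_toReal (hm hu')
    (lintegral_campbell_posShadow_sq_lt_top hQ hu' (MeasurePreserving.id _)))
  refine h.ae_eq (Eventually.of_forall fun p => ?_)
  exact (omega_eq id u p.1 p.2.1 p.2.2).symm

lemma integral_sum_six {β : Type*} [MeasurableSpace β] {ν : Measure β} {a b c c' f f' : β → ℝ}
    (ha : Integrable a ν) (hb : Integrable b ν) (hc : Integrable c ν) (hc' : Integrable c' ν)
    (hf : Integrable f ν) (hf' : Integrable f' ν) (h : ∫ p, c p ∂ν = ∫ p, f p ∂ν)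
    (h' : ∫ p, c' p ∂ν = ∫ p, f' p ∂ν) :
    ∫ p, (a p - b p) + ((c p - c' p) - (f p - f' p)) ∂ν = ∫ p, a p ∂ν - ∫ p, b p ∂ν := by
  have h1 : Integrable (fun p => a p - b p) ν := ha.sub hb
  have h2 : Integrable (fun p => c p - c' p) ν := hc.sub hc'
  have h3 : Integrable (fun p => f p - f' p) ν := hf.sub hf'
  have h4 : Integrable (fun p => (c p - c' p) - (f p - f' p)) ν := h2.sub h3
  rw [integral_add h1 h4, integral_sub h2 h3, integral_sub ha hb, integral_sub hc hc',
    integral_sub hf hf', h, h', sub_self, add_zero]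

/-- The positive and negative parts of a measurable version of the gradient. -/
lemma exists_measurable_parts (hQ : StandingAssumptions Q) (hγ : IsCovariant (grad id γ))
    (hγH : MemH (palm Q) id (grad id γ)) :
    ∃ Fp Fm : Pt d → Pt d → Config (Pt d) → ℝ≥0∞,
      (MeasurableField Fp ∧ Covariant Fp ∧ (∀ s s' S, Fp s s' S ≠ ⊤) ∧
        ∫⁻ S, ∑' s : S.carrier, adj S 0 s * Fp 0 s S ^ 2 ∂palm Q < ⊤) ∧
      (MeasurableField Fm ∧ Covariant Fm ∧ (∀ s s' S, Fm s s' S ≠ ⊤) ∧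
        ∫⁻ S, ∑' s : S.carrier, adj S 0 s * Fm 0 s S ^ 2 ∂palm Q < ⊤) ∧
      ∀ᵐ S ∂palm Q, ∀ s s', IsNeighbour S s s' →
        γ s' S - γ s S = (Fp s s' S).toReal - (Fm s s' S).toReal := by
  obtain ⟨G, hG, hGc, hGγ, hGN⟩ := exists_measurable_gradient hQ hγ hγH
  have hle : ∀ {f : Pt d → Config (Pt d) → ℝ}, (∀ s S, ‖f s S‖ₑ = ‖G 0 s S‖ₑ) →
      ∫⁻ S, ∑' s : S.carrier, adj S 0 s * ENNReal.ofReal (f s S) ^ 2 ∂palm Q < ⊤ := by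
    intro f hf
    refine lt_of_le_of_lt (lintegral_mono fun S => ENNReal.tsum_le_tsum fun s => ?_) hGN
    gcongr
    rw [← hf]
    exact Real.ofReal_le_enorm _
  refine ⟨fun s s' S => ENNReal.ofReal (G s s' S), fun s s' S => ENNReal.ofReal (-G s s' S),
    ⟨hG.ennreal_ofReal, fun x s s' S => by simp only [hGc], fun _ _ _ => ENNReal.ofReal_ne_top,
      hle fun _ _ => rfl⟩,
    ⟨hG.neg.ennreal_ofReal, fun x s s' S => by simp only [hGc], fun _ _ _ => ENNReal.ofReal_ne_top,
      hle fun _ _ => enorm_neg _⟩, ?_⟩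
  filter_upwards [hGγ] with S hS s s' h
  rw [hS s s' h, ENNReal.toReal_ofReal', ENNReal.toReal_ofReal', max_zero_sub_eq_self]

lemma lintegral_campbell_prod_fst {f : Pt d × Pt d × Config (Pt d) → ℝ≥0∞} (hf : Measurable f) :
    ∫⁻ p, f (p.1, p.2.1, p.2.2.1) ∂campbell ((palm Q).prod P) Prod.fst
      = ∫⁻ p, f p ∂campbell (palm Q) id := by
  have h := lintegral_campbell_prod (Q := Q) (P := P) (f := fun p => f (p.1, p.2.1, p.2.2.1))
    (hf.comp (by fun_prop))
  rw [h, lintegral_campbell measurable_id hf]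
  simp

/-- The harness process keeps its gradient square integrable, and its tilt. The two means along the
walk by which the gradient has changed cancel in the tilt. -/
lemma memH_grad_harness_and_tilt_eq [IsProbabilityMeasure Q] (hQ : StandingAssumptions Q)
    (hT : ∀ n, IsPoissonProcess P (T n)) (hTi : iIndepFun T P)
    (he : ∀ n, Measurable fun S => e S n) (hE : ∀ᵐ S ∂palm Q, IsEnumeration S (e S))
    (ht : 0 ≤ t) {u : Pt d} (hu : ‖u‖ = 1) (hFp : MeasurableField Fp) (hFpc : Covariant Fp)
    (hNp : ∫⁻ S, ∑' s : S.carrier, adj S 0 s * Fp 0 s S ^ 2 ∂palm Q < ⊤)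
    (hFm : MeasurableField Fm) (hFmc : Covariant Fm)
    (hNm : ∫⁻ S, ∑' s : S.carrier, adj S 0 s * Fm 0 s S ^ 2 ∂palm Q < ⊤)
    (hγ : ∀ᵐ S ∂palm Q, ∀ s s', IsNeighbour S s s' →
      γ s' S - γ s S = (Fp s s' S).toReal - (Fm s s' S).toReal)
    (hη : ∀ᵐ z ∂(palm Q).prod P, ∀ s ∈ z.1, deg z.1 s ≠ 0 → harness e T γ t s z
        = γ s z.1 + (pointMean Fp e T t s z).toReal - (pointMean Fm e T t s z).toReal) :
    MemH ((palm Q).prod P) Prod.fst (grad Prod.fst (harness e T γ t)) ∧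
      tilt ((palm Q).prod P) Prod.fst u (harness e T γ t) = tilt (palm Q) id u γ := by
  have hs := hQ.stationary
  have hu' : ‖-u‖ = 1 := by rwa [norm_neg]
  set ν := campbell ((palm Q).prod P) (Prod.fst : Config (Pt d) × Ω → Config (Pt d)) with hν
  -- the parts `a`, `b` of the old gradient, the means `c`, `c'` along the walk from the end of an
  -- edge and `f`, `f'` along the walk from its start, and the parts `w`, `w'` of `ω_u`
  let a : Pt d × Pt d × Config (Pt d) × Ω → ℝ≥0∞ := fun p => Fp p.1 p.2.1 p.2.2.1
  let b : Pt d × Pt d × Config (Pt d) × Ω → ℝ≥0∞ := fun p => Fm p.1 p.2.1 p.2.2.1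
  let c : Pt d × Pt d × Config (Pt d) × Ω → ℝ≥0∞ := fun p => pointMean Fp e T t p.2.1 p.2.2
  let c' : Pt d × Pt d × Config (Pt d) × Ω → ℝ≥0∞ := fun p => pointMean Fm e T t p.2.1 p.2.2
  let f : Pt d × Pt d × Config (Pt d) × Ω → ℝ≥0∞ := fun p => pointMean Fp e T t p.1 p.2.2
  let f' : Pt d × Pt d × Config (Pt d) × Ω → ℝ≥0∞ := fun p => pointMean Fm e T t p.1 p.2.2
  let w : Pt d × Pt d × Config (Pt d) × Ω → ℝ≥0∞ := fun p => posShadow u p.2.2.1 p.1 p.2.1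
  let w' : Pt d × Pt d × Config (Pt d) × Ω → ℝ≥0∞ := fun p => posShadow (-u) p.2.2.1 p.1 p.2.1
  have hπ : Measurable fun p : Pt d × Pt d × Config (Pt d) × Ω => (p.1, p.2.1, p.2.2.1) := by
    fun_prop
  have hπ1 : Measurable fun p : Pt d × Pt d × Config (Pt d) × Ω => (p.1, p.2.2) := by fun_prop
  have hπ2 : Measurable fun p : Pt d × Pt d × Config (Pt d) × Ω => (p.2.1, p.2.2) := by fun_prop
  have ha : Measurable a := hFp.comp hπ
  have hb : Measurable b := hFm.comp hπ
  have hc : Measurable c := (measurable_pointMean hT he hFp t).comp hπ2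
  have hc' : Measurable c' := (measurable_pointMean hT he hFm t).comp hπ2
  have hf : Measurable f := (measurable_pointMean hT he hFp t).comp hπ1
  have hf' : Measurable f' := (measurable_pointMean hT he hFm t).comp hπ1
  have hw : Measurable w := (measurable_posShadow hu).comp hπ
  have hw' : Measurable w' := (measurable_posShadow hu').comp hπ
  have hsq : ∀ {F : Pt d → Pt d → Config (Pt d) → ℝ≥0∞}, MeasurableField F →
      ∫⁻ S, ∑' s : S.carrier, adj S 0 s * F 0 s S ^ 2 ∂palm Q < ⊤ →
      ∫⁻ p, F p.1 p.2.1 p.2.2 ^ 2 ∂campbell (palm Q) id < ⊤ := fun hF hN => by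
    rw [lintegral_campbell measurable_id (hF.pow_const 2)]
    exact ENNReal.mul_lt_top (by simp) hN
  have ha2 : ∫⁻ p, a p ^ 2 ∂ν < ⊤ :=
    (lintegral_campbell_prod_fst (hFp.pow_const 2)).trans_lt (hsq hFp hNp)
  have hb2 : ∫⁻ p, b p ^ 2 ∂ν < ⊤ :=
    (lintegral_campbell_prod_fst (hFm.pow_const 2)).trans_lt (hsq hFm hNm)
  have hc2 : ∫⁻ p, c p ^ 2 ∂ν < ⊤ :=
    lintegral_campbell_pointMean_snd_sq_lt_top hs hT hTi he hE hFp hFpc ht hNp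
  have hc2' : ∫⁻ p, c' p ^ 2 ∂ν < ⊤ :=
    lintegral_campbell_pointMean_snd_sq_lt_top hs hT hTi he hE hFm hFmc ht hNm
  have hf2 : ∫⁻ p, f p ^ 2 ∂ν < ⊤ :=
    lintegral_campbell_pointMean_fst_sq_lt_top hs hT hTi he hE hFp hFpc ht hNp
  have hf2' : ∫⁻ p, f' p ^ 2 ∂ν < ⊤ :=
    lintegral_campbell_pointMean_fst_sq_lt_top hs hT hTi he hE hFm hFmc ht hNm
  have hw2 : ∫⁻ p, w p ^ 2 ∂ν < ⊤ :=
    lintegral_campbell_posShadow_sq_lt_top hQ hu measurePreserving_fst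
  have hw2' : ∫⁻ p, w' p ^ 2 ∂ν < ⊤ :=
    lintegral_campbell_posShadow_sq_lt_top hQ hu' measurePreserving_fst
  have hgrad : ∀ᵐ p ∂ν, ((a p).toReal - (b p).toReal) + (((c p).toReal - (c' p).toReal)
      - ((f p).toReal - (f' p).toReal)) = grad Prod.fst (harness e T γ t) p.1 p.2.1 p.2.2 := by
    refine ae_campbell measurable_fst ?_
    filter_upwards [hη, Measure.quasiMeasurePreserving_fst.ae hγ] with z hz hγz s hn
    simp only [a, b, c, c', f, f']
    rw [grad_of_isNeighbour hn, hz s hn.2.1 (deg_ne_zero (isNeighbour_comm.1 hn)),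
      hz 0 hn.1 (deg_ne_zero hn), ← hγz 0 s hn]
    ring
  constructor
  · exact (((memLp_two_toReal ha ha2).sub (memLp_two_toReal hb hb2)).add
      (((memLp_two_toReal hc hc2).sub (memLp_two_toReal hc' hc2')).sub
        ((memLp_two_toReal hf hf2).sub (memLp_two_toReal hf' hf2')))).ae_eq hgrad
  · obtain ⟨ia, ea⟩ := integral_toReal_mul_sub ha hw hw' ha2 hw2 hw2'
    obtain ⟨ib, eb⟩ := integral_toReal_mul_sub hb hw hw' hb2 hw2 hw2'
    obtain ⟨ic, ec⟩ := integral_toReal_mul_sub hc hw hw' hc2 hw2 hw2'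
    obtain ⟨ic', ec'⟩ := integral_toReal_mul_sub hc' hw hw' hc2' hw2 hw2'
    obtain ⟨jf, ef⟩ := integral_toReal_mul_sub hf hw hw' hf2 hw2 hw2'
    obtain ⟨jf', ef'⟩ := integral_toReal_mul_sub hf' hw hw' hf2' hw2 hw2'
    have hd := ae_palm_tsum_posShadow_eq hQ hu
    have hd' := ae_palm_tsum_posShadow_eq hQ hu'
    have h1 : ∫ p, (c p).toReal * ((w p).toReal - (w' p).toReal) ∂ν
        = ∫ p, (f p).toReal * ((w p).toReal - (w' p).toReal) ∂ν := by
      rw [ec, ef]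
      congr 2
      · exact lintegral_campbell_pointMean_mul_posShadow hs hT hTi he hE hFp hFpc ht hu hd
      · exact lintegral_campbell_pointMean_mul_posShadow hs hT hTi he hE hFp hFpc ht hu' hd'
    have h2 : ∫ p, (c' p).toReal * ((w p).toReal - (w' p).toReal) ∂ν
        = ∫ p, (f' p).toReal * ((w p).toReal - (w' p).toReal) ∂ν := by
      rw [ec', ef']
      congr 2
      · exact lintegral_campbell_pointMean_mul_posShadow hs hT hTi he hE hFm hFmc ht hu hd
      · exact lintegral_campbell_pointMean_mul_posShadow hs hT hTi he hE hFm hFmc ht hu' hd'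
    have hL : tilt ((palm Q).prod P) Prod.fst u (harness e T γ t)
        = ∫ p, (a p).toReal * ((w p).toReal - (w' p).toReal) ∂ν
          - ∫ p, (b p).toReal * ((w p).toReal - (w' p).toReal) ∂ν := by
      rw [tilt_eq_integral measurable_fst, ← integral_sum_six ia ib ic ic' jf jf' h1 h2]
      refine integral_congr_ae ?_
      filter_upwards [hgrad] with p hp
      rw [← hp]
      ring
    let a₀ : Pt d × Pt d × Config (Pt d) → ℝ≥0∞ := fun p => Fp p.1 p.2.1 p.2.2
    let b₀ : Pt d × Pt d × Config (Pt d) → ℝ≥0∞ := fun p => Fm p.1 p.2.1 p.2.2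
    let w₀ : Pt d × Pt d × Config (Pt d) → ℝ≥0∞ := fun p => posShadow u p.2.2 p.1 p.2.1
    let w₀' : Pt d × Pt d × Config (Pt d) → ℝ≥0∞ := fun p => posShadow (-u) p.2.2 p.1 p.2.1
    have hmw₀ : Measurable w₀ := measurable_posShadow hu
    have hmw₀' : Measurable w₀' := measurable_posShadow hu'
    have hw₀ : ∫⁻ p, w₀ p ^ 2 ∂campbell (palm Q) id < ⊤ :=
      lintegral_campbell_posShadow_sq_lt_top hQ hu (MeasurePreserving.id _)
    have hw₀' : ∫⁻ p, w₀' p ^ 2 ∂campbell (palm Q) id < ⊤ :=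
      lintegral_campbell_posShadow_sq_lt_top hQ hu' (MeasurePreserving.id _)
    obtain ⟨ia₀, ea₀⟩ := integral_toReal_mul_sub (K := a₀) hFp hmw₀ hmw₀' (hsq hFp hNp) hw₀ hw₀'
    obtain ⟨ib₀, eb₀⟩ := integral_toReal_mul_sub (K := b₀) hFm hmw₀ hmw₀' (hsq hFm hNm) hw₀ hw₀'
    have hR : tilt (palm Q) id u γ
        = ∫ p, (a₀ p).toReal * ((w₀ p).toReal - (w₀' p).toReal) ∂campbell (palm Q) id
          - ∫ p, (b₀ p).toReal * ((w₀ p).toReal - (w₀' p).toReal) ∂campbell (palm Q) id := by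
      rw [tilt_eq_integral measurable_id, ← integral_sub ia₀ ib₀]
      refine integral_congr_ae (ae_campbell measurable_id ?_)
      filter_upwards [hγ] with S hS s hn
      simp only [a₀, b₀, w₀, w₀', id]
      rw [grad_of_isNeighbour hn, hS 0 s hn]
      ring
    rw [hL, hR, ea, eb, ea₀, eb₀]
    congr 3
    · exact lintegral_campbell_prod_fst (f := fun p => a₀ p * w₀ p) (Measurable.mul hFp hmw₀)
    · exact lintegral_campbell_prod_fst (f := fun p => a₀ p * w₀' p) (Measurable.mul hFp hmw₀')
    · exact lintegral_campbell_prod_fst (f := fun p => b₀ p * w₀ p) (Measurable.mul hFm hmw₀)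
    · exact lintegral_campbell_prod_fst (f := fun p => b₀ p * w₀' p) (Measurable.mul hFm hmw₀')

end

end

end HarnessTilt

open HarnessTilt in
theorem proposition2 {d : ℕ}
    -- the law of the point process
    (Q : Measure (Config (Pt d))) [IsProbabilityMeasure Q] (hQ : StandingAssumptions Q)
    -- independent rate one Poisson processes
    {Ω : Type*} [MeasurableSpace Ω] (P : Measure Ω) [IsProbabilityMeasure P]
    (T : ℕ → Ω → Config ℝ) (hT : ∀ n, IsPoissonProcess P (T n)) (hTindep : iIndepFun T P)
    -- an arbitrary measurable enumeration of the points of the Palm version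
    (e : Config (Pt d) → ℕ → Pt d) (he : ∀ n, Measurable fun S => e S n)
    (he' : ∀ᵐ S ∂palm Q, Function.Injective (e S) ∧ Set.range (e S) = S.carrier)
    -- the direction and the initial surface
    (u : Pt d) (hu : ‖u‖ = 1)
    (γ : Pt d → Config (Pt d) → ℝ) (hγ : IsCovariant (grad id γ))
    (hγH : MemH (palm Q) id (grad id γ)) :
    MemH (palm Q) id (omega id u) ∧
    ∀ t : ℝ, 0 ≤ t →
      (∀ᵐ z : Config (Pt d) × Ω ∂(palm Q).prod P, ∀ s ∈ z.1, Summable fun s' : ↥z.1.carrier =>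
        transProb z.1 (clock e (fun n => T n z.2) z.1) t s s' * γ s' z.1) ∧
      MemH ((palm Q).prod P) Prod.fst (grad Prod.fst (harness e T γ t)) ∧
      tilt ((palm Q).prod P) Prod.fst u (harness e T γ t) = tilt (palm Q) id u γ := by
  have hE := ae_palm_isEnumeration hQ he'
  obtain ⟨Fp, Fm, ⟨hFp, hFpc, hp, hNp⟩, ⟨hFm, hFmc, hm, hNm⟩, hF⟩ :=
    exists_measurable_parts hQ hγ hγH
  refine ⟨memH_omega hQ hu, fun t ht => ?_⟩
  have h := ae_prod_hasSum_harness hQ.stationary hT hTindep he hE ht hFp hFpc hNp hFm hFmc hNm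
    hp hm hF
  exact ⟨h.mono fun z hz s hs => (hz s hs).1.summable,
    memH_grad_harness_and_tilt_eq hQ hT hTindep he hE ht hu hFp hFpc hNp hFm hFmc hNm hF
      (h.mono fun z hz s hs => (hz s hs).2)⟩
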